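/- Let $d\geq 1$ and $\gamma\geq 1$ be integers, let $\mathbb T=\mathbb R/2\pi\mathbb Z$, and let $0<s<\frac{1+\gamma}{2}$. Let $-\Delta_\gamma=-\Delta_x-|x|^{2\gamma}\Delta_y$ be the Baouendi–Grushin operator in $L^2(\mathbb R^d\times\mathbb T^d)$ with its maximal domain $\{f\in L^2 : \Delta_\gamma f\in L^2 \text{ in the sense of distributions}\}$; it is a non-negative selfadjoint operator, so that the semigroup $e^{-t(-\Delta_\gamma)^s}$, $t\geq 0$, is defined by functional calculus. Let $\omega\subset\mathbb R^d\times\mathbb T^d$ be a (Lebesgue) measurable set with $\overline\omega\cap\{(x,y) : x=0\}=\emptyset$. Then for no $T>0$ is the equation $$\partial_t f+(-\Delta_\gamma)^s f=h\,\mathbf 1_\omega,\qquad f(0)=f_0\in L^2(\mathbb R^d\times\mathbb T^d),$$ exactly null-controllable from $\omega$ in time $T$. That is, for every $T>0$ it is not true that for every $f_0\in L^2(\mathbb R^d\times\mathbb T^d)$ there exists a control $h\in L^2((0,T)\times\mathbb R^d\times\mathbb T^d)$ for which the mild solution $$f(t)=e^{-t(-\Delta_\gamma)^s}f_0+\int_0^t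 e^{-(t-\tau)(-\Delta_\gamma)^s}\bigl(\mathbf 1_\omega h(\tau)\bigr)\,d\tau$$ satisfies $f(T)=0$. -/

import Mathlib

open MeasureTheory Set

noncomputable section

namespace BaouendiGrushin

/-! ### Abstract part: functional calculus, mild solutions, exact null-controllability -/

section Abstract

variable {H : Type*} [NormedAddCommGroup H] [InnerProductSpace ℂ H] [CompleteSpace H]

/-- An (unbounded) operator `A` in `H` is given by its graph `G = {(f, A f) | f ∈ D(A)}`.
`IsResolvent G R` says that the bounded operator `R` is `(1 + A)⁻¹`:
for all `f, g` one has `f ∈ D(A)` and `f + A f = g` if and only if `R g = f`. -/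
def IsResolvent (G : Set (H × H)) (R : H →L[ℂ] H) : Prop :=
  ∀ f g : H, (f, g - f) ∈ G ↔ R g = f

open Classical in
/-- The bounded operator `(1 + A)⁻¹`, where `A` is the operator with graph `G`. It is unique when it
exists (the value `0` otherwise), and it exists if `A` is non-negative and selfadjoint. -/
def resolventOp (G : Set (H × H)) : H →L[ℂ] H :=
  if h : ∃ R : H →L[ℂ] H, IsResolvent G R then h.choose else 0

/-- The operator `F(A)` for a non-negative selfadjoint operator `A` with graph `G` and a continuous
function `F : [0, ∞) → ℝ` vanishing at infinity: writing `R = (1 + A)⁻¹` (a bounded selfadjoint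
operator with spectrum in `[0, 1]`), one has `A = R⁻¹ - 1` and hence `F(A) = Φ(R)` with
`Φ(r) = F(1 / r - 1)` for `r ∈ (0, 1]` and `Φ(0) = 0`. -/
def funCalc (G : Set (H × H)) (F : ℝ → ℝ) : H →L[ℂ] H :=
  cfc (fun r : ℝ => if 0 < r then F (1 / r - 1) else 0) (resolventOp G)

/-- The semigroup `e^{-t A^s}`, `t ≥ 0`, for a non-negative selfadjoint operator `A` with
graph `G` and a real number `s > 0`. -/
def fracSemigroup (G : Set (H × H)) (s t : ℝ) : H →L[ℂ] H :=
  if t = 0 then 1 else funCalc G (fun l => Real.exp (-t * l ^ s))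

/-- The mild solution `f(t) = S(t) f₀ + ∫₀ᵗ S(t - τ) u(τ) dτ` of `∂ₜ f + P f = u`, `f(0) = f₀`,
where `S(t) = e^{-t P}`. -/
def mildSolution (S : ℝ → H →L[ℂ] H) (f₀ : H) (u : ℝ → H) (t : ℝ) : H :=
  S t f₀ + ∫ τ in (0 : ℝ)..t, S (t - τ) (u τ)

end Abstract

section Control

variable {X : Type*} [MeasurableSpace X] {μ : Measure X}

lemma memLp_indicator {ω : Set X} (hω : NullMeasurableSet ω μ) (u : Lp ℂ 2 μ) :
    MemLp (ω.indicator u) 2 μ :=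
  (Lp.memLp u).of_le ((Lp.aestronglyMeasurable u).indicator₀ hω)
    (Filter.Eventually.of_forall fun _ => norm_indicator_le_norm_self _ _)

/-- The function `𝟙_ω u` for `u ∈ L²(X)`. -/
def cutoff {ω : Set X} (hω : NullMeasurableSet ω μ) (u : Lp ℂ 2 μ) : Lp ℂ 2 μ :=
  (memLp_indicator hω u).toLp (ω.indicator u)

/-- Exact null-controllability from the control support `ω` in time `T` of
`∂ₜ f + P f = h 𝟙_ω`, `f(0) = f₀ ∈ L²(X)`, where `S(t) = e^{-t P}`:
for every `f₀ ∈ L²(X)` there is a control `h ∈ L²((0,T) × X) = L²((0,T); L²(X))` such that the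
mild solution vanishes at time `T`. -/
def ExactlyNullControllable (S : ℝ → Lp ℂ 2 μ →L[ℂ] Lp ℂ 2 μ) {ω : Set X}
    (hω : NullMeasurableSet ω μ) (T : ℝ) : Prop :=
  ∀ f₀ : Lp ℂ 2 μ, ∃ h : ℝ → Lp ℂ 2 μ, MemLp h 2 (volume.restrict (Ioo 0 T)) ∧
    mildSolution S f₀ (fun τ => cutoff hω (h τ)) T = 0

end Control

/-! ### The Baouendi-Grushin operator on `ℝ^d × 𝕋^d` -/

instance fact_two_pi_pos : Fact (0 < 2 * Real.pi) := ⟨Real.two_pi_pos⟩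

/-- The Euclidean space `ℝ^d`. -/
abbrev E (d : ℕ) : Type := EuclideanSpace ℝ (Fin d)

/-- The torus `𝕋^d = (ℝ / 2πℤ)^d`. -/
abbrev Torus (d : ℕ) : Type := Fin d → AddCircle (2 * Real.pi)

/-- The space `ℝ^d × 𝕋^d`, with the product topology and the product of the Lebesgue measures. -/
abbrev Space (d : ℕ) : Type := E d × Torus d

/-- The covering map `ℝ^d → 𝕋^d`. -/
def toTorus (d : ℕ) (v : E d) : Torus d := fun i => (v i : AddCircle (2 * Real.pi))

/-- `φ ∈ C_c^∞(ℝ^d × 𝕋^d)`; smoothness is read off after lifting to `ℝ^d × ℝ^d`. -/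
structure IsTestFunction (d : ℕ) (φ : Space d → ℂ) : Prop where
  smooth : ContDiff ℝ ((⊤ : ℕ∞) : WithTop ℕ∞) (fun p : E d × E d => φ (p.1, toTorus d p.2))
  compactSupport : HasCompactSupport φ

/-- `Δ_γ φ = Δ_x φ + |x|^{2γ} Δ_y φ` for smooth `φ`. -/
def grushinLaplacian (d γ : ℕ) (φ : Space d → ℂ) (p : Space d) : ℂ :=
  Laplacian.laplacian (fun x : E d => φ (x, p.2)) p.1
    + ((‖p.1‖ ^ (2 * γ) : ℝ) : ℂ)
      * Laplacian.laplacian (fun v : E d => φ (p.1, p.2 + toTorus d v)) 0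

/-- The Hilbert space `L²(ℝ^d × 𝕋^d)`. -/
abbrev L2 (d : ℕ) : Type := Lp ℂ 2 (volume : Measure (Space d))

/-- The graph of the operator `-Δ_γ` in `L²(ℝ^d × 𝕋^d)` with its maximal domain: `f ∈ L²` is in
the domain and `-Δ_γ f = g` if the distribution `-Δ_γ f` is given by the function `g ∈ L²`. -/
def grushinGraph (d γ : ℕ) : Set (L2 d × L2 d) :=
  {fg | ∀ φ : Space d → ℂ, IsTestFunction d φ →
    ∫ p, fg.1 p * (-grushinLaplacian d γ φ p) = ∫ p, fg.2 p * φ p}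

/-- The semigroup `e^{-t (-Δ_γ)^s}` on `L²(ℝ^d × 𝕋^d)`. -/
def grushinSemigroup (d γ : ℕ) (s : ℝ) : ℝ → L2 d →L[ℂ] L2 d :=
  fracSemigroup (grushinGraph d γ) s

end BaouendiGrushin

end

/-! Suppose the equation is null-controllable. Pairing f(T) = 0 with an eigenfunction v of -Δ_γ for
the eigenvalue m gives |⟨v, f₀⟩| ≤ e^{T m^s} ‖1_ω v‖ ∫‖h‖ (`norm_inner_le_of_controlled`). There are
eigenfunctions v_N = U(N²|x|²) e^{i N^{γ+1} y₁} with eigenvalue λN², squared norm K/N^d and ‖1_ω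
v_N‖ ≤ A e^{-c N^{γ+1}} (`exists_concentrating_eigenfunctions`): they concentrate at x = 0, which ω
avoids. Since 2s < γ+1, the growth e^{T λ^s N^{2s}} loses against e^{-c N^{γ+1}}. Hence suitably
rescaled functionals ⟨v_N, ·⟩ are bounded at each f₀ while their norms are unbounded, contradicting
Banach–Steinhaus.

Two ingredients need work. The first is that the maximal operator is really selfadjoint, so that the
semigroup is the intended one and acts on v_N by e^{-t m^s} (`exists_isResolvent_grushinGraph`,
`fracSemigroup_apply_of_mem`). This amounts to essential selfadjointness on test functions: 1 - Δ_γ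
must have dense range there. Fourier series in y reduce this to the Schrödinger operators -Δ + 1 +
|n|²|x|^{2γ}, for which mollification and a cut-off energy estimate show that square integrable weak
solutions vanish (`ae_eq_zero_of_weak`).

The second is a radial ground state of -Δ + |x|^{2γ} with decay e^{-κ|x|^{γ+1}}
(`exists_ground_state`). No spectral theory is used for it. The regular solution of the radial
equation is an entire power series in |x|², and λ is the largest energy for which that solution
stays non-negative. Maximality forces the solution to decrease in the region r^{2γ} > λ, and a
first-order comparison then yields the decay (`IsRadial.exists_decay`). -/

open MeasureTheory Set

noncomputable section

namespace BaouendiGrushin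

/-! ### Calculus and integration by parts on a group covered by a normed space. -/

section Covering

open Topology Filter
open scoped ContDiff ComplexConjugate

variable {W G : Type*} [NormedAddCommGroup W] [NormedSpace ℝ W] [AddCommGroup G]

/-- The derivative of `F` at `g` in the direction `w`, read through the homomorphism `π : W → G`. -/
def dirDeriv (π : W →+ G) (w : W) (F : G → ℂ) (g : G) : ℂ :=
  deriv (fun t : ℝ => F (g + π (t • w))) 0

/-- Smoothness of a function on `G`, read off after lifting it along `π : W → G`. -/
def SmoothVia (π : W →+ G) (F : G → ℂ) : Prop := ContDiff ℝ ∞ (F ∘ π)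

variable {π : W →+ G} {F F₁ F₂ : G → ℂ} {w : W}

lemma dirDeriv_map (hF : SmoothVia π F) (x : W) :
    dirDeriv π w F (π x) = fderiv ℝ (F ∘ π) x w := by
  have h1 : HasFDerivAt (F ∘ π) (fderiv ℝ (F ∘ π) x) (x + (0 : ℝ) • w) := by
    simpa using (hF.differentiable (by simp) x).hasFDerivAt
  have h2 : HasDerivAt (fun t : ℝ => x + t • w) w 0 := by
    simpa using ((hasDerivAt_id (0 : ℝ)).smul_const w).const_add x
  have := h1.comp_hasDerivAt (0 : ℝ) h2
  rw [dirDeriv, ← this.deriv]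
  congr 1
  ext t
  simp

lemma comp_dirDeriv (hF : SmoothVia π F) :
    dirDeriv π w F ∘ π = fun x => fderiv ℝ (F ∘ π) x w :=
  funext fun x => dirDeriv_map hF x

lemma SmoothVia.dirDeriv (hF : SmoothVia π F) (w : W) : SmoothVia π (dirDeriv π w F) := by
  unfold SmoothVia
  rw [comp_dirDeriv hF]
  exact (ContDiff.fderiv_right (m := ∞) hF (by simp)).clm_apply contDiff_const

lemma SmoothVia.mul (h₁ : SmoothVia π F₁) (h₂ : SmoothVia π F₂) :
    SmoothVia π (fun g => F₁ g * F₂ g) := ContDiff.mul h₁ h₂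

lemma SmoothVia.add (h₁ : SmoothVia π F₁) (h₂ : SmoothVia π F₂) :
    SmoothVia π (fun g => F₁ g + F₂ g) := ContDiff.add h₁ h₂

lemma SmoothVia.const_mul (h₁ : SmoothVia π F) (c : ℂ) :
    SmoothVia π (fun g => c * F g) := ContDiff.mul contDiff_const h₁

lemma SmoothVia.conj (h : SmoothVia π F) : SmoothVia π (fun g => conj (F g)) :=
  Complex.conjCLE.contDiff.comp h

lemma SmoothVia.sum {ι : Type*} (s : Finset ι) {F : ι → G → ℂ}
    (h : ∀ i ∈ s, SmoothVia π (F i)) : SmoothVia π (fun g => ∑ i ∈ s, F i g) := by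
  unfold SmoothVia
  have : (fun g => ∑ i ∈ s, F i g) ∘ π = fun x => ∑ i ∈ s, (F i ∘ π) x := by ext; simp
  rw [this]
  exact ContDiff.sum h

lemma SmoothVia.differentiable (h : SmoothVia π F) : Differentiable ℝ (F ∘ π) :=
  ContDiff.differentiable h (by simp)

/-- Along each line, a smooth function has the expected derivative. -/
lemma SmoothVia.hasDerivAt (hπ : Function.Surjective π) (hF : SmoothVia π F) (g : G) (w : W)
    (t : ℝ) : HasDerivAt (fun t : ℝ => F (g + π (t • w))) (BaouendiGrushin.dirDeriv π w F (g + π (t • w))) t := by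
  obtain ⟨x, rfl⟩ := hπ g
  rw [← map_add, dirDeriv_map hF]
  have h2 : HasDerivAt (fun t : ℝ => x + t • w) w t := by
    simpa using ((hasDerivAt_id t).smul_const w).const_add x
  have := (hF.differentiable (x + t • w)).hasFDerivAt.comp_hasDerivAt t h2
  simpa [Function.comp_def] using this

lemma SmoothVia.hasDerivAt_zero (hπ : Function.Surjective π) (hF : SmoothVia π F) (g : G) (w : W) :
    HasDerivAt (fun t : ℝ => F (g + π (t • w))) (BaouendiGrushin.dirDeriv π w F g) 0 := by
  simpa using hF.hasDerivAt hπ g w 0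

lemma dirDeriv_mul (hπ : Function.Surjective π) (h₁ : SmoothVia π F₁) (h₂ : SmoothVia π F₂)
    (g : G) : dirDeriv π w (fun g => F₁ g * F₂ g) g =
      dirDeriv π w F₁ g * F₂ g + F₁ g * dirDeriv π w F₂ g := by
  have := ((h₁.hasDerivAt_zero hπ g w).mul (h₂.hasDerivAt_zero hπ g w)).deriv
  simpa [dirDeriv, Pi.mul_def] using this

lemma dirDeriv_add (hπ : Function.Surjective π) (h₁ : SmoothVia π F₁) (h₂ : SmoothVia π F₂)
    (g : G) : dirDeriv π w (fun g => F₁ g + F₂ g) g = dirDeriv π w F₁ g + dirDeriv π w F₂ g := by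
  have := ((h₁.hasDerivAt_zero hπ g w).add (h₂.hasDerivAt_zero hπ g w)).deriv
  simpa [dirDeriv, Pi.add_def] using this

lemma dirDeriv_const_mul (c : ℂ) (g : G) :
    dirDeriv π w (fun g => c * F g) g = c * dirDeriv π w F g := by
  simp [dirDeriv, deriv_const_mul_field]

lemma dirDeriv_conj (hπ : Function.Surjective π) (h : SmoothVia π F) (g : G) :
    dirDeriv π w (fun g => conj (F g)) g = conj (dirDeriv π w F g) := by
  have := (h.hasDerivAt_zero hπ g w)
  exact (this.star).deriv

/-- If `F` does not change along the direction `w`, then it behaves like a constant. -/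
lemma dirDeriv_mul_of_invariant (hF₁ : ∀ g (t : ℝ), F₁ (g + π (t • w)) = F₁ g) (g : G) :
    dirDeriv π w (fun g => F₁ g * F₂ g) g = F₁ g * dirDeriv π w F₂ g := by
  simp [dirDeriv, deriv_const_mul_field, hF₁]

variable [TopologicalSpace G]

lemma SmoothVia.continuous (hπ : IsOpenQuotientMap π) (hF : SmoothVia π F) : Continuous F := by
  rw [hπ.isQuotientMap.continuous_iff]
  exact ContDiff.continuous hF

lemma dirDeriv_of_notMem_tsupport [IsTopologicalAddGroup G] (hπ : IsOpenQuotientMap π) {g : G}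
    (hg : g ∉ tsupport F) : dirDeriv π w F g = 0 := by
  rw [notMem_tsupport_iff_eventuallyEq] at hg
  have hc : ContinuousAt (fun t : ℝ => g + π (t • w)) 0 :=
    (continuous_const.add (hπ.continuous.comp (by fun_prop))).continuousAt
  have h2 : ∀ᶠ t : ℝ in 𝓝 0, F (g + π (t • w)) = 0 := by
    have := hc.tendsto
    simp only [zero_smul, map_zero, add_zero] at this
    exact this.eventually hg
  rw [dirDeriv, EventuallyEq.deriv_eq (f := fun _ => (0 : ℂ)) h2]
  simp

lemma tsupport_dirDeriv_subset [IsTopologicalAddGroup G] (hπ : IsOpenQuotientMap π) :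
    tsupport (dirDeriv π w F) ⊆ tsupport F := by
  refine closure_minimal (fun g hg => ?_) (isClosed_tsupport F)
  by_contra h
  exact hg (dirDeriv_of_notMem_tsupport hπ h)

lemma hasCompactSupport_dirDeriv [IsTopologicalAddGroup G] (hπ : IsOpenQuotientMap π)
    (hF : HasCompactSupport F) : HasCompactSupport (dirDeriv π w F) :=
  hF.of_isClosed_subset (isClosed_tsupport _) (tsupport_dirDeriv_subset hπ)

variable [IsTopologicalAddGroup G] [T2Space G] [MeasurableSpace G] [BorelSpace G] {μ : Measure G}
  [IsFiniteMeasureOnCompacts μ] [μ.IsAddLeftInvariant]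

/-- The integral of a derivative of a compactly supported smooth function vanishes. -/
lemma integral_dirDeriv_eq_zero (hπ : IsOpenQuotientMap π) (hF : SmoothVia π F)
    (hc : HasCompactSupport F) (w : W) : ∫ g, dirDeriv π w F g ∂μ = 0 := by
  set D := dirDeriv π w F with hD
  have hDc : HasCompactSupport D := hasCompactSupport_dirDeriv hπ hc
  have hDcont : Continuous D := (hF.dirDeriv w).continuous hπ
  obtain ⟨C, hC⟩ := hDcont.bounded_above_of_compact_support hDc
  -- `K` collects the points whose translates by π(t w), |t| ≤ 1, can meet the support of the
  -- derivative, so C·1_K dominates uniformly in t.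
  let m : ℝ × G → G := fun q => q.2 - π (q.1 • w)
  have hm : Continuous m := continuous_snd.sub (hπ.continuous.comp (by fun_prop))
  set K : Set G := m '' (Icc (-1 : ℝ) 1 ×ˢ tsupport D) with hK
  have hKc : IsCompact K := (isCompact_Icc.prod hDc).image hm
  have hline : ∀ g : G, Continuous (fun t : ℝ => g + π (t • w)) := fun g =>
    continuous_const.add (hπ.continuous.comp (by fun_prop))
  have key := hasDerivAt_integral_of_dominated_loc_of_deriv_le (μ := μ)
    (F := fun (t : ℝ) g => F (g + π (t • w))) (F' := fun (t : ℝ) g => D (g + π (t • w)))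
    (bound := K.indicator fun _ => C) (x₀ := (0 : ℝ)) (s := Ioo (-1) 1)
    (Ioo_mem_nhds (by norm_num) (by norm_num)) ?_ ?_ ?_ ?_ ?_ ?_
  -- By invariance of the measure the integral does not depend on t, so its derivative at 0, which
  -- is the integral sought, vanishes.
  · have h1 : (fun t : ℝ => ∫ g, F (g + π (t • w)) ∂μ) = fun _ => ∫ g, F g ∂μ := by
      ext t
      exact integral_add_right_eq_self F _
    have := key.2
    rw [h1] at this
    simpa using this.unique (hasDerivAt_const _ _)
  · refine Eventually.of_forall fun t => ?_
    exact (((hF.continuous hπ).comp (continuous_add_const _)).stronglyMeasurable_of_hasCompactSupport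
      (hc.comp_homeomorph (Homeomorph.addRight (π (t • w))))).aestronglyMeasurable
  · simpa using (hF.continuous hπ).integrable_of_hasCompactSupport hc
  · simpa using (hDcont.integrable_of_hasCompactSupport hDc (μ := μ)).aestronglyMeasurable
  · refine Eventually.of_forall fun g t ht => ?_
    by_cases hg : g ∈ K
    · rw [indicator_of_mem hg]
      exact hC _
    · rw [indicator_of_notMem hg]
      refine le_of_eq ?_
      rw [norm_eq_zero]
      by_contra h
      exact hg ⟨(t, g + π (t • w)), ⟨⟨ht.1.le, ht.2.le⟩, subset_tsupport _ h⟩, by simp [m]⟩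
  · exact (integrable_indicator_iff hKc.measurableSet).2 (integrableOn_const hKc.measure_lt_top.ne)
  · exact Eventually.of_forall fun g t _ => hF.hasDerivAt hπ.surjective g w t

lemma integral_mul_dirDeriv (hπ : IsOpenQuotientMap π) (h₁ : SmoothVia π F₁)
    (h₂ : SmoothVia π F₂) (hc : HasCompactSupport F₂) (w : W) :
    ∫ g, F₁ g * dirDeriv π w F₂ g ∂μ = - ∫ g, dirDeriv π w F₁ g * F₂ g ∂μ := by
  have h := integral_dirDeriv_eq_zero (μ := μ) hπ (h₁.mul h₂) (hc.mul_left (f := F₁)) w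
  simp_rw [dirDeriv_mul hπ.surjective h₁ h₂] at h
  rw [integral_add] at h
  · linear_combination h
  · exact (((h₁.dirDeriv w).mul h₂).continuous hπ).integrable_of_hasCompactSupport hc.mul_left
  · exact ((h₁.mul (h₂.dirDeriv w)).continuous hπ).integrable_of_hasCompactSupport
      (hasCompactSupport_dirDeriv hπ hc).mul_left

/-- Second derivatives may be moved to the other factor. -/
lemma integral_mul_dirDeriv_dirDeriv (hπ : IsOpenQuotientMap π) (h₁ : SmoothVia π F₁)
    (h₂ : SmoothVia π F₂) (hc : HasCompactSupport F₂) (w : W) :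
    ∫ g, F₁ g * dirDeriv π w (dirDeriv π w F₂) g ∂μ =
      ∫ g, dirDeriv π w (dirDeriv π w F₁) g * F₂ g ∂μ := by
  rw [integral_mul_dirDeriv hπ h₁ (h₂.dirDeriv w) (hasCompactSupport_dirDeriv hπ hc),
    integral_mul_dirDeriv hπ (h₁.dirDeriv w) h₂ hc, neg_neg]

end Covering

/-! ### Resolvents, functional calculus and eigenvectors. -/

section FunctionalCalculus

open Topology Filter
open scoped ComplexConjugate InnerProductSpace

variable {H : Type*} [NormedAddCommGroup H] [InnerProductSpace ℂ H]

lemma re_inner_self (x : H) : (⟪x, x⟫_ℂ).re = ‖x‖ ^ 2 := inner_self_eq_norm_sq (𝕜 := ℂ) x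

lemma mem_spectrum_of_apply_eq_smul {R : H →L[ℂ] H} {κ : ℝ} {v : H} (hv : v ≠ 0)
    (h : R v = (κ : ℂ) • v) : κ ∈ spectrum ℝ R := by
  rw [spectrum.mem_iff]
  intro hu
  obtain ⟨u, hu⟩ := hu
  have h0 : (u : H →L[ℂ] H) v = 0 := by
    rw [hu]
    simp [Algebra.algebraMap_eq_smul_one, h]
  have : (↑u⁻¹ * (u : H →L[ℂ] H)) v = 0 := by
    simp only [mul_apply_eq_comp, h0, map_zero]
  rw [Units.inv_mul] at this
  exact hv (by simpa using this)

lemma IsResolvent.unique {G : Set (H × H)} {R R' : H →L[ℂ] H} (h : IsResolvent G R)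
    (h' : IsResolvent G R') : R = R' := by
  ext g
  exact (h' (R g) g).1 ((h (R g) g).2 rfl) |>.symm

/-- Once some resolvent is exhibited, uniqueness removes both the arbitrary choice and the default
value 0 from the definition. -/
lemma IsResolvent.resolventOp_eq {G : Set (H × H)} {R : H →L[ℂ] H} (h : IsResolvent G R) :
    resolventOp G = R := by
  have hex : ∃ R : H →L[ℂ] H, IsResolvent G R := ⟨R, h⟩
  rw [resolventOp, dif_pos hex]
  exact hex.choose_spec.unique h

variable [CompleteSpace H]

/-- The functional calculus acts on eigenvectors in the expected way. -/
lemma cfc_apply_of_apply_eq_smul {R : H →L[ℂ] H} (hR : IsSelfAdjoint R) {κ : ℝ} {v : H}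
    (h : R v = (κ : ℂ) • v) {f : ℝ → ℝ} (hf : ContinuousOn f (spectrum ℝ R)) :
    cfc f R v = (f κ : ℂ) • v := by
  rcases eq_or_ne v 0 with rfl | hv
  · simp
  have hκ := mem_spectrum_of_apply_eq_smul hv h
  -- The identity holds for constants and for the coordinate function and survives sums, products
  -- and uniform limits, hence holds on all of C(spectrum) by Stone–Weierstrass.
  have key : ∀ g : C(spectrum ℝ R, ℝ), cfcHom (R := ℝ) hR g v = (g ⟨κ, hκ⟩ : ℂ) • v := by
    intro g
    induction g using ContinuousMap.induction_on_of_compact with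
    | const r =>
      have : (ContinuousMap.const (spectrum ℝ R) r) = algebraMap ℝ C(spectrum ℝ R, ℝ) r := rfl
      rw [this, AlgHomClass.commutes]
      simp [Algebra.algebraMap_eq_smul_one]
    | id =>
      rw [show (ContinuousMap.restrict (spectrum ℝ R) (ContinuousMap.id ℝ)) = 
        (ContinuousMap.id ℝ).restrict (spectrum ℝ R) from rfl, cfcHom_id hR, h]
      simp
    | star_id =>
      rw [map_star, cfcHom_id hR, hR.star_eq, h]
      simp
    | add f g hf hg => simp [hf, hg, add_smul]
    | mul f g hf hg =>
      rw [map_mul, mul_apply_eq_comp, hg, map_smul, hf, smul_smul, ContinuousMap.mul_apply,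
        Complex.ofReal_mul, mul_comm]
    | frequently f hf =>
      have hc : IsClosed {g : C(spectrum ℝ R, ℝ) |
          cfcHom (R := ℝ) hR g v = (g ⟨κ, hκ⟩ : ℂ) • v} := by
        refine isClosed_eq ?_ ?_
        · exact (ContinuousLinearMap.apply ℂ H v).continuous.comp (cfcHom_continuous hR)
        · have : Continuous fun g : C(spectrum ℝ R, ℝ) => g ⟨κ, hκ⟩ :=
            continuous_eval_const _
          exact (Complex.continuous_ofReal.comp this).smul continuous_const
      exact hc.mem_of_frequently_of_tendsto hf tendsto_id
  rw [cfc_apply f R hR hf, key]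
  rfl

/-- The symbol `r ↦ F (1 / r - 1)` of the semigroup is continuous on `[0, 1]`. -/
lemma continuousOn_symbol {s t : ℝ} (hs : 0 < s) (ht : 0 < t) :
    ContinuousOn (fun r : ℝ => if 0 < r then Real.exp (-t * (1 / r - 1) ^ s) else 0) (Icc 0 1) := by
  intro r hr
  rcases hr.1.eq_or_lt with rfl | h0
  · rw [ContinuousWithinAt]
    simp only [lt_irrefl, if_false]
    -- As r ↓ 0 the energy 1/r - 1 tends to infinity, so s, t > 0 make the default value 0 the
    -- correct limit.
    have h1 : Tendsto (fun r : ℝ => Real.exp (-t * (1 / r - 1) ^ s)) (𝓝[>] 0) (𝓝 0) := by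
      refine Real.tendsto_exp_atBot.comp ?_
      refine Tendsto.const_mul_atTop_of_neg (by linarith) ?_
      refine (tendsto_rpow_atTop hs).comp ?_
      simp only [one_div]
      exact tendsto_atTop_add_const_right _ _ tendsto_inv_nhdsGT_zero
    have h2 : Tendsto (fun r : ℝ => if 0 < r then Real.exp (-t * (1 / r - 1) ^ s) else 0)
        (𝓝[≥] 0) (𝓝 0) := by
      rw [← Ioi_insert, nhdsWithin_insert, tendsto_sup]
      refine ⟨?_, h1.congr' ?_⟩
      · rw [tendsto_pure_left]
        intro s hs
        simpa using mem_of_mem_nhds hs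
      · filter_upwards [self_mem_nhdsWithin] with r hr
        rw [if_pos (mem_Ioi.1 hr)]
    exact h2.mono_left (nhdsWithin_mono _ Icc_subset_Ici_self)
  · have h3 : ContinuousAt (fun r : ℝ => Real.exp (-t * (1 / r - 1) ^ s)) r := by
      have : ContinuousAt (fun r : ℝ => (1 / r - 1)) r :=
        (continuousAt_const.div continuousAt_id h0.ne').sub continuousAt_const
      -- The base 1/r - 1 vanishes at r = 1, so continuity of the power rests on s ≥ 0.
      exact (continuousAt_const.mul (this.rpow_const (Or.inr hs.le))).rexp
    refine ContinuousAt.continuousWithinAt (h3.congr ?_)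
    filter_upwards [lt_mem_nhds h0] with x hx
    rw [if_pos hx]

/-- A symmetric non-negative operator `L`, given by its graph `D`, such that `1 + L` has dense range,
has a selfadjoint adjoint `G`, with a non-negative resolvent of norm at most one. -/
theorem exists_isResolvent (D : Submodule ℂ (H × H)) (G : Set (H × H))
    (hG : ∀ f g : H, (f, g) ∈ G ↔ ∀ p ∈ D, ⟪p.2, f⟫_ℂ = ⟪p.1, g⟫_ℂ)
    (hsymm : ∀ p ∈ D, ∀ q ∈ D, ⟪p.2, q.1⟫_ℂ = ⟪p.1, q.2⟫_ℂ)
    (hnonneg : ∀ p ∈ D, 0 ≤ (⟪p.1, p.2⟫_ℂ).re)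
    (hdense : ∀ f : H, (∀ p ∈ D, ⟪p.1 + p.2, f⟫_ℂ = 0) → f = 0) :
    ∃ R : H →L[ℂ] H, IsResolvent G R ∧ IsSelfAdjoint R ∧ spectrum ℝ R ⊆ Icc 0 1 := by
  -- On the graph of L, `a` gives f and `e` gives f + L f. The resolvent is the continuous extension
  -- of e(p) ↦ a(p) from the dense range of `e`.
  let a : D →ₗ[ℂ] H := LinearMap.fst ℂ H H ∘ₗ D.subtype
  let e : D →ₗ[ℂ] H := (LinearMap.fst ℂ H H + LinearMap.snd ℂ H H) ∘ₗ D.subtype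
  have ha : ∀ p : D, a p = p.1.1 := fun _ => rfl
  have he : ∀ p : D, e p = p.1.1 + p.1.2 := fun _ => rfl
  have hd : DenseRange e := by
    have : (LinearMap.range e).topologicalClosure = ⊤ := by
      rw [Submodule.topologicalClosure_eq_top_iff, Submodule.eq_bot_iff]
      intro f hf
      refine hdense f fun p hp => ?_
      exact (Submodule.mem_orthogonal _ _).1 hf _ ⟨⟨p, hp⟩, rfl⟩
    rw [DenseRange, ← LinearMap.coe_range]
    exact Submodule.dense_iff_topologicalClosure_eq_top.2 this
  have hbound : ∀ p : D, ‖a p‖ ≤ 1 * ‖e p‖ := by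
    intro p
    rw [one_mul, ha, he]
    by_contra! hlt
    have h1 := hnonneg p.1 p.2
    have h2 : ‖p.1.1‖ ^ 2 ≤ (⟪p.1.1, p.1.1 + p.1.2⟫_ℂ).re := by
      -- Non-negativity gives ‖f‖² ≤ Re⟨f, f + L f⟩, whence ‖f‖ ≤ ‖f + L f‖ by Cauchy–Schwarz.
      rw [inner_add_right, Complex.add_re, re_inner_self]
      linarith
    have h3 : (⟪p.1.1, p.1.1 + p.1.2⟫_ℂ).re ≤ ‖p.1.1‖ * ‖p.1.1 + p.1.2‖ :=
      (Complex.re_le_norm _).trans (norm_inner_le_norm _ _)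
    nlinarith [norm_nonneg (p.1.1 + p.1.2)]
  let R : H →L[ℂ] H := a.extendOfNorm e
  have hRe : ∀ p : D, R (e p) = a p := a.extendOfNorm_eq hd ⟨1, hbound⟩
  have hR1 : ∀ x, ‖R x‖ ≤ 1 * ‖x‖ := a.norm_extendOfNorm_apply_le hd 1 hbound
  have hsym : ∀ x y, ⟪R x, y⟫_ℂ = ⟪x, R y⟫_ℂ := by
    intro x y
    refine hd.induction_on₂ (p := fun x y => ⟪R x, y⟫_ℂ = ⟪x, R y⟫_ℂ) ?_ ?_ x y
    · exact isClosed_eq (by fun_prop) (by fun_prop)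
    · intro p q
      rw [hRe, hRe, ha, ha, he, he, inner_add_left, inner_add_right, hsymm _ p.2 _ q.2]
  have hsa : IsSelfAdjoint R := by
    rw [ContinuousLinearMap.isSelfAdjoint_iff_isSymmetric]
    exact hsym
  have hpos : R.IsPositive := by
    refine (ContinuousLinearMap.isPositive_iff_complex R).2 fun x => ?_
    have him : ((⟪R x, x⟫_ℂ).re : ℂ) = ⟪R x, x⟫_ℂ := by
      refine Complex.conj_eq_iff_re.1 ?_
      rw [inner_conj_symm, hsym]
    refine ⟨him, ?_⟩
    refine hd.induction_on (p := fun x => 0 ≤ (⟪R x, x⟫_ℂ).re) x ?_ ?_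
    · exact isClosed_le continuous_const (by fun_prop)
    · intro p
      rw [hRe, ha, he, inner_add_right, Complex.add_re, re_inner_self]
      exact add_nonneg (sq_nonneg _) (hnonneg _ p.2)
  refine ⟨R, ?_, hsa, ?_⟩
  · intro f g
    rw [hG]
    constructor
    · intro h
      -- Membership of (f, g - f) in the adjoint graph says ⟨e p, f⟩ = ⟨a p, g⟩ = ⟨R(e p), g⟩ = ⟨e
      -- p, R g⟩ for every p, and the vectors e p are dense.
      refine hd.eq_of_inner_right ℂ fun p => ?_
      have := h p p.2
      rw [← hsym, hRe, ha, he, inner_add_left, this, inner_sub_right]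
      ring
    · rintro rfl p hp
      have h1 := hRe ⟨p, hp⟩
      rw [ha, he] at h1
      have h2 := hsym (p.1 + p.2) g
      rw [h1, inner_add_left] at h2
      rw [inner_sub_right, h2]
      ring
  · intro r hr
    refine ⟨?_, ?_⟩
    · exact spectrum_nonneg_of_nonneg ((ContinuousLinearMap.nonneg_iff_isPositive R).2 hpos) hr
    · have h1 := spectrum.norm_le_norm_mul_of_mem hr
      have h2 : ‖R‖ ≤ 1 := R.opNorm_le_bound zero_le_one hR1
      have h3 : ‖(1 : H →L[ℂ] H)‖ ≤ 1 := ContinuousLinearMap.norm_id_le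
      have h4 : ‖R‖ * ‖(1 : H →L[ℂ] H)‖ ≤ 1 := mul_le_one₀ h2 (norm_nonneg _) h3
      exact (le_abs_self r).trans (h1.trans h4)

/-- The semigroup is selfadjoint. -/
lemma isSelfAdjoint_fracSemigroup (G : Set (H × H)) (s t : ℝ) :
    IsSelfAdjoint (fracSemigroup G s t) := by
  unfold fracSemigroup
  split_ifs
  · exact IsSelfAdjoint.one _
  · exact cfc_predicate _ _

/-- The semigroup acts on an eigenvector of `A` through multiplication by `e^{-t μ^s}`. -/
lemma fracSemigroup_apply_of_mem {G : Set (H × H)} {R : H →L[ℂ] H} (hR : IsResolvent G R)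
    (hsa : IsSelfAdjoint R) (hspec : spectrum ℝ R ⊆ Icc 0 1) {s t m : ℝ} (hs : 0 < s) (ht : 0 < t)
    (hm : 0 ≤ m) {v : H} (hv : (v, (m : ℂ) • v) ∈ G) :
    fracSemigroup G s t v = (Real.exp (-t * m ^ s) : ℂ) • v := by
  have h1 : R ((1 + m : ℂ) • v) = v := by
    refine (hR v _).1 ?_
    convert hv using 2
    rw [add_smul, one_smul, add_sub_cancel_left]
  have hne : (1 + m : ℂ) ≠ 0 := by
    norm_cast
    positivity
  have h2 : R v = (((1 + m)⁻¹ : ℝ) : ℂ) • v := by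
    rw [map_smul] at h1
    rw [Complex.ofReal_inv, Complex.ofReal_add, Complex.ofReal_one, eq_inv_smul_iff₀ hne, h1]
  rw [fracSemigroup, if_neg ht.ne', funCalc, hR.resolventOp_eq,
    cfc_apply_of_apply_eq_smul hsa h2 ((continuousOn_symbol hs ht).mono hspec), if_pos (by positivity)]
  congr 3
  simp

end FunctionalCalculus

/-! ### Mollification of weak solutions and the energy identity on ℝ^d. -/

section Mollification

open Topology Filter
open scoped ContDiff ComplexConjugate Convolution

/-- The `i`-th vector of the standard basis of `ℝ^d`. -/
abbrev stdVec {d : ℕ} (i : Fin d) : E d := EuclideanSpace.single i (1 : ℝ)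

/-- The derivative in the direction `w` of a function on `ℝ^d`. -/
abbrev lineD {d : ℕ} (w : E d) (F : E d → ℂ) : E d → ℂ := dirDeriv (AddMonoidHom.id (E d)) w F

/-- The Laplacian on `ℝ^d` as a sum of second derivatives. -/
def lap {d : ℕ} (F : E d → ℂ) (x : E d) : ℂ := ∑ i, lineD (stdVec i) (lineD (stdVec i) F) x

variable {d : ℕ}

lemma isOpenQuotientMap_id : IsOpenQuotientMap (AddMonoidHom.id (E d)) :=
  (Homeomorph.refl (E d)).isOpenQuotientMap

lemma lineD_eq_fderiv {F : E d → ℂ} (hF : ContDiff ℝ ∞ F) (w x : E d) :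
    lineD w F x = fderiv ℝ F x w := dirDeriv_map (π := AddMonoidHom.id (E d)) hF x

/-- The convolution of the kernel `ρ` with `f`. -/
def moll {F : Type*} [NormedAddCommGroup F] [NormedSpace ℝ F] (ρ : E d → ℝ) (f : E d → F)
    (x : E d) : F := ∫ t, ρ (x - t) • f t

lemma moll_eq_convolution {F : Type*} [NormedAddCommGroup F] [NormedSpace ℝ F]
    (ρ : E d → ℝ) (f : E d → F) :
    moll ρ f = f ⋆[(ContinuousLinearMap.lsmul ℝ ℝ).flip, volume] ρ := rfl

lemma integrable_moll_integrand {F : Type*} [NormedAddCommGroup F] [NormedSpace ℝ F]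
    {ρ : E d → ℝ} (hρ : Continuous ρ) (hc : HasCompactSupport ρ) {f : E d → F}
    (hf : LocallyIntegrable f) (x : E d) : Integrable fun t => ρ (x - t) • f t :=
  hc.convolutionExists_right (ContinuousLinearMap.lsmul ℝ ℝ).flip hf hρ x

lemma contDiff_moll {ρ : E d → ℝ} (hρ : ContDiff ℝ ∞ ρ) (hc : HasCompactSupport ρ) {f : E d → ℂ}
    (hf : LocallyIntegrable f) : ContDiff ℝ ∞ (moll ρ f) :=
  hc.contDiff_convolution_right (n := ⊤) (ContinuousLinearMap.lsmul ℝ ℝ).flip hf hρ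

/-- Only the kernel is smooth, so it takes all the derivatives; this is how the Laplacian of a
mollification becomes a pairing of f with a test function. -/
lemma lineD_moll {ρ : E d → ℝ} (hρ : ContDiff ℝ ∞ ρ) (hc : HasCompactSupport ρ) {f : E d → ℂ}
    (hf : LocallyIntegrable f) (w : E d) :
    lineD w (moll ρ f) = moll (fun t => fderiv ℝ ρ t w) f := by
  ext x
  rw [lineD_eq_fderiv (contDiff_moll hρ hc hf), moll_eq_convolution, moll_eq_convolution,
    (hc.hasFDerivAt_convolution_right _ hf (hρ.of_le (by simp)) x).fderiv,
    convolution_precompR_apply _ hf (hc.fderiv ℝ) (hρ.continuous_fderiv (by simp))]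

lemma contDiff_fderiv_apply {ρ : E d → ℝ} (hρ : ContDiff ℝ ∞ ρ) (w : E d) :
    ContDiff ℝ ∞ fun t => fderiv ℝ ρ t w :=
  (ContDiff.fderiv_right (m := ∞) hρ (by simp)).clm_apply contDiff_const

lemma contDiff_reflect {ρ : E d → ℝ} (hρ : ContDiff ℝ ∞ ρ) (x : E d) :
    ContDiff ℝ ∞ fun t => (ρ (x - t) : ℂ) :=
  Complex.ofRealCLM.contDiff.comp (hρ.comp (contDiff_const.sub contDiff_id))

lemma hasCompactSupport_reflect {ρ : E d → ℝ} (hc : HasCompactSupport ρ) (x : E d) :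
    HasCompactSupport fun t => (ρ (x - t) : ℂ) := by
  have h1 : HasCompactSupport fun t => ρ (x - t) := hc.comp_homeomorph (Homeomorph.subLeft x)
  exact h1.comp_left (g := fun r : ℝ => (r : ℂ)) (by simp)

/-- The reflected kernel t ↦ ρ(x - t) is the test function to be inserted in the weak equation. Each
derivative in t costs a sign, so second derivatives agree with those of the kernel. -/
lemma lineD_reflect {ρ : E d → ℝ} (hρ : ContDiff ℝ ∞ ρ) (x w : E d) :
    lineD w (fun t => (ρ (x - t) : ℂ)) = fun t => -((fderiv ℝ ρ (x - t) w : ℝ) : ℂ) := by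
  ext t
  rw [lineD_eq_fderiv (contDiff_reflect hρ x)]
  have h1 : HasFDerivAt (fun t => x - t) (-ContinuousLinearMap.id ℝ (E d)) t :=
    (hasFDerivAt_id t).const_sub x
  have h2 : HasFDerivAt ρ (fderiv ℝ ρ (x - t)) (x - t) :=
    (hρ.differentiable (by simp) _).hasFDerivAt
  have h3 := Complex.ofRealCLM.hasFDerivAt.comp t (h2.comp t h1)
  have h4 : fderiv ℝ (fun t => (ρ (x - t) : ℂ)) t = _ := h3.fderiv
  rw [h4]
  simp

lemma lineD_lineD_reflect {ρ : E d → ℝ} (hρ : ContDiff ℝ ∞ ρ) (x w : E d) :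
    lineD w (lineD w (fun t => (ρ (x - t) : ℂ))) =
      fun t => ((fderiv ℝ (fun s => fderiv ℝ ρ s w) (x - t) w : ℝ) : ℂ) := by
  have h1 := lineD_reflect (contDiff_fderiv_apply hρ w) x w
  ext t
  have h2 := congrFun h1 t
  rw [lineD_reflect hρ]
  have h3 : (fun t => -((fderiv ℝ ρ (x - t) w : ℝ) : ℂ)) =
      fun t => (-1 : ℂ) * ((fderiv ℝ ρ (x - t) w : ℝ) : ℂ) := by ext; simp
  rw [h3, lineD, dirDeriv_const_mul]
  rw [lineD] at h2
  rw [h2]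
  simp

/-- The mollification of a weak solution is a smooth solution, up to a commutator. -/
lemma lap_moll_of_weak {ρ : E d → ℝ} (hρ : ContDiff ℝ ∞ ρ) (hc : HasCompactSupport ρ)
    {f : E d → ℂ} (hf : LocallyIntegrable f) {Q : E d → ℂ} (hQ : Continuous Q)
    (h : ∀ ψ : E d → ℂ, ContDiff ℝ ∞ ψ → HasCompactSupport ψ →
      ∫ x, f x * (Q x * ψ x - lap ψ x) = 0) (x : E d) :
    lap (moll ρ f) x = ∫ t, ρ (x - t) • (Q t * f t) := by
  have h1 := h _ (contDiff_reflect hρ x) (hasCompactSupport_reflect hc x)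
  have hfQ : LocallyIntegrable fun t => Q t * f t := by
    have := hf.mul_continuous (f := f) (g := Q) hQ
    simpa [mul_comm] using this
  have hI : Integrable fun t => ρ (x - t) • (Q t * f t) :=
    integrable_moll_integrand hρ.continuous hc hfQ x
  have hρ2 : ∀ w, ContDiff ℝ ∞ fun t => fderiv ℝ (fun s => fderiv ℝ ρ s w) t w := fun w =>
    contDiff_fderiv_apply (contDiff_fderiv_apply hρ w) w
  have hc1 : ∀ w, HasCompactSupport fun t => fderiv ℝ ρ t w := fun w =>
    hc.fderiv_apply ℝ w
  have hJ : ∀ w, Integrable fun t => fderiv ℝ (fun s => fderiv ℝ ρ s w) (x - t) w • f t := fun w =>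
    integrable_moll_integrand (hρ2 w).continuous ((hc1 w).fderiv_apply ℝ w) hf x
  have h2 : lap (moll ρ f) x =
      ∑ i, ∫ t, fderiv ℝ (fun s => fderiv ℝ ρ s (stdVec i)) (x - t) (stdVec i) • f t := by
    refine Finset.sum_congr rfl fun i _ => ?_
    rw [lineD_moll hρ hc hf, lineD_moll (contDiff_fderiv_apply hρ _) (hc1 _) hf]
    rfl
  rw [h2, ← integral_finsetSum _ fun i _ => hJ _, ← sub_eq_zero, ← integral_sub
    (integrable_finsetSum _ fun i _ => hJ _) hI, ← neg_eq_zero, ← integral_neg, ← h1]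
  refine integral_congr_ae (Eventually.of_forall fun t => ?_)
  simp only [lap, lineD_lineD_reflect hρ, Complex.real_smul, ← Finset.sum_mul]
  ring

/-- Integration by parts in the energy identity for the cut-off function `c`. -/
lemma re_integral_lap_le {u c : E d → ℂ} (hu : ContDiff ℝ ∞ u) (hcs : ContDiff ℝ ∞ c)
    (hcc : HasCompactSupport c) (hreal : ∀ x, conj (c x) = c x) :
    (∫ x, lap u x * (c x * (c x * conj (u x)))).re ≤
      ∑ i, ∫ x, ‖lineD (stdVec i) c x‖ ^ 2 * ‖u x‖ ^ 2 := by
  have hπ : IsOpenQuotientMap (AddMonoidHom.id (E d)) := isOpenQuotientMap_id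
  have hu' : SmoothVia (AddMonoidHom.id (E d)) u := hu
  have hc' : SmoothVia (AddMonoidHom.id (E d)) c := hcs
  have hp : SmoothVia (AddMonoidHom.id (E d)) fun x => c x * (c x * conj (u x)) :=
    hc'.mul (hc'.mul hu'.conj)
  have hpc : HasCompactSupport fun x => c x * (c x * conj (u x)) := hcc.mul_right
  have h1 : ∀ i : Fin d, Integrable fun x =>
      lineD (stdVec i) (lineD (stdVec i) u) x * (c x * (c x * conj (u x))) := fun i =>
    ((((hu'.dirDeriv _).dirDeriv _).mul hp).continuous hπ).integrable_of_hasCompactSupport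
      hpc.mul_left
  simp_rw [lap, Finset.sum_mul]
  rw [integral_finsetSum _ fun i _ => h1 i, Complex.re_sum]
  refine Finset.sum_le_sum fun i _ => ?_
  set w : E d := stdVec i
  have hint : Integrable fun x => lineD w u x * lineD w (fun x => c x * (c x * conj (u x))) x :=
    (((hu'.dirDeriv _).mul (hp.dirDeriv _)).continuous hπ).integrable_of_hasCompactSupport
      (hasCompactSupport_dirDeriv hπ hpc).mul_left
  have h2 := integral_mul_dirDeriv (μ := volume) hπ (hu'.dirDeriv w) hp hpc w
  rw [eq_neg_iff_add_eq_zero, add_comm, ← eq_neg_iff_add_eq_zero] at h2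
  have h3 : (∫ x, lineD w (lineD w u) x * (c x * (c x * conj (u x)))) =
    -∫ x, lineD w u x * lineD w (fun x => c x * (c x * conj (u x))) x := h2
  rw [h3, ← integral_neg]
  have h4 : (∫ x, -(lineD w u x * lineD w (fun x => c x * (c x * conj (u x))) x)).re =
      ∫ x, (-(lineD w u x * lineD w (fun x => c x * (c x * conj (u x))) x)).re :=
    (integral_re (𝕜 := ℂ) hint.neg).symm
  rw [h4]
  refine integral_mono hint.neg.re ?_ fun x => ?_
  · refine Continuous.integrable_of_hasCompactSupport ?_ ?_
    · exact (((hc'.dirDeriv w).continuous hπ).norm.pow 2).mul ((hu'.continuous hπ).norm.pow 2)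
    · refine HasCompactSupport.mul_right ?_
      exact (hasCompactSupport_dirDeriv hπ hcc).comp_left (g := fun z : ℂ => ‖z‖ ^ 2) (by simp)
  · have e1 : lineD w (fun x => c x * (c x * conj (u x))) x =
        lineD w c x * (c x * conj (u x)) +
          c x * (lineD w c x * conj (u x) + c x * conj (lineD w u x)) := by
      rw [lineD, dirDeriv_mul hπ.surjective hc' (hc'.mul hu'.conj),
        dirDeriv_mul hπ.surjective hc' hu'.conj, dirDeriv_conj hπ.surjective hu']
    have e2 : conj (lineD w c x) = lineD w c x := by
      rw [lineD, ← dirDeriv_conj hπ.surjective hc']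
      simp_rw [hreal]
    simp only [e1]
    rw [Complex.conj_eq_iff_im] at e2
    have e3 := hreal x
    rw [Complex.conj_eq_iff_im] at e3
    simp only [Complex.sq_norm, Complex.normSq_apply, Complex.neg_re, Complex.mul_re,
      Complex.mul_im, Complex.add_re, Complex.add_im, Complex.conj_re, Complex.conj_im, e2, e3]
    -- For real c, -Re(∂u · ∂(c² ū)) = |∂c|²|u|² - |c ∂u + u ∂c|²; the two squares are the real and
    -- imaginary parts of the dropped term.
    nlinarith [sq_nonneg ((c x).re * (lineD w u x).re + (lineD w c x).re * (u x).re),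
      sq_nonneg ((c x).re * (lineD w u x).im + (lineD w c x).re * (u x).im)]

end Mollification

/-! ### Square integrable weak solutions of -Δf + (1 + V)f = 0 vanish. -/

section WeakUniqueness

open Topology Filter
open scoped ContDiff ComplexConjugate Convolution ENNReal

variable {d : ℕ}

lemma integral_comp_sub_left_eq (ρ : E d → ℝ) (x : E d) : ∫ t, ρ (x - t) = ∫ t, ρ t :=
  integral_sub_left_eq_self ρ volume x

/-- Jensen's inequality for mollification. -/
lemma sq_moll_le {ρ : E d → ℝ} (hρ : Continuous ρ) (hc : HasCompactSupport ρ) (h0 : ∀ x, 0 ≤ ρ x)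
    (h1 : ∫ x, ρ x = 1) {g : E d → ℝ} (hg : LocallyIntegrable g)
    (hg2 : LocallyIntegrable fun x => g x ^ 2) (x : E d) :
    moll ρ g x ^ 2 ≤ moll ρ (fun t => g t ^ 2) x := by
  set n := moll ρ g x with hn
  have i1 := integrable_moll_integrand hρ hc hg x
  have i2 := integrable_moll_integrand hρ hc hg2 x
  have i3 : Integrable fun t => ρ (x - t) :=
    (hρ.integrable_of_hasCompactSupport hc).comp_sub_left x
  -- This is the variance of g under the probability density ρ(x - ·), whose mean is n.
  have h2 : 0 ≤ ∫ t, ρ (x - t) * (g t - n) ^ 2 :=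
    integral_nonneg fun t => mul_nonneg (h0 _) (sq_nonneg _)
  have h3 : ∫ t, ρ (x - t) * (g t - n) ^ 2 =
      moll ρ (fun t => g t ^ 2) x - 2 * n * n + n ^ 2 * 1 := by
    have e : ∀ t, ρ (x - t) * (g t - n) ^ 2 =
        ρ (x - t) • g t ^ 2 - 2 * n * (ρ (x - t) • g t) + n ^ 2 * ρ (x - t) := fun t => by
      simp only [smul_eq_mul]
      ring
    simp_rw [e]
    have i5 : Integrable fun t => ρ (x - t) • g t ^ 2 - 2 * n * (ρ (x - t) • g t) :=
      i2.sub (i1.const_mul _)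
    rw [integral_add i5 (i3.const_mul _), integral_sub i2 (i1.const_mul _),
      integral_const_mul, integral_const_mul, integral_comp_sub_left_eq, h1]
    rfl
  nlinarith

lemma norm_moll_le {ρ : E d → ℝ} (h0 : ∀ x, 0 ≤ ρ x) (f : E d → ℂ) (x : E d) :
    ‖moll ρ f x‖ ≤ moll ρ (fun t => ‖f t‖) x := by
  refine (norm_integral_le_integral_norm _).trans (le_of_eq ?_)
  refine integral_congr_ae (Eventually.of_forall fun t => ?_)
  simp only [norm_smul, Real.norm_of_nonneg (h0 _), smul_eq_mul]

/-- The energy estimate for the mollification of a weak solution. -/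
lemma integral_cutoff_moll_le {ρ : E d → ℝ} (hρ : ContDiff ℝ ∞ ρ) (hc : HasCompactSupport ρ)
    (h0 : ∀ x, 0 ≤ ρ x) (h1 : ∫ x, ρ x = 1) {V : E d → ℝ} (hV : Continuous V) (hV0 : ∀ x, 0 ≤ V x)
    {f : E d → ℂ} (hf : MemLp f 2)
    (h : ∀ ψ : E d → ℂ, ContDiff ℝ ∞ ψ → HasCompactSupport ψ →
      ∫ x, f x * ((1 + V x : ℂ) * ψ x - lap ψ x) = 0)
    {c : E d → ℂ} (hcs : ContDiff ℝ ∞ c) (hcc : HasCompactSupport c)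
    (hreal : ∀ x, conj (c x) = c x) (hc1 : ∀ x, ‖c x‖ ≤ 1) {B η : ℝ} (hη : 0 ≤ η)
    (hB : ∀ i x, ‖lineD (stdVec i) c x‖ ≤ B)
    (hosc : ∀ x t, c x ≠ 0 → ρ (x - t) ≠ 0 → |V t - V x| ≤ η) :
    ∫ x, ‖c x‖ ^ 2 * ‖moll ρ f x‖ ^ 2 ≤ (η + d * B ^ 2) * ∫ x, ‖f x‖ ^ 2 := by
  have hf1 : LocallyIntegrable f := hf.locallyIntegrable one_le_two
  have hf2 : LocallyIntegrable fun x => ‖f x‖ := hf.norm.locallyIntegrable one_le_two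
  have hf3 : Integrable fun x => ‖f x‖ ^ 2 := hf.integrable_norm_pow (by simp)
  set u := moll ρ f with hu
  have hus : ContDiff ℝ ∞ u := contDiff_moll hρ hc hf1
  set m := moll ρ (fun t => ‖f t‖ ^ 2) with hm
  have hρi : Integrable ρ := hρ.continuous.integrable_of_hasCompactSupport hc
  have hmi : Integrable m :=
    hf3.integrable_convolution (ContinuousLinearMap.lsmul ℝ ℝ).flip hρi
  have hmint : ∫ x, m x = ∫ x, ‖f x‖ ^ 2 := by
    have := integral_convolution (μ := volume) (ν := volume)
      (ContinuousLinearMap.lsmul ℝ ℝ (E := ℝ)).flip hf3 hρi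
    rw [h1] at this
    simpa [hm, moll_eq_convolution] using this
  have hn2 : ∀ x, moll ρ (fun t => ‖f t‖) x ^ 2 ≤ m x := fun x =>
    sq_moll_le hρ.continuous hc h0 h1 hf2 hf3.locallyIntegrable x
  have hun : ∀ x, ‖u x‖ ≤ moll ρ (fun t => ‖f t‖) x := fun x => norm_moll_le h0 f x
  have hum : ∀ x, ‖u x‖ ^ 2 ≤ m x := fun x =>
    (pow_le_pow_left₀ (norm_nonneg _) (hun x) 2).trans (hn2 x)
  have hm0 : ∀ x, 0 ≤ m x := fun x => (sq_nonneg _).trans (hum x)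
  have hcont : Continuous fun x => ‖c x‖ ^ 2 * ‖u x‖ ^ 2 :=
    (hcs.continuous.norm.pow 2).mul (hus.continuous.norm.pow 2)
  have hQ : Continuous fun x => (1 + V x : ℂ) :=
    continuous_const.add (Complex.continuous_ofReal.comp hV)
  have hlap := lap_moll_of_weak hρ hc hf1 hQ h
  -- pointwise lower bound
  have hpt : ∀ x, ‖c x‖ ^ 2 * ‖u x‖ ^ 2 - η * m x ≤
      (lap u x * (c x * (c x * conj (u x)))).re := by
    intro x
    rcases eq_or_ne (c x) 0 with hcx | hcx
    · rw [hcx]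
      simp only [norm_zero, zero_mul, mul_zero, Complex.zero_re]
      have := mul_nonneg hη (hm0 x)
      simp
      linarith
    -- `err` is the commutator of mollification with multiplication by V. The oscillation bound on
    -- the support of c makes it at most η times the mollified |f|.
    set err : ℂ := ∫ t, ρ (x - t) • (((V t - V x : ℝ) : ℂ) * f t) with herr
    have hfV : LocallyIntegrable fun t => ((V t - V x : ℝ) : ℂ) * f t := by
      have hcv : Continuous fun t => ((V t - V x : ℝ) : ℂ) :=
        Complex.continuous_ofReal.comp (hV.sub continuous_const)
      have := hf1.mul_continuous hcv
      simpa [mul_comm] using this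
    have e1 : lap u x = (1 + V x : ℂ) * u x + err := by
      rw [hlap, herr, hu, moll, ← integral_const_mul, ← integral_add]
      · refine integral_congr_ae (Eventually.of_forall fun t => ?_)
        simp only [Complex.real_smul, Complex.ofReal_sub]
        ring
      · exact (integrable_moll_integrand hρ.continuous hc hf1 x).const_mul _
      · exact integrable_moll_integrand hρ.continuous hc hfV x
    have e2 : ‖err‖ ≤ η * moll ρ (fun t => ‖f t‖) x := by
      rw [moll, ← integral_const_mul]
      refine (norm_integral_le_integral_norm _).trans ?_
      refine integral_mono (integrable_moll_integrand hρ.continuous hc hfV x).norm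
        ((integrable_moll_integrand hρ.continuous hc hf2 x).const_mul _) fun t => ?_
      simp only [norm_smul, norm_mul, Real.norm_of_nonneg (h0 _), smul_eq_mul, Complex.norm_real]
      rcases eq_or_ne (ρ (x - t)) 0 with hz | hz
      · simp [hz]
      · have := hosc x t hcx hz
        rw [Real.norm_eq_abs, mul_left_comm]
        exact mul_le_mul_of_nonneg_right this (mul_nonneg (h0 _) (norm_nonneg _))
    have e3 : (lap u x * (c x * (c x * conj (u x)))).re =
        (1 + V x) * (‖c x‖ ^ 2 * ‖u x‖ ^ 2) + (err * (c x * (c x * conj (u x)))).re := by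
      have hcc' := hreal x
      rw [Complex.conj_eq_iff_im] at hcc'
      rw [e1]
      simp only [Complex.sq_norm, Complex.normSq_apply, Complex.mul_re, Complex.mul_im,
        Complex.add_re, Complex.add_im, Complex.conj_re, Complex.conj_im, hcc', Complex.one_re,
        Complex.one_im, Complex.ofReal_re, Complex.ofReal_im]
      ring
    have e4 : ‖err * (c x * (c x * conj (u x)))‖ ≤ η * m x := by
      rw [norm_mul, norm_mul, norm_mul, RCLike.norm_conj]
      have hn0 : 0 ≤ moll ρ (fun t => ‖f t‖) x := (norm_nonneg _).trans (hun x)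
      have a1 : ‖c x‖ * (‖c x‖ * ‖u x‖) ≤ moll ρ (fun t => ‖f t‖) x := by
        refine le_trans ?_ (hun x)
        have := mul_le_of_le_one_left (norm_nonneg (u x)) (hc1 x)
        exact (mul_le_of_le_one_left (by positivity) (hc1 x)).trans this
      calc ‖err‖ * (‖c x‖ * (‖c x‖ * ‖u x‖))
          ≤ (η * moll ρ (fun t => ‖f t‖) x) * moll ρ (fun t => ‖f t‖) x := by gcongr
        _ = η * moll ρ (fun t => ‖f t‖) x ^ 2 := by ring
        -- Jensen turns the squared mollification of |f| into the mollification of |f|², whose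
        -- integral is exactly ∫|f|².
        _ ≤ η * m x := by gcongr; exact hn2 x
    have e5 := (abs_le.1 ((Complex.abs_re_le_norm _).trans e4)).1
    have e6 : 0 ≤ V x * (‖c x‖ ^ 2 * ‖u x‖ ^ 2) := mul_nonneg (hV0 x) (by positivity)
    rw [e3]
    linarith
  have hci : Integrable fun x => ‖c x‖ ^ 2 * ‖u x‖ ^ 2 :=
    hcont.integrable_of_hasCompactSupport
      (HasCompactSupport.mul_right (hcc.comp_left (g := fun z : ℂ => ‖z‖ ^ 2) (by simp)))
  have hlapc : Continuous (lap u) := by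
    unfold lap
    refine continuous_finsetSum _ fun i _ => ?_
    have hu' : SmoothVia (AddMonoidHom.id (E d)) u := hus
    exact ((hu'.dirDeriv _).dirDeriv _).continuous isOpenQuotientMap_id
  have hLi : Integrable fun x => lap u x * (c x * (c x * conj (u x))) :=
    (hlapc.mul (hcs.continuous.mul (hcs.continuous.mul
      (Complex.continuous_conj.comp hus.continuous)))).integrable_of_hasCompactSupport
      hcc.mul_right.mul_left
  have hlow : (∫ x, ‖c x‖ ^ 2 * ‖u x‖ ^ 2) - η * ∫ x, ‖f x‖ ^ 2 ≤
      (∫ x, lap u x * (c x * (c x * conj (u x)))).re := by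
    have e : (∫ x, lap u x * (c x * (c x * conj (u x)))).re =
      ∫ x, (lap u x * (c x * (c x * conj (u x)))).re := (integral_re (𝕜 := ℂ) hLi).symm
    rw [e, ← hmint, ← integral_const_mul, ← integral_sub hci (hmi.const_mul _)]
    exact integral_mono (hci.sub (hmi.const_mul _)) hLi.re hpt
  have hup := re_integral_lap_le hus hcs hcc hreal
  have hsum : ∑ i, ∫ x, ‖lineD (stdVec i) c x‖ ^ 2 * ‖u x‖ ^ 2 ≤ d * B ^ 2 * ∫ x, ‖f x‖ ^ 2 := by
    have : ∀ i : Fin d, ∫ x, ‖lineD (stdVec i) c x‖ ^ 2 * ‖u x‖ ^ 2 ≤ B ^ 2 * ∫ x, ‖f x‖ ^ 2 := by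
      intro i
      rw [← hmint, ← integral_const_mul]
      refine integral_mono_of_nonneg (Eventually.of_forall fun x => by positivity)
        (hmi.const_mul _) (Eventually.of_forall fun x => ?_)
      exact mul_le_mul (pow_le_pow_left₀ (norm_nonneg _) (hB i x) 2) (hum x) (by positivity)
        (sq_nonneg _)
    refine (Finset.sum_le_sum fun i _ => this i).trans (le_of_eq ?_)
    simp [mul_assoc]
  linarith

/-- A cut-off function with small derivatives. -/
lemma exists_cutoff (d : ℕ) : ∃ A : ℝ, ∀ R : ℝ, 0 < R → ∃ c : E d → ℂ, ContDiff ℝ ∞ c ∧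
    HasCompactSupport c ∧ (∀ x, conj (c x) = c x) ∧ (∀ x, ‖c x‖ ≤ 1) ∧
    (∀ x, ‖x‖ ≤ R → c x = 1) ∧ ∀ i x, ‖lineD (stdVec i) c x‖ ≤ A / R := by
  let b : ContDiffBump (0 : E d) := ⟨1, 2, one_pos, one_lt_two⟩
  have hb : ContDiff ℝ ∞ b := b.contDiff
  obtain ⟨A, hA⟩ := (hb.continuous_fderiv (by simp)).bounded_above_of_compact_support
    (b.hasCompactSupport.fderiv ℝ)
  refine ⟨A, fun R hR => ?_⟩
  have hs : ContDiff ℝ ∞ fun x : E d => b (R⁻¹ • x) := hb.comp (contDiff_const_smul _)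
  have hcs : ContDiff ℝ ∞ fun x : E d => (b (R⁻¹ • x) : ℂ) := Complex.ofRealCLM.contDiff.comp hs
  refine ⟨fun x => (b (R⁻¹ • x) : ℂ), hcs, ?_, fun x => Complex.conj_ofReal _, fun x => ?_,
    fun x hx => ?_, fun i x => ?_⟩
  · have h1 : HasCompactSupport fun x : E d => b (R⁻¹ • x) :=
      b.hasCompactSupport.comp_smul (inv_ne_zero hR.ne')
    exact h1.comp_left (g := fun r : ℝ => (r : ℂ)) (by simp)
  · rw [Complex.norm_real, Real.norm_of_nonneg b.nonneg]
    exact b.le_one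
  · have : b (R⁻¹ • x) = 1 := by
      refine b.one_of_mem_closedBall ?_
      rw [mem_closedBall_zero_iff, norm_smul, norm_inv, Real.norm_of_nonneg hR.le]
      change _ ≤ (1 : ℝ)
      rw [inv_mul_le_iff₀ hR]
      simpa using hx
    simp [this]
  · rw [lineD_eq_fderiv hcs]
    have h1 : HasFDerivAt (fun x : E d => R⁻¹ • x) (R⁻¹ • ContinuousLinearMap.id ℝ (E d)) x :=
      (R⁻¹ • ContinuousLinearMap.id ℝ (E d)).hasFDerivAt
    have h3 := Complex.ofRealCLM.hasFDerivAt.comp x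
      (((hb.differentiable (by simp)) (R⁻¹ • x)).hasFDerivAt.comp x h1)
    have h4 : fderiv ℝ (fun x : E d => (b (R⁻¹ • x) : ℂ)) x = _ := h3.fderiv
    rw [h4]
    simp only [ContinuousLinearMap.comp_apply, smul_apply,
      ContinuousLinearMap.id_apply, map_smul, Complex.ofRealCLM_apply, norm_smul, norm_inv,
      Real.norm_of_nonneg hR.le, Complex.norm_real]
    rw [div_eq_inv_mul]
    refine mul_le_mul_of_nonneg_left ?_ (by positivity)
    refine ((fderiv ℝ b (R⁻¹ • x)).le_opNorm _).trans ?_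
    simpa using hA (R⁻¹ • x)

/-- Essential selfadjointness of Schrödinger operators with non-negative continuous potential:
a square integrable weak solution of `-Δf + (1 + V) f = 0` vanishes. -/
theorem ae_eq_zero_of_weak {V : E d → ℝ} (hV : Continuous V) (hV0 : ∀ x, 0 ≤ V x)
    {f : E d → ℂ} (hf : MemLp f 2)
    (h : ∀ ψ : E d → ℂ, ContDiff ℝ ∞ ψ → HasCompactSupport ψ →
      ∫ x, f x * ((1 + V x : ℂ) * ψ x - lap ψ x) = 0) : f =ᵐ[volume] 0 := by
  obtain ⟨A, hA⟩ := exists_cutoff d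
  have hR : ∀ k : ℕ, (0 : ℝ) < k + 1 := fun k => by positivity
  choose c hcs hcc hreal hc1 hone hder using fun k : ℕ => hA (k + 1) (hR k)
  -- V need not be uniformly continuous on ℝ^d, so the mollification radius is chosen after the
  -- cut-off radius k+1, from uniform continuity on a compact neighbourhood of the support.
  have heps : ∀ k : ℕ, ∃ ε : ℝ, 0 < ε ∧ ε ≤ 1 / (k + 1) ∧
      ∀ x t, c k x ≠ 0 → ‖x - t‖ < ε → |V t - V x| ≤ 1 / (k + 1) := by
    intro k
    have hK : IsCompact (Metric.cthickening 1 (tsupport (c k))) := (hcc k).isCompact.cthickening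
    have hu := hK.uniformContinuousOn_of_continuous hV.continuousOn
    obtain ⟨δ, hδ, hδ'⟩ := Metric.uniformContinuousOn_iff.1 hu (1 / (k + 1)) (by positivity)
    refine ⟨min δ (1 / (k + 1)), by positivity, min_le_right _ _, fun x t hx ht => ?_⟩
    have hxs : x ∈ tsupport (c k) := subset_tsupport _ hx
    have h1 : (1 : ℝ) / (k + 1) ≤ 1 := by
      rw [div_le_one (hR k)]
      linarith [Nat.cast_nonneg (α := ℝ) k]
    refine (hδ' t ?_ x (Metric.self_subset_cthickening _ hxs) ?_).le
    · refine Metric.mem_cthickening_of_dist_le t x 1 _ hxs ?_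
      rw [dist_comm, dist_eq_norm]
      exact (ht.le.trans (min_le_right _ _)).trans h1
    · rw [dist_comm, dist_eq_norm]
      exact ht.trans_le (min_le_left _ _)
  choose ε hε hεle hosc using heps
  let φ : ℕ → ContDiffBump (0 : E d) := fun k => ⟨ε k / 2, ε k, half_pos (hε k), half_lt_self (hε k)⟩
  let ρ : ℕ → E d → ℝ := fun k => (φ k).normed volume
  have hρ : ∀ k, ContDiff ℝ ∞ (ρ k) := fun k => (φ k).contDiff_normed
  have hest : ∀ k : ℕ, ∫ x, ‖c k x‖ ^ 2 * ‖moll (ρ k) f x‖ ^ 2 ≤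
      (1 / (k + 1) + d * (A / (k + 1)) ^ 2) * ∫ x, ‖f x‖ ^ 2 := by
    intro k
    refine integral_cutoff_moll_le (hρ k) (φ k).hasCompactSupport_normed
      (fun x => (φ k).nonneg_normed x) ((φ k).integral_normed) hV hV0 hf h (hcs k) (hcc k)
      (hreal k) (hc1 k) (by positivity) (hder k) fun x t hx ht => hosc k x t hx ?_
    have : x - t ∈ Function.support ((φ k).normed volume) := ht
    rw [(φ k).support_normed_eq] at this
    simpa using this
  have hlim : ∀ᵐ x, Tendsto (fun k => moll (ρ k) f x) atTop (𝓝 (f x)) := by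
    -- K = 2 is the fixed ratio between the outer radius ε_k and the inner radius ε_k/2 of the
    -- bumps.
    have := ContDiffBump.ae_convolution_tendsto_right_of_locallyIntegrable (φ := φ) (K := 2)
      (l := atTop) (μ := (volume : Measure (E d))) (g := f) ?_ ?_ (hf.locallyIntegrable one_le_two)
    · filter_upwards [this] with x hx
      refine hx.congr fun k => ?_
      rw [moll_eq_convolution, convolution_flip]
    · exact squeeze_zero (fun k => (hε k).le) hεle tendsto_one_div_add_atTop_nhds_zero_nat
    · exact Eventually.of_forall fun k => by simp [φ, mul_div_cancel₀]
  have hlim2 : ∀ᵐ x, Tendsto (fun k => ENNReal.ofReal (‖c k x‖ ^ 2 * ‖moll (ρ k) f x‖ ^ 2)) atTop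
      (𝓝 (ENNReal.ofReal (‖f x‖ ^ 2))) := by
    filter_upwards [hlim] with x hx
    refine ENNReal.tendsto_ofReal ((hx.norm.pow 2).congr' ?_)
    obtain ⟨K, hK⟩ := exists_nat_ge ‖x‖
    filter_upwards [eventually_ge_atTop K] with k hk
    rw [hone k x (hK.trans _)]
    · simp
    · have : (K : ℝ) ≤ k := by exact_mod_cast hk
      linarith
  have hcm : ∀ k, Continuous fun x => ‖c k x‖ ^ 2 * ‖moll (ρ k) f x‖ ^ 2 := fun k =>
    ((hcs k).continuous.norm.pow 2).mul ((contDiff_moll (hρ k) (φ k).hasCompactSupport_normed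
      (hf.locallyIntegrable one_le_two)).continuous.norm.pow 2)
  have hci : ∀ k, Integrable fun x => ‖c k x‖ ^ 2 * ‖moll (ρ k) f x‖ ^ 2 := fun k =>
    (hcm k).integrable_of_hasCompactSupport
      (HasCompactSupport.mul_right ((hcc k).comp_left (g := fun z : ℂ => ‖z‖ ^ 2) (by simp)))
  have hzero : ∫⁻ x, ENNReal.ofReal (‖f x‖ ^ 2) = 0 := by
    have hle : ∀ k : ℕ, ∫⁻ x, ENNReal.ofReal (‖c k x‖ ^ 2 * ‖moll (ρ k) f x‖ ^ 2) ≤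
        ENNReal.ofReal ((1 / (k + 1) + d * (A / (k + 1)) ^ 2) * ∫ x, ‖f x‖ ^ 2) := by
      intro k
      rw [← ofReal_integral_eq_lintegral_ofReal (hci k) (Eventually.of_forall fun x => by positivity)]
      exact ENNReal.ofReal_le_ofReal (hest k)
    have ht : Tendsto (fun k : ℕ => ENNReal.ofReal
        ((1 / (k + 1) + d * (A / (k + 1)) ^ 2) * ∫ x, ‖f x‖ ^ 2)) atTop (𝓝 0) := by
      have t1 := tendsto_one_div_add_atTop_nhds_zero_nat (𝕜 := ℝ)
      have t2 : Tendsto (fun k : ℕ => A / ((k : ℝ) + 1)) atTop (𝓝 0) := by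
        simpa [div_eq_mul_inv] using t1.const_mul A
      have t3 := ((t1.add ((t2.pow 2).const_mul (d : ℝ))).mul_const (∫ x, ‖f x‖ ^ 2))
      have t4 := ENNReal.tendsto_ofReal t3
      simpa using t4
    refine le_antisymm ?_ bot_le
    -- Fatou's lemma: the localized energies tend to 0 while their integrands tend to |f|² almost
    -- everywhere.
    calc ∫⁻ x, ENNReal.ofReal (‖f x‖ ^ 2)
        = ∫⁻ x, liminf (fun k => ENNReal.ofReal (‖c k x‖ ^ 2 * ‖moll (ρ k) f x‖ ^ 2)) atTop := by
          refine lintegral_congr_ae ?_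
          filter_upwards [hlim2] with x hx
          exact hx.liminf_eq.symm
      _ ≤ liminf (fun k => ∫⁻ x, ENNReal.ofReal (‖c k x‖ ^ 2 * ‖moll (ρ k) f x‖ ^ 2)) atTop :=
          lintegral_liminf_le fun k => (hcm k).measurable.ennreal_ofReal
      _ ≤ liminf (fun k : ℕ => ENNReal.ofReal
            ((1 / (k + 1) + d * (A / (k + 1)) ^ 2) * ∫ x, ‖f x‖ ^ 2)) atTop :=
          liminf_le_liminf (Eventually.of_forall hle)
      _ = 0 := ht.liminf_eq
  rw [lintegral_eq_zero_iff' (by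
    have := hf.aestronglyMeasurable.norm.aemeasurable
    exact (this.pow_const 2).ennreal_ofReal)] at hzero
  filter_upwards [hzero] with x hx
  simp only [Pi.zero_apply, ENNReal.ofReal_eq_zero] at hx
  have : ‖f x‖ = 0 := by nlinarith [norm_nonneg (f x)]
  simpa using this

end WeakUniqueness

/-! ### Fourier analysis in the periodic variables. -/

section Modes

open Topology Filter
open scoped ContDiff ComplexConjugate ENNReal NNReal

variable {d : ℕ}

/-- The character `y ↦ e^{i n·y}` of the torus. -/
def mode (n : Fin d → ℤ) : C(Torus d, ℂ) where
  toFun y := ∏ i, fourier (n i) (y i)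
  continuous_toFun := by fun_prop

lemma mode_apply (n : Fin d → ℤ) (y : Torus d) : mode n y = ∏ i, fourier (n i) (y i) := rfl

lemma mode_add (m n : Fin d → ℤ) (y : Torus d) : mode (m + n) y = mode m y * mode n y := by
  simp only [mode_apply, Pi.add_apply, fourier_add, ← Finset.prod_mul_distrib]

lemma mode_neg (n : Fin d → ℤ) (y : Torus d) : mode (-n) y = conj (mode n y) := by
  simp only [mode_apply, Pi.neg_apply, fourier_neg, map_prod]

lemma mode_zero (y : Torus d) : mode (0 : Fin d → ℤ) y = 1 := by
  simp [mode_apply]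

lemma norm_mode (n : Fin d → ℤ) (y : Torus d) : ‖mode n y‖ = 1 := by
  rw [mode_apply, norm_prod]
  exact Finset.prod_eq_one fun i _ => Circle.norm_coe _

lemma mode_single [DecidableEq (Fin d)] (i : Fin d) (y : Torus d) :
    mode (Pi.single i 1) y = fourier 1 (y i) := by
  rw [mode_apply, Finset.prod_eq_single i]
  · rw [Pi.single_eq_same]
  · intro j _ hj
    rw [Pi.single_eq_of_ne hj, fourier_zero]
  · simp

/-- The algebra of trigonometric polynomials. -/
def trigPoly (d : ℕ) : StarSubalgebra ℂ C(Torus d, ℂ) where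
  toSubalgebra := Algebra.adjoin ℂ (range mode)
  star_mem' := by
    change Algebra.adjoin ℂ (range mode) ≤ star (Algebra.adjoin ℂ (range mode))
    refine Algebra.adjoin_le ?_
    rintro _ ⟨n, rfl⟩
    refine Algebra.subset_adjoin ⟨-n, ?_⟩
    ext y
    simp only [mode_neg, starRingEnd_apply, ContinuousMap.star_apply]

/-- The characters form a multiplicative monoid, so the algebra they generate is already their
linear span; testing against single characters therefore suffices. -/
lemma trigPoly_toSubmodule :
    Subalgebra.toSubmodule (trigPoly d).toSubalgebra = Submodule.span ℂ (range mode) := by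
  apply Algebra.adjoin_eq_span_of_subset
  refine Subset.trans ?_ Submodule.subset_span
  intro x hx
  refine Submonoid.closure_induction (fun _ => id) ⟨0, ?_⟩ ?_ hx
  · ext y
    simp [mode_zero]
  · rintro _ _ _ _ ⟨m, rfl⟩ ⟨n, rfl⟩
    exact ⟨m + n, by ext y; simp [mode_add]⟩

/-- Two distinct points differ in some coordinate, where the basic character of that circle is
injective. -/
lemma trigPoly_separatesPoints : (trigPoly d).SeparatesPoints := by
  classical
  intro x y hxy
  obtain ⟨i, hi⟩ := Function.ne_iff.1 hxy
  refine ⟨_, ⟨mode (Pi.single i 1), Algebra.subset_adjoin ⟨Pi.single i 1, rfl⟩, rfl⟩, ?_⟩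
  simp only [mode_single, fourier_one]
  contrapose hi
  exact AddCircle.injective_toCircle Real.two_pi_pos.ne' (Subtype.ext hi)

lemma span_mode_dense : (Submodule.span ℂ (range (mode (d := d)))).topologicalClosure = ⊤ := by
  rw [← trigPoly_toSubmodule]
  exact congr_arg (Subalgebra.toSubmodule <| StarSubalgebra.toSubalgebra ·)
    (ContinuousMap.starSubalgebra_topologicalClosure_eq_top_of_separatesPoints _
      trigPoly_separatesPoints)

lemma integrable_mul_continuousMap {g : Torus d → ℂ} (hg : Integrable g) (ψ : C(Torus d, ℂ)) :
    Integrable fun y => g y * ψ y :=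
  hg.mul_bdd (c := ‖ψ‖) ψ.continuous.aestronglyMeasurable
    (Eventually.of_forall fun y => ψ.norm_coe_le_norm y)

/-- An integrable function on the torus without Fourier coefficients vanishes. -/
lemma ae_eq_zero_of_fourier {g : Torus d → ℂ} (hg : Integrable g)
    (h : ∀ n : Fin d → ℤ, ∫ y, g y * mode n y = 0) : g =ᵐ[volume] 0 := by
  let ℓ : C(Torus d, ℂ) →ₗ[ℂ] ℂ :=
    { toFun := fun ψ => ∫ y, g y * ψ y
      map_add' := fun ψ φ => by
        rw [← integral_add (integrable_mul_continuousMap hg ψ) (integrable_mul_continuousMap hg φ)]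
        simp [mul_add]
      map_smul' := fun c ψ => by
        rw [RingHom.id_apply, smul_eq_mul, ← integral_const_mul]
        simp [mul_left_comm] }
  have hb : ∀ ψ, ‖ℓ ψ‖ ≤ (∫ y, ‖g y‖) * ‖ψ‖ := by
    intro ψ
    rw [← integral_mul_const]
    refine (norm_integral_le_integral_norm _).trans
      (integral_mono (integrable_mul_continuousMap hg ψ).norm (hg.norm.mul_const _) fun y => ?_)
    simp only [norm_mul]
    exact mul_le_mul_of_nonneg_left (ψ.norm_coe_le_norm y) (norm_nonneg _)
  let L := ℓ.mkContinuous _ hb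
  have hL : ∀ ψ : C(Torus d, ℂ), ∫ y, g y * ψ y = 0 := by
    intro ψ
    have h1 : Submodule.span ℂ (range (mode (d := d))) ≤ L.ker := by
      rw [Submodule.span_le]
      rintro _ ⟨n, rfl⟩
      exact h n
    have h2 := Submodule.topologicalClosure_minimal _ h1 L.isClosed_ker
    rw [span_mode_dense] at h2
    exact h2 (Submodule.mem_top (x := ψ))
  -- It remains to integrate g over closed sets, whose indicators are bounded pointwise limits of
  -- continuous functions.
  refine ae_eq_zero_of_forall_setIntegral_isClosed_eq_zero hg fun s hs => ?_
  have hlim : Tendsto (fun k => ∫ y, g y * ((hs.apprSeq k y : ℝ≥0) : ℂ)) atTop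
      (𝓝 (∫ y, s.indicator g y)) := by
    refine tendsto_integral_of_dominated_convergence (fun y => ‖g y‖) (fun k => ?_) hg.norm
      (fun k => Eventually.of_forall fun y => ?_) (Eventually.of_forall fun y => ?_)
    · refine hg.aestronglyMeasurable.mul (Continuous.aestronglyMeasurable ?_)
      exact Complex.continuous_ofReal.comp
        (NNReal.continuous_coe.comp (hs.apprSeq k).continuous)
    · rw [norm_mul]
      refine mul_le_of_le_one_right (norm_nonneg _) ?_
      rw [Complex.norm_real]
      simpa using HasOuterApproxClosed.apprSeq_apply_le_one hs k y
    · have h1 := (tendsto_pi_nhds.1 (HasOuterApproxClosed.tendsto_apprSeq hs)) y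
      have h2 : Tendsto (fun k => ((hs.apprSeq k y : ℝ≥0) : ℂ)) atTop
          (𝓝 (((s.indicator (fun _ => (1 : ℝ≥0)) y : ℝ≥0) : ℝ) : ℂ)) :=
        ((Complex.continuous_ofReal.comp NNReal.continuous_coe).tendsto _).comp h1
      have h3 := h2.const_mul (g y)
      by_cases hy : y ∈ s <;> simpa [hy] using h3
  rw [← integral_indicator hs.measurableSet]
  refine tendsto_nhds_unique hlim (tendsto_const_nhds.congr fun k => ?_)
  exact (hL ⟨fun y => ((hs.apprSeq k y : ℝ≥0) : ℂ), Complex.continuous_ofReal.comp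
    (NNReal.continuous_coe.comp (hs.apprSeq k).continuous)⟩).symm

/-- The squared `L¹` norm is bounded by the squared `L²` norm. -/
lemma sq_integral_le {α : Type*} [MeasurableSpace α] {μ : Measure α} [IsFiniteMeasure μ]
    {h : α → ℝ} (hi : Integrable h μ) (hi2 : Integrable (fun y => h y ^ 2) μ) :
    (∫ y, h y ∂μ) ^ 2 ≤ μ.real univ * ∫ y, h y ^ 2 ∂μ := by
  set V := μ.real univ
  set I := ∫ y, h y ∂μ
  have hV : 0 ≤ V := measureReal_nonneg
  rcases hV.eq_or_lt with h0 | hV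
  · have hμ : μ = 0 := by
      rw [← Measure.measure_univ_eq_zero]
      exact (measureReal_eq_zero_iff).1 h0.symm
    have : I = 0 := by simp [I, hμ]
    simp [this, ← h0]
  -- Cauchy–Schwarz against the constant 1, by expanding a square and then dividing by the total
  -- mass V.
  have h1 : 0 ≤ ∫ y, (V * h y - I) ^ 2 ∂μ := integral_nonneg fun y => sq_nonneg _
  have e : ∀ y, (V * h y - I) ^ 2 = V ^ 2 * h y ^ 2 - 2 * V * I * h y + I ^ 2 := fun y => by ring
  simp_rw [e] at h1
  have i5 : Integrable (fun y => V ^ 2 * h y ^ 2 - 2 * V * I * h y) μ :=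
    (hi2.const_mul _).sub (hi.const_mul _)
  rw [integral_add i5 (integrable_const _), integral_sub (hi2.const_mul _) (hi.const_mul _),
    integral_const_mul, integral_const_mul, integral_const, smul_eq_mul] at h1
  change 0 ≤ V ^ 2 * _ - 2 * V * I * I + V * I ^ 2 at h1
  have h2 : 0 ≤ V * (V * (∫ y, h y ^ 2 ∂μ) - I ^ 2) := by linarith
  have := nonneg_of_mul_nonneg_right h2 hV
  linarith

/-- The Fourier coefficient in the periodic variables. -/
def coeff (f : Space d → ℂ) (n : Fin d → ℤ) (x : E d) : ℂ := ∫ y, f (x, y) * mode n y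

section

variable {f : Space d → ℂ}

lemma ae_memLp_slice (hfm : StronglyMeasurable f) (hf : MemLp f 2) :
    ∀ᵐ x : E d, MemLp (fun y => f (x, y)) 2 := by
  have h1 : Integrable (fun p => ‖f p‖ ^ 2) := hf.integrable_norm_pow (by simp)
  have h2 : ∀ᵐ x : E d, Integrable fun y => ‖f (x, y)‖ ^ 2 :=
    Integrable.prod_right_ae (μ := volume) (ν := volume) h1
  filter_upwards [h2] with x hx
  exact (memLp_two_iff_integrable_sq_norm
    (hfm.comp_measurable measurable_prodMk_left).aestronglyMeasurable).2 hx

/-- Characters have modulus one and the torus has finite measure, so |coefficient|² is at most the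
volume times the slice integral of |f|², which is integrable in x by Fubini. -/
lemma memLp_coeff (hfm : StronglyMeasurable f) (hf : MemLp f 2) (n : Fin d → ℤ) :
    MemLp (coeff f n) 2 := by
  have hm : StronglyMeasurable fun p : Space d => f p * mode n p.2 :=
    hfm.mul ((mode n).continuous.comp continuous_snd).stronglyMeasurable
  have hcm : StronglyMeasurable (coeff f n) := hm.integral_prod_right' (ν := volume)
  rw [memLp_two_iff_integrable_sq_norm hcm.aestronglyMeasurable]
  have h1 : Integrable (fun p : Space d => ‖f p‖ ^ 2) := hf.integrable_norm_pow (by simp)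
  have h2 : Integrable fun x : E d => ∫ y, ‖f (x, y)‖ ^ 2 :=
    Integrable.integral_prod_left (μ := volume) (ν := volume) h1
  refine (h2.const_mul ((volume : Measure (Torus d)).real univ)).mono'
    (hcm.norm.pow 2).aestronglyMeasurable ?_
  filter_upwards [ae_memLp_slice hfm hf] with x hx
  rw [Real.norm_of_nonneg (by positivity)]
  have hx1 : Integrable fun y => ‖f (x, y)‖ := (hx.integrable one_le_two).norm
  refine le_trans ?_ (sq_integral_le hx1 (hx.integrable_norm_pow (by simp)))
  refine pow_le_pow_left₀ (norm_nonneg _) ?_ 2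
  refine (norm_integral_le_integral_norm _).trans (le_of_eq ?_)
  simp [norm_mode]

/-- The functions `w(x) e^{i n·y}` are total in `L²`. -/
lemma ae_eq_zero_of_coeff (hfm : StronglyMeasurable f) (hf : MemLp f 2)
    (h : ∀ n, coeff f n =ᵐ[volume] 0) : f =ᵐ[volume] 0 := by
  have h1 : ∀ᵐ x : E d, ∀ᵐ y : Torus d, f (x, y) = 0 := by
    filter_upwards [ae_memLp_slice hfm hf, ae_all_iff.2 h] with x hx hx'
    exact ae_eq_zero_of_fourier (hx.integrable one_le_two) hx'
  exact (Measure.ae_prod_iff_ae_ae (μ := volume) (ν := volume)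
    (measurableSet_eq_fun hfm.measurable measurable_const)).2 h1

/-- Fubini for the Fourier coefficients. -/
lemma integral_mul_mode (hf : MemLp f 2) {ψ : E d → ℂ}
    (hψ : Continuous ψ) (hc : HasCompactSupport ψ) (n : Fin d → ℤ) :
    ∫ p : Space d, f p * (ψ p.1 * mode n p.2) = ∫ x, coeff f n x * ψ x := by
  have hg : MemLp (fun p : Space d => ψ p.1 * mode n p.2) 2 := by
    refine Continuous.memLp_of_hasCompactSupport ?_ ?_
    · exact (hψ.comp continuous_fst).mul ((mode n).continuous.comp continuous_snd)
    · refine HasCompactSupport.mul_right ?_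
      refine HasCompactSupport.intro (K := tsupport ψ ×ˢ univ) (hc.isCompact.prod isCompact_univ)
        fun p hp => ?_
      exact image_eq_zero_of_notMem_tsupport fun h' => hp ⟨h', mem_univ _⟩
  have hi : Integrable fun p : Space d => f p * (ψ p.1 * mode n p.2) := hf.integrable_mul hg
  rw [Measure.volume_eq_prod, integral_prod _ hi]
  refine integral_congr_ae (Eventually.of_forall fun x => ?_)
  simp only [coeff]
  rw [← integral_mul_const]
  refine integral_congr_ae (Eventually.of_forall fun y => ?_)
  simp only
  ring

end

end Modes

/-! ### The Grushin operator: Green's formula, separation of variables, selfadjointness. -/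

section Grushin

open Topology Filter
open scoped ContDiff ComplexConjugate ENNReal InnerProductSpace

variable {d : ℕ}

instance : (volume : Measure (Space d)).IsAddLeftInvariant :=
  Measure.prod.instIsAddLeftInvariant

lemma integral_sum_add {α ι : Type*} [MeasurableSpace α] {μ : Measure α} (s : Finset ι)
    {f g : ι → α → ℂ} (hf : ∀ i, Integrable (f i) μ) (hg : ∀ i, Integrable (g i) μ) :
    ∫ x, ∑ i ∈ s, (f i x + g i x) ∂μ = ∑ i ∈ s, (∫ x, f i x ∂μ + ∫ x, g i x ∂μ) := by
  rw [integral_finsetSum (f := fun i x => f i x + g i x) s fun i _ => (hf i).add (hg i)]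
  exact Finset.sum_congr rfl fun i _ => integral_add (hf i) (hg i)

/-- The covering homomorphism `ℝ^d × ℝ^d → ℝ^d × 𝕋^d`. -/
def cover (d : ℕ) : E d × E d →+ Space d where
  toFun p := (p.1, toTorus d p.2)
  map_zero' := by ext i <;> simp [toTorus]
  map_add' p q := by ext i <;> simp [toTorus]

lemma cover_apply (p : E d × E d) : cover d p = (p.1, toTorus d p.2) := rfl

lemma isOpenQuotientMap_toTorus : IsOpenQuotientMap (toTorus d) := by
  have h1 : IsOpenQuotientMap (Pi.map fun (_ : Fin d) (r : ℝ) => (r : AddCircle (2 * Real.pi))) :=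
    IsOpenQuotientMap.piMap fun _ => QuotientAddGroup.isOpenQuotientMap_mk
  exact h1.comp (EuclideanSpace.equiv (Fin d) ℝ).toHomeomorph.isOpenQuotientMap

lemma isOpenQuotientMap_cover : IsOpenQuotientMap (cover d) :=
  (IsOpenQuotientMap.id (X := E d)).prodMap isOpenQuotientMap_toTorus

lemma toTorus_add (v w : E d) : toTorus d (v + w) = toTorus d v + toTorus d w := by
  ext i; simp [toTorus]

lemma toTorus_zero : toTorus d 0 = 0 := by
  ext i; simp [toTorus]

lemma isTestFunction_iff {φ : Space d → ℂ} :
    IsTestFunction d φ ↔ SmoothVia (cover d) φ ∧ HasCompactSupport φ :=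
  ⟨fun h => ⟨h.1, h.2⟩, fun h => ⟨h.1, h.2⟩⟩

/-- The derivative in the direction `w` of the non-periodic variables. -/
abbrev dX (w : E d) (F : Space d → ℂ) : Space d → ℂ := dirDeriv (cover d) (w, 0) F

/-- The derivative in the direction `w` of the periodic variables. -/
abbrev dY (w : E d) (F : Space d → ℂ) : Space d → ℂ := dirDeriv (cover d) (0, w) F

lemma lineD_slice_fst (F : Space d → ℂ) (w x : E d) (y : Torus d) :
    lineD w (fun x => F (x, y)) x = dX w F (x, y) := by
  simp [dirDeriv, cover_apply, toTorus_zero]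

lemma lineD_slice_snd (F : Space d → ℂ) (w x v : E d) (y : Torus d) :
    lineD w (fun v => F (x, y + toTorus d v)) v = dY w F (x, y + toTorus d v) := by
  simp [dirDeriv, cover_apply, toTorus_add, add_assoc]

/-- The Laplacian is the trace of the second derivative, computed here in the standard orthonormal
basis. This links the operator of the statement to iterated line derivatives, which can be
integrated by parts. -/
lemma laplacian_eq_lap {F : E d → ℂ} (hF : ContDiff ℝ ∞ F) (x : E d) :
    Laplacian.laplacian F x = lap F x := by
  have h := InnerProductSpace.laplacian_eq_iteratedFDeriv_orthonormalBasis F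
    (EuclideanSpace.basisFun (Fin d) ℝ)
  rw [h, lap]
  refine Finset.sum_congr rfl fun i _ => ?_
  have hF' : SmoothVia (AddMonoidHom.id (E d)) F := hF
  have hD : ContDiff ℝ ∞ (lineD (stdVec i) F) := hF'.dirDeriv _
  rw [lineD_eq_fderiv hD, iteratedFDeriv_two_apply]
  have e : lineD (stdVec i) F = fun x => fderiv ℝ F x (stdVec i) :=
    funext fun x => lineD_eq_fderiv hF _ x
  rw [e]
  have h1 : HasFDerivAt (fderiv ℝ F) (fderiv ℝ (fderiv ℝ F) x) x :=
    ((hF.fderiv_right (m := ∞) (by simp)).differentiable (by simp) x).hasFDerivAt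
  rw [(h1.clm_apply (hasFDerivAt_const (stdVec i) x)).fderiv]
  simp

lemma SmoothVia.slice_fst {F : Space d → ℂ} (hF : SmoothVia (cover d) F) (y : Torus d) :
    ContDiff ℝ ∞ fun x => F (x, y) := by
  obtain ⟨v, rfl⟩ := isOpenQuotientMap_toTorus.surjective y
  exact ContDiff.comp (g := F ∘ cover d) (f := fun x : E d => (x, v)) hF
    (contDiff_id.prodMk contDiff_const)

lemma SmoothVia.slice_snd {F : Space d → ℂ} (hF : SmoothVia (cover d) F) (x : E d) (y : Torus d) :
    ContDiff ℝ ∞ fun v => F (x, y + toTorus d v) := by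
  obtain ⟨u, rfl⟩ := isOpenQuotientMap_toTorus.surjective y
  simp_rw [← toTorus_add]
  exact ContDiff.comp (g := F ∘ cover d) (f := fun v : E d => (x, u + v)) hF
    (contDiff_const.prodMk (contDiff_const.add contDiff_id))

/-- The weight `|x|^{2γ}`. -/
def weight (d γ : ℕ) (p : Space d) : ℂ := ((‖p.1‖ ^ (2 * γ) : ℝ) : ℂ)

lemma contDiff_norm_pow (d γ : ℕ) : ContDiff ℝ ∞ fun x : E d => ‖x‖ ^ (2 * γ) := by
  simp_rw [pow_mul]
  exact (contDiff_norm_sq ℝ).pow γ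

lemma smoothVia_weight (d γ : ℕ) : SmoothVia (cover d) (weight d γ) :=
  Complex.ofRealCLM.contDiff.comp ((contDiff_norm_pow d γ).comp contDiff_fst)

lemma weight_add (γ : ℕ) (w : E d) (p : Space d) (t : ℝ) :
    weight d γ (p + cover d (t • ((0 : E d), w))) = weight d γ p := by
  simp [weight, cover_apply]

/-- The Grushin Laplacian as a sum of second derivatives. -/
lemma grushinLaplacian_eq (γ : ℕ) {F : Space d → ℂ} (hF : SmoothVia (cover d) F) (p : Space d) :
    grushinLaplacian d γ F p = ∑ i, dX (stdVec i) (dX (stdVec i) F) p +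
      weight d γ p * ∑ i, dY (stdVec i) (dY (stdVec i) F) p := by
  obtain ⟨x, y⟩ := p
  rw [grushinLaplacian, laplacian_eq_lap (hF.slice_fst y), laplacian_eq_lap (hF.slice_snd x y)]
  have h1 : ∀ w : E d, lineD w (fun x => F (x, y)) = fun x => dX w F (x, y) := fun w =>
    funext fun x => lineD_slice_fst F w x y
  have h2 : ∀ w : E d, lineD w (fun v => F (x, y + toTorus d v)) =
      fun v => dY w F (x, y + toTorus d v) := fun w => funext fun v => lineD_slice_snd F w x v y
  simp only [lap, h1, h2, lineD_slice_fst, lineD_slice_snd, toTorus_zero, add_zero, weight]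

lemma smoothVia_grushinLaplacian (γ : ℕ) {F : Space d → ℂ} (hF : SmoothVia (cover d) F) :
    SmoothVia (cover d) (grushinLaplacian d γ F) := by
  rw [funext (grushinLaplacian_eq γ hF)]
  exact (SmoothVia.sum _ fun i _ => (hF.dirDeriv _).dirDeriv _).add
    ((smoothVia_weight d γ).mul (SmoothVia.sum _ fun i _ => (hF.dirDeriv _).dirDeriv _))

lemma hasCompactSupport_grushinLaplacian (γ : ℕ) {φ : Space d → ℂ} (hφ : IsTestFunction d φ) :
    HasCompactSupport (grushinLaplacian d γ φ) := by
  rw [isTestFunction_iff] at hφ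
  rw [funext (grushinLaplacian_eq γ hφ.1)]
  refine HasCompactSupport.intro hφ.2 fun p hp => ?_
  have h1 : ∀ w, dirDeriv (cover d) w (dirDeriv (cover d) w φ) p = 0 := fun w =>
    dirDeriv_of_notMem_tsupport isOpenQuotientMap_cover
      fun h => hp (tsupport_dirDeriv_subset isOpenQuotientMap_cover h)
  simp [h1]

lemma grushinLaplacian_add (γ : ℕ) {φ ψ : Space d → ℂ} (hφ : SmoothVia (cover d) φ)
    (hψ : SmoothVia (cover d) ψ) (p : Space d) : grushinLaplacian d γ (fun p => φ p + ψ p) p =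
      grushinLaplacian d γ φ p + grushinLaplacian d γ ψ p := by
  have h1 : ∀ {φ ψ : Space d → ℂ} (_ : SmoothVia (cover d) φ) (_ : SmoothVia (cover d) ψ)
      (w : E d × E d), dirDeriv (cover d) w (fun p => φ p + ψ p) =
      fun p => dirDeriv (cover d) w φ p + dirDeriv (cover d) w ψ p := fun h h' w =>
    funext fun p => dirDeriv_add isOpenQuotientMap_cover.surjective h h' p
  rw [grushinLaplacian_eq γ (hφ.add hψ), grushinLaplacian_eq γ hφ, grushinLaplacian_eq γ hψ]
  simp only [h1 hφ hψ, h1 (hφ.dirDeriv _) (hψ.dirDeriv _), Finset.sum_add_distrib]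
  ring

lemma grushinLaplacian_const_mul (γ : ℕ) {φ : Space d → ℂ} (hφ : SmoothVia (cover d) φ) (c : ℂ)
    (p : Space d) : grushinLaplacian d γ (fun p => c * φ p) p = c * grushinLaplacian d γ φ p := by
  have h1 : ∀ (φ : Space d → ℂ) (w : E d × E d), dirDeriv (cover d) w (fun p => c * φ p) =
      fun p => c * dirDeriv (cover d) w φ p := fun φ w => funext fun p => dirDeriv_const_mul c p
  rw [grushinLaplacian_eq γ (hφ.const_mul c), grushinLaplacian_eq γ hφ]
  simp only [h1, ← Finset.mul_sum]
  ring

lemma grushinLaplacian_conj (γ : ℕ) {φ : Space d → ℂ} (hφ : SmoothVia (cover d) φ)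
    (p : Space d) :
    grushinLaplacian d γ (fun p => conj (φ p)) p = conj (grushinLaplacian d γ φ p) := by
  have h1 : ∀ {φ : Space d → ℂ} (_ : SmoothVia (cover d) φ) (w : E d × E d),
      dirDeriv (cover d) w (fun p => conj (φ p)) = fun p => conj (dirDeriv (cover d) w φ p) :=
    fun h w => funext fun p => dirDeriv_conj isOpenQuotientMap_cover.surjective h p
  rw [grushinLaplacian_eq γ hφ.conj, grushinLaplacian_eq γ hφ]
  simp only [h1 hφ, h1 (hφ.dirDeriv _), map_add, map_mul, map_sum]
  simp only [weight, Complex.conj_ofReal]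

/-- The weight depends on x alone, so it commutes with derivatives in y; this is what makes the
degenerate operator symmetric. -/
lemma dY_weight_mul (γ : ℕ) (F : Space d → ℂ) (w : E d) :
    dY w (fun p => weight d γ p * F p) = fun p => weight d γ p * dY w F p :=
  funext fun p => dirDeriv_mul_of_invariant (weight_add γ w) p

lemma IsTestFunction.smoothVia {φ : Space d → ℂ} (h : IsTestFunction d φ) :
    SmoothVia (cover d) φ := h.smooth

lemma IsTestFunction.conj {φ : Space d → ℂ} (h : IsTestFunction d φ) :
    IsTestFunction d fun p => conj (φ p) :=
  isTestFunction_iff.2 ⟨h.smoothVia.conj,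
    h.compactSupport.comp_left (g := fun z : ℂ => (starRingEnd ℂ) z) (by simp)⟩

lemma integrable_mul_of_test {F φ : Space d → ℂ} (hF : SmoothVia (cover d) F)
    (hφ : SmoothVia (cover d) φ) (hc : HasCompactSupport φ) :
    Integrable fun p => F p * φ p :=
  ((hF.mul hφ).continuous isOpenQuotientMap_cover).integrable_of_hasCompactSupport hc.mul_left

/-- Green's formula for the Grushin Laplacian. -/
lemma integral_mul_grushinLaplacian (γ : ℕ) {F φ : Space d → ℂ} (hF : SmoothVia (cover d) F)
    (hφ : IsTestFunction d φ) :
    ∫ p, F p * grushinLaplacian d γ φ p = ∫ p, grushinLaplacian d γ F p * φ p := by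
  have hs := hφ.smoothVia
  have hc := hφ.compactSupport
  have hπ : IsOpenQuotientMap (cover d) := isOpenQuotientMap_cover
  have hw := smoothVia_weight d γ
  have hcD : ∀ w, HasCompactSupport (dirDeriv (cover d) w (dirDeriv (cover d) w φ)) := fun w =>
    hasCompactSupport_dirDeriv hπ (hasCompactSupport_dirDeriv hπ hc)
  have e1 : ∀ p, F p * grushinLaplacian d γ φ p =
      ∑ i, (F p * dX (stdVec i) (dX (stdVec i) φ) p +
        weight d γ p * F p * dY (stdVec i) (dY (stdVec i) φ) p) := fun p => by
    rw [grushinLaplacian_eq γ hs, Finset.sum_add_distrib, ← Finset.mul_sum, ← Finset.mul_sum]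
    ring
  have e2 : ∀ p, grushinLaplacian d γ F p * φ p =
      ∑ i, (dX (stdVec i) (dX (stdVec i) F) p * φ p +
        weight d γ p * dY (stdVec i) (dY (stdVec i) F) p * φ p) := fun p => by
    rw [grushinLaplacian_eq γ hF, Finset.sum_add_distrib, ← Finset.sum_mul, ← Finset.sum_mul,
      ← Finset.mul_sum]
    ring
  simp_rw [e1, e2]
  have i1 : ∀ i, Integrable fun p => F p * dX (stdVec i) (dX (stdVec i) φ) p := fun i =>
    integrable_mul_of_test hF ((hs.dirDeriv _).dirDeriv _) (hcD _)
  have i2 : ∀ i, Integrable fun p => weight d γ p * F p * dY (stdVec i) (dY (stdVec i) φ) p :=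
    fun i => integrable_mul_of_test (hw.mul hF) ((hs.dirDeriv _).dirDeriv _) (hcD _)
  have i3 : ∀ i, Integrable fun p => dX (stdVec i) (dX (stdVec i) F) p * φ p := fun i =>
    integrable_mul_of_test ((hF.dirDeriv _).dirDeriv _) hs hc
  have i4 : ∀ i, Integrable fun p => weight d γ p * dY (stdVec i) (dY (stdVec i) F) p * φ p :=
    fun i => integrable_mul_of_test (hw.mul ((hF.dirDeriv _).dirDeriv _)) hs hc
  rw [integral_sum_add _ i1 i2, integral_sum_add _ i3 i4]
  refine Finset.sum_congr rfl fun i _ => ?_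
  congr 1
  · exact integral_mul_dirDeriv_dirDeriv hπ hF hs hc _
  · have := integral_mul_dirDeriv_dirDeriv (μ := volume) hπ (hw.mul hF) hs hc
      ((0 : E d), stdVec i)
    rw [this]
    simp only [dY_weight_mul]

/-- Non-negativity of `-Δ_γ` on test functions. -/
lemma re_integral_grushinLaplacian_nonpos (γ : ℕ) {φ : Space d → ℂ} (hφ : IsTestFunction d φ) :
    (∫ p, grushinLaplacian d γ φ p * conj (φ p)).re ≤ 0 := by
  have hs := hφ.smoothVia
  have hc := hφ.compactSupport
  have hs' := hφ.conj.smoothVia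
  have hc' := hφ.conj.compactSupport
  have hπ : IsOpenQuotientMap (cover d) := isOpenQuotientMap_cover
  have hw := smoothVia_weight d γ
  have e2 : ∀ p, grushinLaplacian d γ φ p * conj (φ p) =
      ∑ i, (dX (stdVec i) (dX (stdVec i) φ) p * conj (φ p) +
        dY (stdVec i) (fun p => weight d γ p * dY (stdVec i) φ p) p * conj (φ p)) := fun p => by
    rw [grushinLaplacian_eq γ hs, Finset.sum_add_distrib, ← Finset.sum_mul, ← Finset.sum_mul]
    simp only [dY_weight_mul, ← Finset.mul_sum]
    ring
  have hwD : ∀ i : Fin d, SmoothVia (cover d) fun p => weight d γ p * dY (stdVec i) φ p := fun i =>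
    hw.mul (hs.dirDeriv _)
  simp_rw [e2]
  have i3 : ∀ i, Integrable fun p => dX (stdVec i) (dX (stdVec i) φ) p * conj (φ p) := fun i =>
    integrable_mul_of_test ((hs.dirDeriv _).dirDeriv _) hs' hc'
  have i4 : ∀ i, Integrable fun p =>
      dY (stdVec i) (fun p => weight d γ p * dY (stdVec i) φ p) p * conj (φ p) :=
    fun i => integrable_mul_of_test ((hwD i).dirDeriv _) hs' hc'
  rw [integral_sum_add _ i3 i4, Complex.re_sum]
  refine Finset.sum_nonpos fun i _ => ?_
  rw [Complex.add_re]
  -- One integration by parts, used with G = ∂φ in the x directions and with G = |x|^{2γ}∂φ in the y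
  -- directions; both pair non-negatively with the conjugate of ∂φ.
  have key : ∀ (w : E d × E d) (G : Space d → ℂ) (_ : SmoothVia (cover d) G)
      (_ : ∀ p, 0 ≤ (G p * conj (dirDeriv (cover d) w φ p)).re),
      (∫ p, dirDeriv (cover d) w G p * conj (φ p)).re ≤ 0 := by
    intro w G hG h0
    have h1 := integral_mul_dirDeriv (μ := volume) hπ hG hs' hc' w
    have h2 : ∫ p, dirDeriv (cover d) w G p * conj (φ p) =
        - ∫ p, G p * conj (dirDeriv (cover d) w φ p) := by
      simp_rw [dirDeriv_conj hπ.surjective hs] at h1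
      rw [h1, neg_neg]
    rw [h2, Complex.neg_re, neg_nonpos]
    have hi : Integrable fun p => G p * conj (dirDeriv (cover d) w φ p) := by
      refine integrable_mul_of_test hG (hs.dirDeriv w).conj ?_
      exact (hasCompactSupport_dirDeriv hπ hc).comp_left (g := fun z : ℂ => (starRingEnd ℂ) z)
        (by simp)
    have h3 : (∫ p, G p * conj (dirDeriv (cover d) w φ p)).re =
      ∫ p, (G p * conj (dirDeriv (cover d) w φ p)).re := (integral_re (𝕜 := ℂ) hi).symm
    rw [h3]
    exact integral_nonneg h0
  refine add_nonpos (key _ _ (hs.dirDeriv _) fun p => ?_) (key _ _ (hwD i) fun p => ?_)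
  · rw [Complex.mul_conj, Complex.ofReal_re]
    exact Complex.normSq_nonneg _
  · rw [mul_assoc, Complex.mul_conj, weight, ← Complex.ofReal_mul, Complex.ofReal_re]
    exact mul_nonneg (by positivity) (Complex.normSq_nonneg _)

section Separated

variable (a : E d → ℂ) (n : Fin d → ℤ)

lemma mode_toTorus (v : E d) :
    mode n (toTorus d v) = Complex.exp (Complex.I * ∑ i, (n i : ℂ) * (v i : ℂ)) := by
  rw [mode_apply, Finset.mul_sum, Complex.exp_sum]
  refine Finset.prod_congr rfl fun i _ => ?_
  rw [toTorus, fourier_coe_apply]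
  congr 1
  have : (Real.pi : ℂ) ≠ 0 := by exact_mod_cast Real.pi_ne_zero
  push_cast
  field_simp

lemma mode_add_arg (y z : Torus d) : mode n (y + z) = mode n y * mode n z := by
  simp only [mode_apply, Pi.add_apply, fourier_apply, smul_add, AddCircle.toCircle_add,
    Circle.coe_mul, Finset.prod_mul_distrib]

lemma contDiff_mode_toTorus : ContDiff ℝ ∞ fun v : E d => mode n (toTorus d v) := by
  simp_rw [mode_toTorus]
  refine ContDiff.cexp (contDiff_const.mul (ContDiff.sum fun i _ => contDiff_const.mul ?_))
  exact Complex.ofRealCLM.contDiff.comp (contDiff_piLp_apply (p := 2))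

/-- The separated function `a(x) e^{i n·y}`. -/
def separated (p : Space d) : ℂ := a p.1 * mode n p.2

variable {a}

lemma smoothVia_separated (ha : ContDiff ℝ ∞ a) : SmoothVia (cover d) (separated a n) :=
  (ha.comp contDiff_fst).mul ((contDiff_mode_toTorus n).comp contDiff_snd)

lemma dX_separated (w : E d) :
    dX w (separated a n) = separated (lineD w a) n := by
  ext p
  simp [dirDeriv, separated, cover_apply, toTorus_zero]

lemma dY_separated (i : Fin d) :
    dY (stdVec i) (separated a n) = fun p => (Complex.I * n i) * separated a n p := by
  ext p
  have h1 : ∀ t : ℝ, mode n (toTorus d (t • stdVec i)) = Complex.exp (Complex.I * n i * t) := by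
    intro t
    rw [mode_toTorus, Finset.sum_eq_single i]
    · simp [mul_assoc]
    · intro j _ hj
      simp [hj]
    · simp
  have h2 : HasDerivAt (fun t : ℝ => Complex.exp (Complex.I * n i * t)) (Complex.I * n i) 0 := by
    have := (((hasDerivAt_id (0 : ℝ)).ofReal_comp).const_mul (Complex.I * n i)).cexp
    simpa using this
  simp only [dirDeriv, separated, cover_apply, Prod.fst_add, Prod.snd_add, Prod.smul_mk, smul_zero,
    add_zero, mode_add_arg, h1]
  rw [((h2.const_mul (mode n p.2)).const_mul (a p.1)).deriv]
  ring

/-- The Grushin operator acts on separated functions as a Schrödinger operator. -/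
lemma grushinLaplacian_separated (γ : ℕ) (ha : ContDiff ℝ ∞ a) (p : Space d) :
    grushinLaplacian d γ (separated a n) p =
      (lap a p.1 - (∑ i, (n i : ℂ) ^ 2) * (‖p.1‖ ^ (2 * γ) : ℝ) * a p.1) * mode n p.2 := by
  rw [grushinLaplacian_eq γ (smoothVia_separated n ha)]
  have h1 : ∀ (c : ℂ) (F : Space d → ℂ) (w : E d),
      dY w (fun p => c * F p) = fun p => c * dY w F p := fun c F w =>
    funext fun p => dirDeriv_const_mul c p
  simp only [dX_separated, dY_separated, h1, ← mul_assoc, ← Finset.sum_mul]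
  simp only [separated, lap, weight, ← Finset.sum_mul]
  have h2 : ∑ i, Complex.I * (n i : ℂ) * Complex.I * n i = -∑ i, (n i : ℂ) ^ 2 := by
    rw [← Finset.sum_neg_distrib]
    refine Finset.sum_congr rfl fun i _ => ?_
    linear_combination (n i : ℂ) ^ 2 * Complex.I_mul_I
  rw [h2]
  ring

lemma isTestFunction_separated (ha : ContDiff ℝ ∞ a) (hc : HasCompactSupport a) :
    IsTestFunction d (separated a n) := by
  refine isTestFunction_iff.2 ⟨smoothVia_separated n ha, ?_⟩
  refine HasCompactSupport.mul_right ?_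
  refine HasCompactSupport.intro (K := tsupport a ×ˢ univ) (hc.isCompact.prod isCompact_univ)
    fun p hp => ?_
  exact image_eq_zero_of_notMem_tsupport fun h' => hp ⟨h', mem_univ _⟩

end Separated

/-- The range of `1 - Δ_γ` on test functions is total in `L²`. -/
lemma ae_eq_zero_of_grushin_weak (γ : ℕ) {f : Space d → ℂ} (hfm : StronglyMeasurable f)
    (hf : MemLp f 2)
    (h : ∀ φ, IsTestFunction d φ → ∫ p, f p * (φ p - grushinLaplacian d γ φ p) = 0) :
    f =ᵐ[volume] 0 := by
  refine ae_eq_zero_of_coeff hfm hf fun n => ?_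
  set c : ℝ := ∑ i, (n i : ℝ) ^ 2 with hcdef
  have hc0 : 0 ≤ c := Finset.sum_nonneg fun i _ => sq_nonneg _
  have hVc : Continuous fun x : E d => c * ‖x‖ ^ (2 * γ) := by fun_prop
  -- Testing with ψ(x)e^{i n·y} turns the Fourier coefficient into a weak solution of a Schrödinger
  -- equation with potential |n|²|x|^{2γ}.
  refine ae_eq_zero_of_weak (V := fun x => c * ‖x‖ ^ (2 * γ)) hVc (fun x => by positivity)
    (memLp_coeff hfm hf n) fun ψ hψ hψc => ?_
  have hlap : Continuous (lap ψ) := by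
    have hu' : SmoothVia (AddMonoidHom.id (E d)) ψ := hψ
    exact continuous_finsetSum _ fun i _ =>
      ((hu'.dirDeriv _).dirDeriv _).continuous isOpenQuotientMap_id
  have hlapc : HasCompactSupport (lap ψ) := by
    refine HasCompactSupport.intro hψc fun x hx => ?_
    refine Finset.sum_eq_zero fun i _ => ?_
    exact dirDeriv_of_notMem_tsupport isOpenQuotientMap_id
      fun h => hx (tsupport_dirDeriv_subset isOpenQuotientMap_id h)
  have hcont : Continuous fun x => (1 + (c * ‖x‖ ^ (2 * γ) : ℝ) : ℂ) * ψ x - lap ψ x :=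
    ((continuous_const.add (Complex.continuous_ofReal.comp hVc)).mul hψ.continuous).sub hlap
  have hcs : HasCompactSupport fun x => (1 + (c * ‖x‖ ^ (2 * γ) : ℝ) : ℂ) * ψ x - lap ψ x :=
    (hψc.mul_left).sub hlapc
  rw [← integral_mul_mode hf hcont hcs n, ← h _ (isTestFunction_separated n hψ hψc)]
  refine integral_congr_ae (Eventually.of_forall fun p => ?_)
  simp only [grushinLaplacian_separated n γ hψ, separated, hcdef]
  push_cast
  ring

/-- The graph of `-Δ_γ` on test functions, as a subspace of `L² × L²`. -/
def testGraph (d γ : ℕ) : Submodule ℂ (L2 d × L2 d) where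
  carrier := {q | ∃ φ : Space d → ℂ, IsTestFunction d φ ∧ q.1 =ᵐ[volume] φ ∧
    q.2 =ᵐ[volume] fun p => -grushinLaplacian d γ φ p}
  add_mem' := by
    rintro q r ⟨φ, hφ, h1, h2⟩ ⟨ψ, hψ, h3, h4⟩
    refine ⟨fun p => φ p + ψ p, isTestFunction_iff.2 ⟨hφ.smoothVia.add hψ.smoothVia,
      hφ.compactSupport.add hψ.compactSupport⟩, ?_, ?_⟩
    · filter_upwards [Lp.coeFn_add q.1 r.1, h1, h3] with p e e1 e3
      rw [Prod.fst_add, e, Pi.add_apply, e1, e3]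
    · filter_upwards [Lp.coeFn_add q.2 r.2, h2, h4] with p e e1 e3
      rw [Prod.snd_add, e, Pi.add_apply, e1, e3,
        grushinLaplacian_add γ hφ.smoothVia hψ.smoothVia, neg_add]
  zero_mem' := by
    have h0 : SmoothVia (cover d) (fun _ => (0 : ℂ)) := by
      unfold SmoothVia
      exact contDiff_const
    refine ⟨fun _ => 0, isTestFunction_iff.2 ⟨h0, HasCompactSupport.zero⟩, Lp.coeFn_zero _ _ _, ?_⟩
    have h1 : ∀ p, grushinLaplacian d γ (fun _ => 0) p = 0 := fun p => by
      simpa using grushinLaplacian_const_mul γ h0 0 p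
    filter_upwards [Lp.coeFn_zero ℂ 2 (volume : Measure (Space d))] with p hp
    rw [h1, neg_zero]
    exact hp
  smul_mem' := by
    rintro c q ⟨φ, hφ, h1, h2⟩
    refine ⟨fun p => c * φ p, isTestFunction_iff.2 ⟨hφ.smoothVia.const_mul c,
      hφ.compactSupport.mul_left⟩, ?_, ?_⟩
    · filter_upwards [Lp.coeFn_smul c q.1, h1] with p e e1
      rw [Prod.smul_fst, e, Pi.smul_apply, e1, smul_eq_mul]
    · filter_upwards [Lp.coeFn_smul c q.2, h2] with p e e1
      rw [Prod.smul_snd, e, Pi.smul_apply, e1, smul_eq_mul,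
        grushinLaplacian_const_mul γ hφ.smoothVia, mul_neg]

lemma IsTestFunction.memLp {φ : Space d → ℂ} (h : IsTestFunction d φ) : MemLp φ 2 :=
  (h.smoothVia.continuous isOpenQuotientMap_cover).memLp_of_hasCompactSupport h.compactSupport

lemma IsTestFunction.memLp_neg_grushinLaplacian (γ : ℕ) {φ : Space d → ℂ}
    (h : IsTestFunction d φ) : MemLp (fun p => -grushinLaplacian d γ φ p) 2 :=
  (((smoothVia_grushinLaplacian γ h.smoothVia).continuous
    isOpenQuotientMap_cover).memLp_of_hasCompactSupport
      (hasCompactSupport_grushinLaplacian γ h)).neg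

lemma inner_eq_integral (f g : L2 d) {F G : Space d → ℂ} (hf : f =ᵐ[volume] F)
    (hg : g =ᵐ[volume] G) : ⟪f, g⟫_ℂ = ∫ p, G p * conj (F p) := by
  rw [L2.inner_def]
  refine integral_congr_ae ?_
  filter_upwards [hf, hg] with p h1 h2
  rw [h1, h2]
  rfl

/-- The operator `-Δ_γ` has a bounded selfadjoint resolvent with spectrum in `[0, 1]`. -/
theorem exists_isResolvent_grushinGraph (d γ : ℕ) : ∃ R : L2 d →L[ℂ] L2 d,
    IsResolvent (grushinGraph d γ) R ∧ IsSelfAdjoint R ∧ spectrum ℝ R ⊆ Icc 0 1 := by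
  refine exists_isResolvent (testGraph d γ) _ ?_ ?_ ?_ ?_
  -- The graph uses the bilinear pairing and the inner product is sesquilinear. Replacing φ by its
  -- conjugate passes between them, because Δ_γ has real coefficients.
  · intro f g
    constructor
    · rintro h q ⟨φ, hφ, h1, h2⟩
      have h3 := h _ hφ.conj
      rw [inner_eq_integral _ _ h2 Filter.EventuallyEq.rfl,
        inner_eq_integral _ _ h1 Filter.EventuallyEq.rfl]
      simp only [grushinLaplacian_conj γ hφ.smoothVia] at h3
      simpa using h3
    · intro h φ hφ
      have h3 := h ⟨hφ.conj.memLp.toLp _, (hφ.conj.memLp_neg_grushinLaplacian γ).toLp _⟩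
        ⟨_, hφ.conj, hφ.conj.memLp.coeFn_toLp, (hφ.conj.memLp_neg_grushinLaplacian γ).coeFn_toLp⟩
      rw [inner_eq_integral _ _ (hφ.conj.memLp_neg_grushinLaplacian γ).coeFn_toLp
          Filter.EventuallyEq.rfl,
        inner_eq_integral _ _ hφ.conj.memLp.coeFn_toLp Filter.EventuallyEq.rfl] at h3
      simp only [grushinLaplacian_conj γ hφ.smoothVia] at h3
      simpa using h3
  · rintro q ⟨φ, hφ, h1, h2⟩ r ⟨ψ, hψ, h3, h4⟩
    rw [inner_eq_integral _ _ h2 h3, inner_eq_integral _ _ h1 h4]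
    have := integral_mul_grushinLaplacian γ hψ.smoothVia hφ.conj
    simp only [grushinLaplacian_conj γ hφ.smoothVia] at this
    simp only [map_neg, mul_neg, neg_mul, integral_neg, this]
  · rintro q ⟨φ, hφ, h1, h2⟩
    rw [inner_eq_integral _ _ h1 h2]
    have := re_integral_grushinLaplacian_nonpos γ hφ
    simp only [neg_mul, integral_neg, Complex.neg_re]
    linarith
  · intro f h
    rw [Lp.eq_zero_iff_ae_eq_zero]
    refine ae_eq_zero_of_grushin_weak γ (Lp.stronglyMeasurable f) (Lp.memLp f) fun φ hφ => ?_
    have h3 := h ⟨hφ.conj.memLp.toLp _, (hφ.conj.memLp_neg_grushinLaplacian γ).toLp _⟩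
      ⟨_, hφ.conj, hφ.conj.memLp.coeFn_toLp, (hφ.conj.memLp_neg_grushinLaplacian γ).coeFn_toLp⟩
    rw [inner_add_left, inner_eq_integral _ _ hφ.conj.memLp.coeFn_toLp Filter.EventuallyEq.rfl,
      inner_eq_integral _ _ (hφ.conj.memLp_neg_grushinLaplacian γ).coeFn_toLp
        Filter.EventuallyEq.rfl] at h3
    simp only [grushinLaplacian_conj γ hφ.smoothVia] at h3
    simp only [map_neg, Complex.conj_conj] at h3
    rw [← h3, ← integral_add]
    · refine integral_congr_ae (Eventually.of_forall fun p => ?_)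
      simp only
      ring
    · exact (Lp.memLp f).integrable_mul hφ.memLp
    · exact (Lp.memLp f).integrable_mul (hφ.memLp_neg_grushinLaplacian γ)

end Grushin

/-! ### Everywhere convergent real power series. -/

section PowerSeries

open Topology Filter
open scoped ContDiff

lemma hasSum_of_eq {f g : ℕ → ℝ} {s : ℝ} (h : HasSum f s) (e : ∀ k, f k = g k) : HasSum g s := by
  rwa [← funext e]

/-- The coefficients of an everywhere convergent power series. -/
def IsEntire (a : ℕ → ℝ) : Prop := ∀ B : ℝ, 1 ≤ B → Summable fun k => |a k| * B ^ k

/-- The sum of a power series. -/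
def ser (a : ℕ → ℝ) (x : ℝ) : ℝ := ∑' k, a k * x ^ k

/-- The coefficients of the derivative of a power series. -/
def dcoef (a : ℕ → ℝ) (k : ℕ) : ℝ := (k + 1) * a (k + 1)

variable {a : ℕ → ℝ}

lemma IsEntire.summable (ha : IsEntire a) (x : ℝ) : Summable fun k => a k * x ^ k := by
  refine Summable.of_norm_bounded (ha (max 1 |x|) (le_max_left _ _)) fun k => ?_
  rw [norm_mul, norm_pow, Real.norm_eq_abs, Real.norm_eq_abs]
  gcongr
  exact le_max_right _ _

lemma IsEntire.hasSum (ha : IsEntire a) (x : ℝ) : HasSum (fun k => a k * x ^ k) (ser a x) :=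
  (ha.summable x).hasSum

/-- The factor k produced by differentiation is absorbed by doubling the radius, which costs nothing
for an entire series. -/
lemma nat_mul_pow_le {B : ℝ} (hB : 1 ≤ B) (k : ℕ) : (k : ℝ) * B ^ (k - 1) ≤ (2 * B) ^ k := by
  rw [mul_pow]
  have h1 : (k : ℝ) ≤ 2 ^ k := by exact_mod_cast Nat.lt_two_pow_self.le
  exact mul_le_mul h1 (pow_le_pow_right₀ hB (Nat.sub_le k 1)) (by positivity) (by positivity)

lemma IsEntire.dcoef (ha : IsEntire a) : IsEntire (dcoef a) := by
  intro B hB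
  have h := (summable_nat_add_iff 1).2 (ha (2 * B) (by linarith))
  refine Summable.of_nonneg_of_le (fun k => by positivity) (fun k => ?_) h
  have h2 := nat_mul_pow_le hB (k + 1)
  simp only [Nat.add_sub_cancel, Nat.cast_add, Nat.cast_one] at h2
  rw [BaouendiGrushin.dcoef, abs_mul, abs_of_nonneg (by positivity : (0 : ℝ) ≤ k + 1)]
  calc ((k : ℝ) + 1) * |a (k + 1)| * B ^ k = |a (k + 1)| * (((k : ℝ) + 1) * B ^ k) := by ring
    _ ≤ _ := by gcongr

lemma IsEntire.hasDerivAt (ha : IsEntire a) (x : ℝ) :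
    HasDerivAt (ser a) (ser (BaouendiGrushin.dcoef a) x) x := by
  set B : ℝ := |x| + 1 with hBdef
  have hB : 1 ≤ B := by linarith [abs_nonneg x]
  have key := hasDerivAt_tsum_of_isPreconnected (𝕜 := ℝ) (ha (2 * B) (by linarith))
    (t := Ioo (-B) B) isOpen_Ioo isPreconnected_Ioo (g := fun k y => a k * y ^ k)
    (g' := fun k y => a k * ((k : ℝ) * y ^ (k - 1)))
    (fun k y _ => (hasDerivAt_pow k y).const_mul (a k)) (fun k y hy => ?_) (y₀ := 0)
    ⟨by linarith, by linarith⟩ (ha.summable 0) (y := x)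
    ⟨by linarith [neg_abs_le x], by linarith [le_abs_self x]⟩
  · refine HasDerivAt.congr_deriv key ?_
    have hs : Summable fun k => a k * ((k : ℝ) * x ^ (k - 1)) := by
      refine (summable_nat_add_iff 1).1 ((ha.dcoef.summable x).congr fun k => ?_)
      simp only [BaouendiGrushin.dcoef, Nat.add_sub_cancel, Nat.cast_add, Nat.cast_one]
      ring
    rw [hs.tsum_eq_zero_add, ser]
    simp only [Nat.cast_zero, zero_mul, mul_zero, zero_add, BaouendiGrushin.dcoef,
      Nat.add_sub_cancel, Nat.cast_add, Nat.cast_one]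
    refine tsum_congr fun k => by ring
  · rw [norm_mul, norm_mul, norm_pow, Real.norm_eq_abs, Real.norm_eq_abs, Real.norm_eq_abs,
      Nat.abs_cast]
    refine mul_le_mul_of_nonneg_left (le_trans ?_ (nat_mul_pow_le hB k)) (abs_nonneg _)
    gcongr
    exact (abs_lt.2 hy).le

lemma IsEntire.contDiff (ha : IsEntire a) : ContDiff ℝ ∞ (ser a) := by
  rw [contDiff_infty]
  intro n
  induction n generalizing a with
  | zero => exact contDiff_zero.2 (continuous_iff_continuousAt.2 fun x => (ha.hasDerivAt x).continuousAt)
  | succ n ih =>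
    have hd : deriv (ser a) = ser (BaouendiGrushin.dcoef a) := funext fun x => (ha.hasDerivAt x).deriv
    push_cast
    rw [contDiff_succ_iff_deriv]
    refine ⟨fun x => (ha.hasDerivAt x).differentiableAt, by simp, ?_⟩
    rw [hd]
    exact ih ha.dcoef

end PowerSeries

/-! ### The regular radial solution as a power series depending on the energy. -/

section RadialSolution

open Topology Filter
open scoped ContDiff

/-- The coefficients of the regular solution `U` of `4ρU'' + 2dU' = (ρ^γ - λ) U`. -/
def coef (d γ : ℕ) (lam : ℝ) : ℕ → ℝ
  | 0 => 1
  | k + 1 => ((if γ ≤ k then coef d γ lam (k - γ) else 0) - lam * coef d γ lam k) /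
      ((k + 1) * (4 * k + 2 * d))
decreasing_by all_goals omega

variable {d γ : ℕ}

lemma coef_zero (lam : ℝ) : coef d γ lam 0 = 1 := by rw [coef]

lemma coef_succ (lam : ℝ) (k : ℕ) : coef d γ lam (k + 1) =
    ((if γ ≤ k then coef d γ lam (k - γ) else 0) - lam * coef d γ lam k) /
      ((k + 1) * (4 * k + 2 * d)) := by rw [coef]

lemma continuous_coef (k : ℕ) : Continuous fun lam => coef d γ lam k := by
  induction k using Nat.strong_induction_on with
  | _ k ih =>
    cases k with
    | zero => simp_rw [coef_zero]; exact continuous_const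
    | succ k =>
      simp_rw [coef_succ]
      refine Continuous.div_const (Continuous.sub ?_ (continuous_id.mul (ih k (by omega)))) _
      split_ifs
      · exact ih _ (by omega)
      · exact continuous_const

lemma coef_nonneg {L : ℝ} (hL : L ≤ 0) (k : ℕ) : 0 ≤ coef d γ L k := by
  induction k using Nat.strong_induction_on with
  | _ k ih =>
    cases k with
    | zero => rw [coef_zero]; exact zero_le_one
    | succ k =>
      rw [coef_succ]
      refine div_nonneg ?_ (by positivity)
      have h1 := mul_nonneg (neg_nonneg.2 hL) (ih k (by omega))
      split_ifs
      · linarith [ih (k - γ) (by omega)]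
      · linarith

/-- At energy -L both terms of the recursion are non-negative, so its coefficients majorize those of
every energy with |λ| ≤ L. This uniformity gives joint continuity in the energy. -/
lemma abs_coef_le {lam L : ℝ} (h : |lam| ≤ L) (k : ℕ) : |coef d γ lam k| ≤ coef d γ (-L) k := by
  have hL : 0 ≤ L := (abs_nonneg _).trans h
  induction k using Nat.strong_induction_on with
  | _ k ih =>
    cases k with
    | zero => simp [coef_zero]
    | succ k =>
      rw [coef_succ, coef_succ, abs_div,
        abs_of_nonneg (by positivity : (0 : ℝ) ≤ ((k : ℝ) + 1) * (4 * k + 2 * d))]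
      refine div_le_div_of_nonneg_right ?_ (by positivity)
      refine (abs_sub _ _).trans ?_
      rw [sub_eq_add_neg, ← neg_mul, neg_neg, abs_mul]
      refine add_le_add ?_ (mul_le_mul h (ih k (by omega)) (abs_nonneg _) hL)
      split_ifs
      · exact ih _ (by omega)
      · simp

/-- Once the denominator (k+1)(4k+2d) exceeds B^{γ+1} + LB, the recursion cannot increase a bound
valid for all earlier terms. The constant is the sum of the finitely many terms before that. -/
lemma coef_mul_pow_le {L B : ℝ} (hL : 0 ≤ L) (hB : 1 ≤ B) :
    ∃ C : ℝ, ∀ k, coef d γ (-L) k * B ^ k ≤ C := by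
  obtain ⟨k₀, hk₀⟩ := exists_nat_ge (B ^ (γ + 1) + L * B)
  have hB0 : 0 ≤ B := by linarith
  have hc : ∀ k, 0 ≤ coef d γ (-L) k := coef_nonneg (by linarith)
  set C : ℝ := ∑ j ∈ Finset.range (k₀ + 2), coef d γ (-L) j * B ^ j with hC
  have hterm : ∀ j, 0 ≤ coef d γ (-L) j * B ^ j := fun j => mul_nonneg (hc j) (pow_nonneg hB0 _)
  have hC0 : 0 ≤ C := Finset.sum_nonneg fun j _ => hterm j
  refine ⟨C, fun k => ?_⟩
  induction k using Nat.strong_induction_on with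
  | _ k ih =>
    by_cases hk : k < k₀ + 2
    · exact Finset.single_le_sum (f := fun j => coef d γ (-L) j * B ^ j) (fun j _ => hterm j)
        (Finset.mem_range.2 hk)
    · obtain ⟨m, rfl⟩ : ∃ m, k = m + 1 := ⟨k - 1, by omega⟩
      have hm : k₀ + 1 ≤ m := by omega
      have hmr : (k₀ : ℝ) + 1 ≤ m := by exact_mod_cast hm
      have hden : (B ^ (γ + 1) + L * B) ≤ ((m : ℝ) + 1) * (4 * m + 2 * d) := by
        have : (0 : ℝ) ≤ d := Nat.cast_nonneg _
        nlinarith [Nat.cast_nonneg (α := ℝ) k₀]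
      have hdpos : 0 < ((m : ℝ) + 1) * (4 * m + 2 * d) := by
        have : (0 : ℝ) ≤ d := Nat.cast_nonneg _
        have : (0 : ℝ) ≤ k₀ := Nat.cast_nonneg _
        have : (0 : ℝ) < m := by linarith
        positivity
      rw [coef_succ, div_mul_eq_mul_div, div_le_iff₀ hdpos]
      have h1 : (if γ ≤ m then coef d γ (-L) (m - γ) else 0) * B ^ (m + 1) ≤ C * B ^ (γ + 1) := by
        split_ifs with hγ
        · have h2 : B ^ (m + 1) = B ^ (m - γ) * B ^ (γ + 1) := by
            rw [← pow_add]
            congr 1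
            omega
          rw [h2, ← mul_assoc]
          exact mul_le_mul_of_nonneg_right (ih _ (by omega)) (pow_nonneg hB0 _)
        · rw [zero_mul]
          positivity
      have h2 : coef d γ (-L) m * B ^ m * (L * B) ≤ C * (L * B) :=
        mul_le_mul_of_nonneg_right (ih _ (by omega)) (by positivity)
      have h3 : C * (B ^ (γ + 1) + L * B) ≤ C * (((m : ℝ) + 1) * (4 * m + 2 * d)) :=
        mul_le_mul_of_nonneg_left hden hC0
      rw [pow_succ] at h1 ⊢
      nlinarith

lemma isEntire_coef (d γ : ℕ) (lam : ℝ) : IsEntire (coef d γ lam) := by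
  intro B hB
  -- Boundedness at radius 2B leaves a factor 2^{-k} at radius B.
  obtain ⟨C, hC⟩ := coef_mul_pow_le (d := d) (γ := γ) (abs_nonneg lam)
    (by linarith : (1 : ℝ) ≤ 2 * B)
  refine Summable.of_nonneg_of_le (fun k => by positivity) (fun k => ?_)
    (summable_geometric_two.mul_left C)
  have h1 := hC k
  rw [mul_pow] at h1
  have h2 := abs_coef_le (d := d) (γ := γ) (le_refl |lam|) k
  have h3 : |coef d γ lam k| * B ^ k ≤ coef d γ (-|lam|) k * B ^ k := by gcongr
  have h4 : (1 / 2 : ℝ) ^ k * 2 ^ k = 1 := by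
    rw [← mul_pow]
    norm_num
  have h5 : (0 : ℝ) < (1 / 2) ^ k := by positivity
  calc |coef d γ lam k| * B ^ k ≤ coef d γ (-|lam|) k * B ^ k := h3
    _ = coef d γ (-|lam|) k * (2 ^ k * B ^ k) * (1 / 2) ^ k := by
        linear_combination (-(coef d γ (-|lam|) k * B ^ k)) * h4
    _ ≤ C * (1 / 2) ^ k := mul_le_mul_of_nonneg_right h1 h5.le

/-- The regular solution in the variable `ρ = |x|²`. -/
def solU (d γ : ℕ) (lam : ℝ) : ℝ → ℝ := ser (coef d γ lam)

/-- The derivative of `solU`. -/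
def solU' (d γ : ℕ) (lam : ℝ) : ℝ → ℝ := ser (dcoef (coef d γ lam))

/-- The second derivative of `solU`. -/
def solU'' (d γ : ℕ) (lam : ℝ) : ℝ → ℝ := ser (dcoef (dcoef (coef d γ lam)))

lemma hasDerivAt_solU (lam x : ℝ) : HasDerivAt (solU d γ lam) (solU' d γ lam x) x :=
  (isEntire_coef d γ lam).hasDerivAt x

lemma hasDerivAt_solU' (lam x : ℝ) : HasDerivAt (solU' d γ lam) (solU'' d γ lam x) x :=
  (isEntire_coef d γ lam).dcoef.hasDerivAt x

lemma contDiff_solU (lam : ℝ) : ContDiff ℝ ∞ (solU d γ lam) := (isEntire_coef d γ lam).contDiff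

lemma ser_zero (a : ℕ → ℝ) : ser a 0 = a 0 := by
  rw [ser, tsum_eq_single 0]
  · simp
  · intro k hk
    simp [hk]

lemma solU_zero (lam : ℝ) : solU d γ lam 0 = 1 := by
  rw [solU, ser_zero, coef_zero]

/-- All coefficients are non-negative at energy 0; this starts the shooting argument. -/
lemma one_le_solU {x : ℝ} (hx : 0 ≤ x) : 1 ≤ solU d γ 0 x := by
  have h := ((isEntire_coef d γ 0).summable x).le_tsum 0
    fun k _ => mul_nonneg (coef_nonneg le_rfl k) (pow_nonneg hx k)
  simp only [coef_zero, pow_zero, mul_one] at h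
  exact h

/-- The differential equation. -/
lemma solU_ode (hd : 1 ≤ d) (lam x : ℝ) :
    4 * x * solU'' d γ lam x + 2 * d * solU' d γ lam x = (x ^ γ - lam) * solU d γ lam x := by
  set a := coef d γ lam with ha
  have hE := isEntire_coef d γ lam
  have h0 := hE.hasSum x
  have h1 := hE.dcoef.hasSum x
  have h2 := hE.dcoef.dcoef.hasSum x
  have h3 : HasSum (fun k : ℕ => (k : ℝ) * (k + 1) * a (k + 1) * x ^ k) (x * solU'' d γ lam x) := by
    refine (hasSum_nat_add_iff' 1).1 ?_
    simp only [Finset.range_one, Finset.sum_singleton, Nat.cast_zero, zero_mul, sub_zero]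
    refine hasSum_of_eq (h2.mul_left x) fun k => ?_
    simp only [dcoef, Nat.cast_add, Nat.cast_one, ← ha]
    ring
  have h4 : HasSum (fun k : ℕ => (if γ ≤ k then a (k - γ) else 0) * x ^ k)
      (x ^ γ * solU d γ lam x) := by
    refine (hasSum_nat_add_iff' γ).1 ?_
    have : ∑ i ∈ Finset.range γ, (if γ ≤ i then a (i - γ) else 0) * x ^ i = 0 := by
      refine Finset.sum_eq_zero fun i hi => ?_
      rw [if_neg (by simpa using hi), zero_mul]
    rw [this, sub_zero]
    refine hasSum_of_eq (h0.mul_left (x ^ γ)) fun k => ?_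
    rw [if_pos (by omega), Nat.add_sub_cancel, pow_add]
    ring
  have h5 : HasSum (fun k : ℕ => (if γ ≤ k then a (k - γ) else 0) * x ^ k - lam * (a k * x ^ k))
      (4 * (x * solU'' d γ lam x) + 2 * d * solU' d γ lam x) := by
    refine hasSum_of_eq ((h3.mul_left 4).add (h1.mul_left (2 * (d : ℝ)))) fun k => ?_
    have hd' : (1 : ℝ) ≤ d := by exact_mod_cast hd
    have hne : ((k : ℝ) + 1) * (4 * k + 2 * d) ≠ 0 := by positivity
    have e := coef_succ (d := d) (γ := γ) lam k
    rw [eq_div_iff hne] at e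
    simp only [dcoef, ← ha] at e ⊢
    linear_combination x ^ k * e
  have h6 : 4 * (x * solU'' d γ lam x) + 2 * d * solU' d γ lam x =
    x ^ γ * solU d γ lam x - lam * solU d γ lam x := h5.unique (h4.sub (h0.mul_left lam))
  linear_combination h6

lemma continuous_ser_param {c : ℝ → ℕ → ℝ} (hc : ∀ k, Continuous fun lam => c lam k)
    {b : ℝ → ℕ → ℝ} (hb : ∀ L, IsEntire (b L)) (hcb : ∀ lam L k, |lam| ≤ L → |c lam k| ≤ b L k) :
    Continuous fun q : ℝ × ℝ => ser (c q.1) q.2 := by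
  rw [continuous_iff_continuousAt]
  intro q
  set L := |q.1| + 1
  set B := |q.2| + 1 with hB
  have hon : ContinuousOn (fun q : ℝ × ℝ => ser (c q.1) q.2) (Ioo (-L) L ×ˢ Ioo (-B) B) := by
    refine continuousOn_tsum (fun k => ?_) (hb L B (by linarith [abs_nonneg q.2])) fun k p hp => ?_
    · exact (((hc k).comp continuous_fst).mul (continuous_snd.pow k)).continuousOn
    · rw [norm_mul, norm_pow, Real.norm_eq_abs, Real.norm_eq_abs]
      exact mul_le_mul ((hcb _ _ _ (abs_lt.2 hp.1).le).trans (le_abs_self _))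
        (pow_le_pow_left₀ (abs_nonneg _) (abs_lt.2 hp.2).le k) (by positivity) (abs_nonneg _)
  refine hon.continuousAt (prod_mem_nhds ?_ ?_)
  · exact Ioo_mem_nhds (by linarith [neg_abs_le q.1]) (by linarith [le_abs_self q.1])
  · exact Ioo_mem_nhds (by linarith [neg_abs_le q.2]) (by linarith [le_abs_self q.2])

lemma continuous_solU (d γ : ℕ) : Continuous fun q : ℝ × ℝ => solU d γ q.1 q.2 :=
  continuous_ser_param (c := coef d γ) (b := fun L => coef d γ (-L)) continuous_coef
    (fun _ => isEntire_coef _ _ _) fun _ _ k h => abs_coef_le h k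

lemma continuous_solU' (d γ : ℕ) : Continuous fun q : ℝ × ℝ => solU' d γ q.1 q.2 := by
  refine continuous_ser_param (c := fun lam => dcoef (coef d γ lam))
    (b := fun L => dcoef (coef d γ (-L))) (fun k => (continuous_coef (k + 1)).const_mul _)
    (fun _ => (isEntire_coef _ _ _).dcoef) fun lam L k h => ?_
  rw [dcoef, dcoef, abs_mul, abs_of_nonneg (by positivity : (0 : ℝ) ≤ k + 1)]
  exact mul_le_mul_of_nonneg_left (abs_coef_le h (k + 1)) (by positivity)

end RadialSolution

/-! ### Ground state energy by shooting, positivity and decay. -/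

section GroundState

open Topology Filter
open scoped ContDiff

/-- `u` is the regular solution of the radial equation `u'' + (d-1)/r u' = (r^{2γ} - λ) u`, and `p`
is its derivative. -/
structure IsRadial (d γ : ℕ) (lam : ℝ) (u p : ℝ → ℝ) : Prop where
  deriv_u : ∀ r, HasDerivAt u (p r) r
  deriv_p : ∀ r, 0 < r → HasDerivAt p ((r ^ (2 * γ) - lam) * u r - (d - 1) / r * p r) r
  u_zero : u 0 = 1
  p_zero : p 0 = 0
  cont_p : Continuous p

variable {d γ : ℕ} {lam : ℝ} {u p : ℝ → ℝ}

lemma isRadial_solU (hd : 1 ≤ d) (lam : ℝ) : IsRadial d γ lam (fun r => solU d γ lam (r ^ 2))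
    (fun r => 2 * r * solU' d γ lam (r ^ 2)) where
  deriv_u r := by
    have := (hasDerivAt_solU (d := d) (γ := γ) lam (r ^ 2)).comp r (hasDerivAt_pow 2 r)
    refine this.congr_deriv ?_
    simp
    ring
  deriv_p r hr := by
    have h1 := (hasDerivAt_solU' (d := d) (γ := γ) lam (r ^ 2)).comp r (hasDerivAt_pow 2 r)
    have h2 := ((hasDerivAt_id r).const_mul 2).mul h1
    refine h2.congr_deriv ?_
    have h3 := solU_ode (γ := γ) hd lam (r ^ 2)
    rw [pow_mul, ← h3]
    simp only [id, Function.comp]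
    field_simp
    push_cast
    ring
  u_zero := by simp [solU_zero]
  p_zero := by simp
  cont_p := by
    have h1 := (continuous_solU' d γ).comp (continuous_const (y := lam).prodMk (continuous_pow 2))
    exact (continuous_const.mul continuous_id).mul h1

namespace IsRadial

lemma cont_u (h : IsRadial d γ lam u p) : Continuous u :=
  continuous_iff_continuousAt.2 fun r => (h.deriv_u r).continuousAt

/-- A nontrivial solution has no double zero. -/
lemma not_double_zero (h : IsRadial d γ lam u p) (hd : 1 ≤ d) {r₀ : ℝ} (hr₀ : 0 < r₀)
    (hu : u r₀ = 0) (hp : p r₀ = 0) : False := by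
  have hd' : (1 : ℝ) ≤ d := by exact_mod_cast hd
  have key : ∀ ε ∈ Ioo 0 r₀, u ε = 0 := by
    intro ε hε
    set V : ℝ := r₀ ^ (2 * γ) + |lam| with hV
    -- A Gronwall constant on [ε, r₀], where the singular coefficient is at most (d-1)/ε. It makes
    -- (u² + p²)e^{Cr} non-decreasing, so vanishing at r₀ propagates back to ε, and ε → 0
    -- contradicts u(0) = 1.
    set C : ℝ := 1 + V + 2 * ((d - 1) / ε) with hC
    have hder : ∀ r, 0 < r → HasDerivAt (fun r => (u r ^ 2 + p r ^ 2) * Real.exp (C * r))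
        (((2 * u r * p r + 2 * p r * ((r ^ (2 * γ) - lam) * u r - (d - 1) / r * p r)) +
          (u r ^ 2 + p r ^ 2) * C) * Real.exp (C * r)) r := by
      intro r hr
      have h1 := ((h.deriv_u r).pow 2).add ((h.deriv_p r hr).pow 2)
      have h2 : HasDerivAt (fun r => Real.exp (C * r)) (Real.exp (C * r) * C) r := by
        simpa using ((hasDerivAt_id r).const_mul C).exp
      refine (h1.mul h2).congr_deriv ?_
      simp
      ring
    have hmono : MonotoneOn (fun r => (u r ^ 2 + p r ^ 2) * Real.exp (C * r)) (Icc ε r₀) := by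
      refine monotoneOn_of_deriv_nonneg (convex_Icc _ _) ?_ ?_ ?_
      · intro r hr
        exact (hder r (hε.1.trans_le hr.1)).continuousAt.continuousWithinAt
      · intro r hr
        rw [interior_Icc] at hr
        exact (hder r (hε.1.trans hr.1)).differentiableAt.differentiableWithinAt
      · intro r hr
        rw [interior_Icc] at hr
        have hr0 : 0 < r := hε.1.trans hr.1
        rw [(hder r hr0).deriv]
        refine mul_nonneg ?_ (Real.exp_pos _).le
        have hv : |1 + (r ^ (2 * γ) - lam)| ≤ 1 + V := by
          have h1 : r ^ (2 * γ) ≤ r₀ ^ (2 * γ) := pow_le_pow_left₀ hr0.le hr.2.le _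
          have h2 : 0 ≤ r ^ (2 * γ) := by positivity
          rw [abs_le]
          constructor <;> linarith [neg_abs_le lam, le_abs_self lam]
        have hq : (d - 1) / r ≤ (d - 1) / ε :=
          div_le_div_of_nonneg_left (by linarith) hε.1 hr.1.le
        have h3 : -(1 + V) * (u r ^ 2 + p r ^ 2) ≤
            2 * (u r * p r) * (1 + (r ^ (2 * γ) - lam)) := by
          have h4 : |2 * (u r * p r)| ≤ u r ^ 2 + p r ^ 2 := by
            rw [abs_le]
            constructor <;> nlinarith [sq_nonneg (u r + p r), sq_nonneg (u r - p r)]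
          have h5 : |2 * (u r * p r) * (1 + (r ^ (2 * γ) - lam))| ≤
              (u r ^ 2 + p r ^ 2) * (1 + V) := by
            rw [abs_mul]
            exact mul_le_mul h4 hv (abs_nonneg _) (by positivity)
          linarith [(abs_le.1 h5).1]
        have h6 : 2 * ((d - 1) / r) * p r ^ 2 ≤ 2 * ((d - 1) / ε) * (u r ^ 2 + p r ^ 2) := by
          have : 0 ≤ ((d : ℝ) - 1) / ε := div_nonneg (by linarith) hε.1.le
          have h7 : (d - 1) / r * p r ^ 2 ≤ (d - 1) / ε * p r ^ 2 :=
            mul_le_mul_of_nonneg_right hq (sq_nonneg _)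
          have h8 : 0 ≤ ((d : ℝ) - 1) / ε * u r ^ 2 := mul_nonneg this (sq_nonneg _)
          linarith
        rw [hC]
        linarith
    have h1 := hmono (left_mem_Icc.2 hε.2.le) (right_mem_Icc.2 hε.2.le) hε.2.le
    simp only [hu, hp] at h1
    have h2 : u ε ^ 2 + p ε ^ 2 ≤ 0 := by
      by_contra! hc
      have := mul_pos hc (Real.exp_pos (C * ε))
      simp at h1
      linarith
    nlinarith [sq_nonneg (u ε), sq_nonneg (p ε)]
  have h1 : Tendsto u (𝓝[>] 0) (𝓝 (u 0)) := (h.cont_u.tendsto 0).mono_left nhdsWithin_le_nhds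
  have h2 : Tendsto u (𝓝[>] 0) (𝓝 0) := by
    refine tendsto_const_nhds.congr' ?_
    filter_upwards [Ioo_mem_nhdsGT hr₀] with ε hε
    exact (key ε hε).symm
  have := tendsto_nhds_unique h1 h2
  rw [h.u_zero] at this
  exact one_ne_zero this

/-- For large `λ`, the solution takes negative values. -/
lemma lam_le (h : IsRadial d γ lam u p) (hd : 1 ≤ d) (hu : ∀ r, 0 ≤ r → 0 ≤ u r) :
    lam ≤ 1 + (4 * d + 8) ^ 2 := by
  by_contra! hlam
  -- Weighted Wronskian of u with the trial function φ = (1 - r²)², for which Δφ = -(4d+8)(1-r²) +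
  -- 8. Its derivative is -r^{d-1} u ((λ - r^{2γ})φ + Δφ).
  have hcD : ∀ r, 0 < r → HasDerivAt
      (fun r => r ^ (d - 1) * (p r * (1 - r ^ 2) ^ 2 - u r * (-4 * r * (1 - r ^ 2))))
      (-(r ^ (d - 1) * (u r * ((lam - r ^ (2 * γ)) * (1 - r ^ 2) ^ 2 -
        (4 * d + 8) * (1 - r ^ 2) + 8)))) r := by
    intro r hr
    have e0 : HasDerivAt (fun r : ℝ => 1 - r ^ 2) (-(2 * r)) r := by
      simpa using (hasDerivAt_pow 2 r).const_sub 1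
    have e1 : HasDerivAt (fun r : ℝ => (1 - r ^ 2) ^ 2) (2 * (1 - r ^ 2) * (-(2 * r))) r := by
      refine (e0.pow 2).congr_deriv ?_
      norm_num
    have e2 : HasDerivAt (fun r : ℝ => -4 * r * (1 - r ^ 2))
        (-4 * (1 - r ^ 2) + -4 * r * (-(2 * r))) r := by
      refine (((hasDerivAt_id r).const_mul (-4)).mul e0).congr_deriv ?_
      norm_num
    have e3 : HasDerivAt (fun r : ℝ => r ^ (d - 1)) ((d - 1) / r * r ^ (d - 1)) r := by
      refine (hasDerivAt_pow (d - 1) r).congr_deriv ?_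
      rcases Nat.eq_zero_or_pos (d - 1) with h0 | h0
      · have : d = 1 := by omega
        simp [this]
      · obtain ⟨m, hm⟩ : ∃ m, d = m + 2 := ⟨d - 2, by omega⟩
        subst hm
        simp only [Nat.add_sub_cancel, show m + 2 - 1 = m + 1 by omega]
        field_simp
        push_cast
        ring
    refine (e3.mul (((h.deriv_p r hr).mul e1).sub ((h.deriv_u r).mul e2))).congr_deriv ?_
    simp only [Pi.sub_apply, Pi.mul_apply]
    field_simp
    ring
  set W : ℝ → ℝ :=
    fun r => r ^ (d - 1) * (p r * (1 - r ^ 2) ^ 2 - u r * (-4 * r * (1 - r ^ 2))) with hW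
  have hWc : Continuous W := by
    have := h.cont_u
    have := h.cont_p
    fun_prop
  have hpos : ∀ r ∈ Ioo (0 : ℝ) 1, 0 < (lam - r ^ (2 * γ)) * (1 - r ^ 2) ^ 2 -
      (4 * d + 8) * (1 - r ^ 2) + 8 := by
    intro r hr
    have h1 : r ^ (2 * γ) ≤ 1 := pow_le_one₀ hr.1.le hr.2.le
    have h2 : 0 < 1 - r ^ 2 := by nlinarith [hr.1, hr.2]
    have h3 : (4 * d + 8 : ℝ) ^ 2 * (1 - r ^ 2) ^ 2 ≤ (lam - r ^ (2 * γ)) * (1 - r ^ 2) ^ 2 :=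
      mul_le_mul_of_nonneg_right (by linarith) (sq_nonneg _)
    nlinarith [sq_nonneg ((4 * d + 8 : ℝ) * (1 - r ^ 2) - 1)]
  -- W decreases but vanishes at both ends, since φ has a double zero at 1. So W, its derivative and
  -- hence u vanish on (0, 1), against u(0) = 1.
  have hanti : AntitoneOn W (Icc 0 1) := by
    refine antitoneOn_of_deriv_nonpos (convex_Icc _ _) hWc.continuousOn ?_ ?_
    · intro r hr
      rw [interior_Icc] at hr
      exact (hcD r hr.1).differentiableAt.differentiableWithinAt
    · intro r hr
      rw [interior_Icc] at hr
      rw [(hcD r hr.1).deriv]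
      have := hpos r hr
      have := hu r hr.1.le
      have := hr.1
      rw [neg_nonpos]
      positivity
  have hW0 : W 0 = 0 := by simp [hW, h.p_zero]
  have hW1 : W 1 = 0 := by simp [hW]
  have hWz : ∀ r ∈ Icc (0 : ℝ) 1, W r = 0 := by
    intro r hr
    have h1 := hanti (left_mem_Icc.2 zero_le_one) hr hr.1
    have h2 := hanti hr (right_mem_Icc.2 zero_le_one) hr.2
    linarith
  have huz : ∀ r ∈ Ioo (0 : ℝ) 1, u r = 0 := by
    intro r hr
    have h1 : W =ᶠ[𝓝 r] fun _ => 0 := by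
      filter_upwards [Ioo_mem_nhds hr.1 hr.2] with x hx
      exact hWz x ⟨hx.1.le, hx.2.le⟩
    have h2 := (hcD r hr.1).unique ((hasDerivAt_const r (0 : ℝ)).congr_of_eventuallyEq h1)
    rw [neg_eq_zero, mul_eq_zero, mul_eq_zero] at h2
    have h3 := (hpos r hr).ne'
    have h4 := (pow_pos hr.1 (d - 1)).ne'
    tauto
  have h1 : Tendsto u (𝓝[>] 0) (𝓝 (u 0)) := (h.cont_u.tendsto 0).mono_left nhdsWithin_le_nhds
  have h2 : Tendsto u (𝓝[>] 0) (𝓝 0) := by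
    refine tendsto_const_nhds.congr' ?_
    filter_upwards [Ioo_mem_nhdsGT zero_lt_one] with ε hε
    exact (huz ε hε).symm
  have := tendsto_nhds_unique h1 h2
  rw [h.u_zero] at this
  exact one_ne_zero this

/-- In the classically forbidden region, a positive increasing solution stays positive. -/
lemma pos_of_increasing (h : IsRadial d γ lam u p) (hd : 1 ≤ d) {r₁ : ℝ} (hr₁ : 0 < r₁)
    (hlam : lam ≤ r₁ ^ (2 * γ)) (hu : 0 < u r₁) (hp : 0 < p r₁) : ∀ r, r₁ ≤ r → 0 < u r := by
  by_contra! hcon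
  obtain ⟨r, hr, hur⟩ := hcon
  set S : Set ℝ := {r | r₁ ≤ r ∧ u r ≤ 0} with hS
  have hSc : IsClosed S :=
    (isClosed_le continuous_const continuous_id).inter (isClosed_le h.cont_u continuous_const)
  have hSb : BddBelow S := ⟨r₁, fun x hx => hx.1⟩
  obtain ⟨h1, h2⟩ : sInf S ∈ S := hSc.csInf_mem ⟨r, hr, hur⟩ hSb
  set r₂ := sInf S
  have hbefore : ∀ x, r₁ ≤ x → x < r₂ → 0 < u x := by
    intro x hx hx2
    by_contra! hc
    exact absurd (csInf_le hSb ⟨hx, hc⟩) (not_le.2 hx2)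
  have hcD : ∀ r, 0 < r → HasDerivAt (fun r => r ^ (d - 1) * p r)
      (r ^ (d - 1) * ((r ^ (2 * γ) - lam) * u r)) r := by
    intro r hr
    have e3 : HasDerivAt (fun r : ℝ => r ^ (d - 1)) ((d - 1) / r * r ^ (d - 1)) r := by
      refine (hasDerivAt_pow (d - 1) r).congr_deriv ?_
      rcases Nat.eq_zero_or_pos (d - 1) with h0 | h0
      · have : d = 1 := by omega
        simp [this]
      · obtain ⟨m, hm⟩ : ∃ m, d = m + 2 := ⟨d - 2, by omega⟩
        subst hm
        simp only [show m + 2 - 1 = m + 1 by omega, Nat.add_sub_cancel]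
        field_simp
        push_cast
        ring
    refine (e3.mul (h.deriv_p r hr)).congr_deriv ?_
    ring
  -- Up to the first zero r₂ the flux r^{d-1}u' has the non-negative derivative r^{d-1}(r^{2γ} -
  -- λ)u, so u keeps increasing and cannot reach 0.
  have hmono : MonotoneOn (fun r => r ^ (d - 1) * p r) (Icc r₁ r₂) := by
    refine monotoneOn_of_deriv_nonneg (convex_Icc _ _) ?_ ?_ ?_
    · intro r hr
      exact (hcD r (hr₁.trans_le hr.1)).continuousAt.continuousWithinAt
    · intro r hr
      rw [interior_Icc] at hr
      exact (hcD r (hr₁.trans hr.1)).differentiableAt.differentiableWithinAt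
    · intro r hr
      rw [interior_Icc] at hr
      rw [(hcD r (hr₁.trans hr.1)).deriv]
      have h3 : r₁ ^ (2 * γ) ≤ r ^ (2 * γ) := pow_le_pow_left₀ hr₁.le hr.1.le _
      have h4 := hr₁.trans hr.1
      exact mul_nonneg (by positivity)
        (mul_nonneg (by linarith) (hbefore r hr.1.le hr.2).le)
  have hppos : ∀ r ∈ Icc r₁ r₂, 0 < p r := by
    intro r hr
    have h3 := hmono (left_mem_Icc.2 h1) hr hr.1
    simp only at h3
    have h4 : 0 < r ^ (d - 1) * p r := lt_of_lt_of_le (by positivity) h3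
    exact pos_of_mul_pos_right h4 (pow_pos (hr₁.trans_le hr.1) _).le
  have humono : MonotoneOn u (Icc r₁ r₂) := by
    refine monotoneOn_of_deriv_nonneg (convex_Icc _ _) h.cont_u.continuousOn ?_ ?_
    · intro r _
      exact (h.deriv_u r).differentiableAt.differentiableWithinAt
    · intro r hr
      rw [(h.deriv_u r).deriv]
      exact (hppos r (interior_subset hr)).le
  have := humono (left_mem_Icc.2 h1) (right_mem_Icc.2 h1) h1
  linarith

end IsRadial

/-- Existence of the ground state energy by shooting. -/
lemma exists_ground_energy (hd : 1 ≤ d) (γ : ℕ) : ∃ lam : ℝ, 0 ≤ lam ∧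
    (∀ r, 0 ≤ r → 0 < solU d γ lam (r ^ 2)) ∧
    ∀ r, 0 < r → lam < r ^ (2 * γ) → 2 * r * solU' d γ lam (r ^ 2) ≤ 0 := by
  set S : Set ℝ := {lam | ∀ r, 0 ≤ r → 0 ≤ solU d γ lam (r ^ 2)} with hS
  have hcu : Continuous fun q : ℝ × ℝ => solU d γ q.1 (q.2 ^ 2) :=
    (continuous_solU d γ).comp (continuous_fst.prodMk (continuous_snd.pow 2))
  have hcp : Continuous fun q : ℝ × ℝ => 2 * q.2 * solU' d γ q.1 (q.2 ^ 2) :=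
    (continuous_const.mul continuous_snd).mul
      ((continuous_solU' d γ).comp (continuous_fst.prodMk (continuous_snd.pow 2)))
  have hSc : IsClosed S := by
    have : S = ⋂ (r : ℝ) (_ : 0 ≤ r), {lam | 0 ≤ solU d γ lam (r ^ 2)} := by
      ext lam
      simp [hS]
    rw [this]
    exact isClosed_iInter fun r => isClosed_iInter fun _ => isClosed_le continuous_const
      (hcu.comp (continuous_id.prodMk continuous_const))
  have h0S : (0 : ℝ) ∈ S := fun r _ => zero_le_one.trans (one_le_solU (sq_nonneg r))
  have hSb : BddAbove S := ⟨_, fun lam hlam => (isRadial_solU hd lam).lam_le hd hlam⟩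
  have hmem : sSup S ∈ S := hSc.csSup_mem ⟨0, h0S⟩ hSb
  set lam := sSup S with hlam
  have hR := isRadial_solU (γ := γ) hd lam
  have hpos : ∀ r, 0 ≤ r → 0 < solU d γ lam (r ^ 2) := by
    intro r hr
    rcases hr.eq_or_lt with rfl | hr
    · simp [solU_zero]
    -- A zero of the non-negative limiting solution would be an interior minimum, hence a double
    -- zero.
    refine lt_of_le_of_ne (hmem r hr.le) fun h0 => ?_
    refine hR.not_double_zero hd hr h0.symm ?_
    have hmin : IsLocalMin (fun r => solU d γ lam (r ^ 2)) r := by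
      filter_upwards [lt_mem_nhds hr] with x hx
      rw [← h0]
      exact hmem x hx.le
    exact hmin.hasDerivAt_eq_zero (hR.deriv_u r)
  refine ⟨lam, le_csSup hSb h0S, hpos, fun r₁ hr₁ hl => ?_⟩
  by_contra! hp
  have hO : IsOpen {q : ℝ × ℝ | 0 < solU d γ q.1 (q.2 ^ 2)} := isOpen_lt continuous_const hcu
  -- If u increased at r₁ in the forbidden region, so would the solution at slightly larger
  -- energies. It would stay positive on [0, r₁] by compactness and beyond by `pos_of_increasing`,
  -- contradicting the supremum.
  obtain ⟨A, B, hA, _, hlA, hB, hAB⟩ := generalized_tube_lemma (s := {lam}) (t := Icc 0 r₁)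
    isCompact_singleton isCompact_Icc hO (by
      rintro ⟨l, r⟩ ⟨hl', hr'⟩
      rw [mem_singleton_iff] at hl'
      simp only at hl' hr'
      subst hl'
      exact hpos r hr'.1)
  have e1 : ∀ᶠ l in 𝓝 lam, l ∈ A := hA.mem_nhds (hlA rfl)
  have e2 : ∀ᶠ l in 𝓝 lam, 0 < 2 * r₁ * solU' d γ l (r₁ ^ 2) :=
    (hcp.comp (continuous_id.prodMk continuous_const)).tendsto lam |>.eventually (lt_mem_nhds hp)
  have e3 : ∀ᶠ l in 𝓝 lam, l < r₁ ^ (2 * γ) := gt_mem_nhds hl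
  have e4 : ∀ᶠ l in 𝓝[>] lam, l ∈ A ∧ 0 < 2 * r₁ * solU' d γ l (r₁ ^ 2) ∧ l < r₁ ^ (2 * γ) :=
    (e1.and (e2.and e3)).filter_mono nhdsWithin_le_nhds
  obtain ⟨l, ⟨hlA', hlp, hll⟩, hgt⟩ := (e4.and self_mem_nhdsWithin).exists
  have hbefore : ∀ r ∈ Icc 0 r₁, 0 < solU d γ l (r ^ 2) := fun r hr =>
    @hAB (l, r) ⟨hlA', hB hr⟩
  have hafter := (isRadial_solU (γ := γ) hd l).pos_of_increasing hd hr₁ hll.le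
    (hbefore r₁ (right_mem_Icc.2 hr₁.le)) hlp
  have hlS : l ∈ S := fun r hr => by
    rcases le_total r r₁ with hr' | hr'
    · exact (hbefore r ⟨hr, hr'⟩).le
    · exact (hafter r hr').le
  exact absurd (le_csSup hSb hlS) (not_le.2 hgt)

/-- Agmon-type decay of a positive, eventually decreasing solution. -/
lemma IsRadial.exists_decay (h : IsRadial d γ lam u p) (hd : 1 ≤ d) (hγ : 1 ≤ γ)
    (hu : ∀ r, 0 ≤ r → 0 < u r) (hp : ∀ r, 0 < r → lam < r ^ (2 * γ) → p r ≤ 0) :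
    ∃ C κ : ℝ, 0 < κ ∧ ∀ r, 0 ≤ r → u r ≤ C * Real.exp (-κ * r ^ (γ + 1)) := by
  have hd' : (1 : ℝ) ≤ d := by exact_mod_cast hd
  -- With κ(γ+1) = 1/2, e^{κ r^{γ+1}} is the integrating factor for u' + ½ r^γ u.
  set κ : ℝ := 1 / (2 * (γ + 1)) with hκ
  have hκ0 : 0 < κ := by positivity
  have hκ1 : κ * (γ + 1) = 1 / 2 := by
    rw [hκ]
    field_simp
  -- Beyond r₀ one has r^{2γ} ≥ r > 2λ, which leaves room for half of the potential.
  set r₀ : ℝ := 1 + 2 * |lam| with hr₀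
  have hr₀1 : 1 ≤ r₀ := by
    have := abs_nonneg lam
    linarith
  have hfar : ∀ r, r₀ ≤ r → 2 * lam < r ^ (2 * γ) := by
    intro r hr
    have h1 : 1 ≤ r := hr₀1.trans hr
    have h2 : r ≤ r ^ (2 * γ) := le_self_pow₀ h1 (by omega)
    linarith [le_abs_self lam]
  have hfar' : ∀ r, r₀ ≤ r → lam < r ^ (2 * γ) := by
    intro r hr
    have h1 := hfar r hr
    have h2 : 0 ≤ r ^ (2 * γ) := pow_nonneg (by linarith) _
    linarith
  have hexp : ∀ (c r : ℝ), HasDerivAt (fun r => Real.exp (c * r ^ (γ + 1)))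
      (Real.exp (c * r ^ (γ + 1)) * (c * ((γ + 1) * r ^ γ))) r := by
    intro c r
    have := ((hasDerivAt_pow (γ + 1) r).const_mul c).exp
    simpa using this
  set w : ℝ → ℝ := fun r => p r + 1 / 2 * r ^ γ * u r with hw
  have hder : ∀ r, 0 < r → HasDerivAt (fun r => w r * Real.exp (-κ * r ^ (γ + 1)))
      ((((r ^ (2 * γ) - lam) * u r - (d - 1) / r * p r +
        (1 / 2 * (γ * r ^ (γ - 1)) * u r + 1 / 2 * r ^ γ * p r)) - 1 / 2 * r ^ γ * w r) *
          Real.exp (-κ * r ^ (γ + 1))) r := by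
    intro r hr
    have h1 := (h.deriv_p r hr).add (((hasDerivAt_pow γ r).const_mul (1 / 2)).mul (h.deriv_u r))
    refine (h1.mul (hexp (-κ) r)).congr_deriv ?_
    simp only [hw, Pi.add_apply, Pi.mul_apply]
    linear_combination (-(p r + 1 / 2 * r ^ γ * u r) * Real.exp (-κ * r ^ (γ + 1)) * r ^ γ) * hκ1
  -- If w were positive at r₁ ≥ r₀, then w e^{-κ r^{γ+1}} would stay above a positive constant. But
  -- u' ≤ 0 and u is bounded there, so w grows at most polynomially.
  have hw0 : ∀ r, r₀ ≤ r → w r ≤ 0 := by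
    by_contra! hcon
    obtain ⟨r₁, hr₁, hw1⟩ := hcon
    have hr₁1 : 1 ≤ r₁ := hr₀1.trans hr₁
    have hmono : MonotoneOn (fun r => w r * Real.exp (-κ * r ^ (γ + 1))) (Ici r₁) := by
      refine monotoneOn_of_deriv_nonneg (convex_Ici _) ?_ ?_ ?_
      · intro r hr
        have : 0 < r := by linarith [mem_Ici.1 hr]
        exact (hder r this).continuousAt.continuousWithinAt
      · intro r hr
        rw [interior_Ici] at hr
        have : 0 < r := by linarith [mem_Ioi.1 hr]
        exact (hder r this).differentiableAt.differentiableWithinAt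
      · intro r hr
        rw [interior_Ici, mem_Ioi] at hr
        have hr0 : 0 < r := by linarith
        have hrr : r₀ ≤ r := by linarith
        rw [(hder r hr0).deriv]
        refine mul_nonneg ?_ (Real.exp_pos _).le
        have h1 := hfar r hrr
        have h2 := hp r hr0 (hfar' r hrr)
        have h3 := hu r hr0.le
        have h4 : 0 ≤ (d - 1) / r * (-p r) :=
          mul_nonneg (div_nonneg (by linarith) hr0.le) (by linarith)
        have h5 : 0 ≤ 1 / 2 * (γ * r ^ (γ - 1)) * u r := by positivity
        have h6 : 0 ≤ (r ^ (2 * γ) / 2 - lam) * u r := mul_nonneg (by linarith) h3.le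
        have h7 : r ^ (2 * γ) = r ^ γ * r ^ γ := by rw [two_mul, pow_add]
        simp only [hw]
        rw [h7] at h6 ⊢
        have h8 : 0 ≤ r ^ γ * r ^ γ * u r := by positivity
        nlinarith
    set c := w r₁ * Real.exp (-κ * r₁ ^ (γ + 1)) with hc
    have hc0 : 0 < c := mul_pos hw1 (Real.exp_pos _)
    have hub : ∀ r, r₁ ≤ r → u r ≤ u r₁ := by
      intro r hr
      have : AntitoneOn u (Ici r₁) := by
        refine antitoneOn_of_deriv_nonpos (convex_Ici _) h.cont_u.continuousOn ?_ ?_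
        · intro r _
          exact (h.deriv_u r).differentiableAt.differentiableWithinAt
        · intro r hr
          rw [interior_Ici, mem_Ioi] at hr
          rw [(h.deriv_u r).deriv]
          exact hp r (by linarith) (hfar' r (by linarith))
      exact this self_mem_Ici hr hr
    have hbd : ∀ r, r₁ ≤ r → c ≤ 1 / 2 * u r₁ * (r ^ (γ + 1) * Real.exp (-κ * r ^ (γ + 1))) := by
      intro r hr
      have hr1 : 1 ≤ r := hr₁1.trans hr
      have h1 : c ≤ w r * Real.exp (-κ * r ^ (γ + 1)) := hmono self_mem_Ici hr hr
      have h2 : w r ≤ 1 / 2 * u r₁ * r ^ (γ + 1) := by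
        have h3 := hp r (by linarith) (hfar' r (by linarith))
        have h4 : r ^ γ ≤ r ^ (γ + 1) := pow_le_pow_right₀ hr1 (by omega)
        have h5 : r ^ γ * u r ≤ r ^ (γ + 1) * u r₁ :=
          mul_le_mul h4 (hub r hr) (hu r (by linarith)).le (by positivity)
        simp only [hw]
        linarith
      calc c ≤ _ := h1
        _ ≤ 1 / 2 * u r₁ * r ^ (γ + 1) * Real.exp (-κ * r ^ (γ + 1)) := by gcongr
        _ = _ := by ring
    have hlim : Tendsto (fun r : ℝ => 1 / 2 * u r₁ * (r ^ (γ + 1) * Real.exp (-κ * r ^ (γ + 1))))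
        atTop (𝓝 (1 / 2 * u r₁ * 0)) := by
      refine Tendsto.const_mul _ ?_
      have h1 : Tendsto (fun x : ℝ => x * Real.exp (-κ * x)) atTop (𝓝 0) := by
        have := tendsto_rpow_mul_exp_neg_mul_atTop_nhds_zero 1 κ hκ0
        simpa using this
      exact h1.comp (tendsto_pow_atTop (by omega))
    rw [mul_zero] at hlim
    have := ge_of_tendsto hlim (eventually_atTop.2 ⟨r₁, hbd⟩)
    linarith
  have hder2 : ∀ r, HasDerivAt (fun r => u r * Real.exp (κ * r ^ (γ + 1)))
      (w r * Real.exp (κ * r ^ (γ + 1))) r := by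
    intro r
    refine ((h.deriv_u r).mul (hexp κ r)).congr_deriv ?_
    simp only [hw]
    linear_combination (u r * Real.exp (κ * r ^ (γ + 1)) * r ^ γ) * hκ1
  have hanti : AntitoneOn (fun r => u r * Real.exp (κ * r ^ (γ + 1))) (Ici r₀) := by
    refine antitoneOn_of_deriv_nonpos (convex_Ici _) ?_ ?_ ?_
    · exact fun r _ => (hder2 r).continuousAt.continuousWithinAt
    · exact fun r _ => (hder2 r).differentiableAt.differentiableWithinAt
    · intro r hr
      rw [(hder2 r).deriv]
      exact mul_nonpos_of_nonpos_of_nonneg (hw0 r (interior_subset hr)) (Real.exp_pos _).le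
  have hcont : ContinuousOn (fun r => u r * Real.exp (κ * r ^ (γ + 1))) (Icc 0 r₀) :=
    fun r _ => (hder2 r).continuousAt.continuousWithinAt
  obtain ⟨C, hC⟩ := isCompact_Icc.bddAbove_image hcont
  refine ⟨C, κ, hκ0, fun r hr => ?_⟩
  have hall : u r * Real.exp (κ * r ^ (γ + 1)) ≤ C := by
    rcases le_total r r₀ with hr' | hr'
    · exact hC ⟨r, ⟨hr, hr'⟩, rfl⟩
    · exact (hanti self_mem_Ici hr' hr').trans (hC ⟨r₀, ⟨by linarith, le_rfl⟩, rfl⟩)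
  rw [neg_mul, Real.exp_neg, ← div_eq_mul_inv, le_div_iff₀ (Real.exp_pos _)]
  exact hall

/-- The ground state of `-Δ + |x|^{2γ}`, in the variable `|x|²`. -/
theorem exists_ground_state (hd : 1 ≤ d) (hγ : 1 ≤ γ) : ∃ (lam C κ : ℝ) (U U' U'' : ℝ → ℝ),
    0 ≤ lam ∧ 0 < κ ∧ ContDiff ℝ ∞ U ∧ U 0 = 1 ∧ (∀ x, HasDerivAt U (U' x) x) ∧
    (∀ x, HasDerivAt U' (U'' x) x) ∧
    (∀ x, 4 * x * U'' x + 2 * d * U' x = (x ^ γ - lam) * U x) ∧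
    ∀ r, 0 ≤ r → |U (r ^ 2)| ≤ C * Real.exp (-κ * r ^ (γ + 1)) := by
  obtain ⟨lam, hlam, hpos, hdec⟩ := exists_ground_energy hd γ
  obtain ⟨C, κ, hκ, hC⟩ := (isRadial_solU (γ := γ) hd lam).exists_decay hd hγ hpos hdec
  refine ⟨lam, C, κ, solU d γ lam, solU' d γ lam, solU'' d γ lam, hlam, hκ, contDiff_solU lam,
    solU_zero lam, hasDerivAt_solU lam, hasDerivAt_solU' lam, solU_ode hd lam, fun r hr => ?_⟩
  rw [abs_of_pos (hpos r hr)]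
  exact hC r hr

end GroundState

/-! ### Concentrating eigenfunctions and the failure of controllability. -/

section Concentration

open Topology Filter
open scoped ComplexConjugate InnerProductSpace

variable {d γ : ℕ}

/-- The Laplacian of the rescaled radial function `x ↦ U(N²|x|²)`. -/
lemma lap_radial {U U' U'' : ℝ → ℝ} (h1 : ∀ x, HasDerivAt U (U' x) x)
    (h2 : ∀ x, HasDerivAt U' (U'' x) x) (N : ℝ) (x : E d) :
    lap (fun x : E d => (U (N ^ 2 * ‖x‖ ^ 2) : ℂ)) x =
      ((N ^ 2 * (4 * (N ^ 2 * ‖x‖ ^ 2) * U'' (N ^ 2 * ‖x‖ ^ 2) +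
        2 * d * U' (N ^ 2 * ‖x‖ ^ 2)) : ℝ) : ℂ) := by
  have hline : ∀ x w : E d, HasDerivAt (fun t : ℝ => x + t • w) w 0 := fun x w => by
    simpa using ((hasDerivAt_id (0 : ℝ)).smul_const w).const_add x
  have hsq : ∀ x w : E d, HasDerivAt (fun t : ℝ => N ^ 2 * ‖x + t • w‖ ^ 2)
      (N ^ 2 * (2 * inner ℝ x w)) 0 := fun x w => by
    have := (hline x w).norm_sq.const_mul (N ^ 2)
    simpa using this
  have hsq0 : ∀ x w : E d, N ^ 2 * ‖x + (0 : ℝ) • w‖ ^ 2 = N ^ 2 * ‖x‖ ^ 2 := fun x w => by simp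
  have d1 : ∀ w : E d, lineD w (fun x : E d => (U (N ^ 2 * ‖x‖ ^ 2) : ℂ)) =
      fun x => ((U' (N ^ 2 * ‖x‖ ^ 2) * (N ^ 2 * (2 * inner ℝ x w)) : ℝ) : ℂ) := by
    intro w
    ext x
    have := (h1 _).comp_of_eq (0 : ℝ) (hsq x w) (hsq0 x w).symm
    exact this.ofReal_comp.deriv
  have d2 : ∀ w : E d, lineD w (lineD w (fun x : E d => (U (N ^ 2 * ‖x‖ ^ 2) : ℂ))) x =
      ((U'' (N ^ 2 * ‖x‖ ^ 2) * (N ^ 2 * (2 * inner ℝ x w)) * (N ^ 2 * (2 * inner ℝ x w)) +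
        U' (N ^ 2 * ‖x‖ ^ 2) * (N ^ 2 * (2 * ‖w‖ ^ 2)) : ℝ) : ℂ) := by
    intro w
    rw [d1]
    have e1 := (h2 _).comp_of_eq (0 : ℝ) (hsq x w) (hsq0 x w).symm
    have e2 : HasDerivAt (fun t : ℝ => N ^ 2 * (2 * inner ℝ (x + t • w) w))
        (N ^ 2 * (2 * ‖w‖ ^ 2)) 0 := by
      have := ((((hline x w).inner ℝ (hasDerivAt_const (0 : ℝ) w)).const_mul 2).const_mul (N ^ 2))
      simpa using this
    have e3 := (e1.mul e2).ofReal_comp.deriv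
    simp only [Pi.mul_apply, Function.comp, zero_smul, add_zero] at e3
    exact e3
  simp only [lap, d2, ← Complex.ofReal_sum]
  congr 1
  have hn : ∀ i : Fin d, ‖(stdVec i : E d)‖ = 1 := fun i => by simp
  have hi : ∀ i : Fin d, inner ℝ x (stdVec i) = x i := fun i => by
    simp [EuclideanSpace.inner_single_right]
  have hs : ∑ i, x i ^ 2 = ‖x‖ ^ 2 := (EuclideanSpace.real_norm_sq_eq x).symm
  simp only [hn, hi, Finset.sum_add_distrib]
  have e4 : ∀ i, U'' (N ^ 2 * ‖x‖ ^ 2) * (N ^ 2 * (2 * x i)) * (N ^ 2 * (2 * x i)) =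
      U'' (N ^ 2 * ‖x‖ ^ 2) * N ^ 4 * 4 * x i ^ 2 := fun i => by ring
  simp only [e4, ← Finset.mul_sum, hs]
  simp
  ring

/-- Since γ+1 ≥ 2, r^{γ+1} ≥ r² - 1 for all r ≥ 0, which gives domination by a Gaussian. -/
lemma integrable_exp_neg_norm_pow (d : ℕ) {γ : ℕ} (hγ : 1 ≤ γ) {κ : ℝ} (hκ : 0 < κ) :
    Integrable fun x : E d => Real.exp (-κ * ‖x‖ ^ (γ + 1)) := by
  have h1 : Integrable fun x : E d => Real.exp κ * Real.exp (-κ * ‖x‖ ^ 2) := by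
    have h2 := (GaussianFourier.integrable_cexp_neg_mul_sq_norm_add (V := E d) (b := κ)
      (by simpa using hκ) 0 0).norm
    refine Integrable.const_mul (h2.congr (Eventually.of_forall fun x => ?_)) _
    beta_reduce
    rw [Complex.norm_exp]
    congr 1
    simp [← Complex.ofReal_pow, ← Complex.ofReal_mul, ← Complex.ofReal_neg]
  refine h1.mono' (Continuous.aestronglyMeasurable (by fun_prop)) (Eventually.of_forall fun x => ?_)
  rw [Real.norm_of_nonneg (Real.exp_pos _).le, ← Real.exp_add]
  refine Real.exp_le_exp.2 ?_
  have h3 : ‖x‖ ^ 2 - 1 ≤ ‖x‖ ^ (γ + 1) := by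
    rcases le_total 1 ‖x‖ with h | h
    · have := pow_le_pow_right₀ h (by omega : 2 ≤ γ + 1)
      linarith
    · have : ‖x‖ ^ 2 ≤ 1 := pow_le_one₀ (norm_nonneg _) h
      have : 0 ≤ ‖x‖ ^ (γ + 1) := by positivity
      linarith
  nlinarith

lemma norm_sq_eq_integral (f : L2 d) {F : Space d → ℂ} (hf : f =ᵐ[volume] F) :
    ‖f‖ ^ 2 = ∫ p, ‖F p‖ ^ 2 := by
  rw [← re_inner_self, inner_eq_integral f f hf hf]
  simp_rw [Complex.mul_conj, Complex.normSq_eq_norm_sq]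
  rw [integral_complex_ofReal, Complex.ofReal_re]

/-- A set whose closure does not meet `{x = 0}` stays away from it. -/
lemma exists_dist_pos {ω : Set (Space d)} (hdist : closure ω ∩ {p : Space d | p.1 = 0} = ∅) :
    ∃ δ : ℝ, 0 < δ ∧ ∀ p ∈ ω, δ ≤ ‖p.1‖ := by
  have hK : IsCompact ({0} ×ˢ univ : Set (Space d)) := isCompact_singleton.prod isCompact_univ
  have hdisj : Disjoint ({0} ×ˢ univ : Set (Space d)) (closure ω) := by
    rw [Set.disjoint_left]
    rintro p ⟨hp, _⟩ hpω
    have : p ∈ closure ω ∩ {p : Space d | p.1 = 0} := ⟨hpω, hp⟩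
    rw [hdist] at this
    exact this
  -- Compactness of the torus makes {x = 0} compact, so disjointness from a closed set gives a
  -- positive distance.
  obtain ⟨δ, hδ, hth⟩ := hdisj.exists_thickenings hK isClosed_closure
  refine ⟨δ, hδ, fun p hp => ?_⟩
  by_contra! hlt
  have hmem : p ∈ Metric.thickening δ ({0} ×ˢ univ : Set (Space d)) := by
    refine Metric.mem_thickening_iff.2 ⟨(0, p.2), ⟨rfl, mem_univ _⟩, ?_⟩
    rw [Prod.dist_eq, dist_self, dist_zero_right]
    simpa [hδ] using hlt
  exact Set.disjoint_left.1 hth hmem (Metric.self_subset_thickening hδ _ (subset_closure hp))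

lemma coeFn_cutoff {X : Type*} [MeasurableSpace X] {μ : Measure X} {ω : Set X}
    (hω : NullMeasurableSet ω μ) (u : Lp ℂ 2 μ) : cutoff hω u =ᵐ[μ] ω.indicator u :=
  MemLp.coeFn_toLp _

lemma inner_cutoff {X : Type*} [MeasurableSpace X] {μ : Measure X} {ω : Set X}
    (hω : NullMeasurableSet ω μ) (u v : Lp ℂ 2 μ) :
    ⟪u, cutoff hω v⟫_ℂ = ⟪cutoff hω u, v⟫_ℂ := by
  rw [L2.inner_def, L2.inner_def]
  refine integral_congr_ae ?_
  filter_upwards [coeFn_cutoff hω u, coeFn_cutoff hω v] with x h1 h2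
  rw [h1, h2]
  by_cases hx : x ∈ ω <;> simp [hx]

/-- Eigenfunctions of `-Δ_γ` concentrating at `x = 0`. -/
theorem exists_concentrating_eigenfunctions (hd : 1 ≤ d) (hγ : 1 ≤ γ) {ω : Set (Space d)}
    (hω : NullMeasurableSet ω volume) (hdist : closure ω ∩ {p : Space d | p.1 = 0} = ∅) :
    ∃ (lam A c K : ℝ) (f : ℕ → L2 d), 0 ≤ lam ∧ 0 < c ∧ 0 < K ∧
      ∀ N : ℕ, 1 ≤ N →
        (f N, ((lam * N ^ 2 : ℝ) : ℂ) • f N) ∈ grushinGraph d γ ∧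
        ‖f N‖ ^ 2 = K / N ^ d ∧ ‖cutoff hω (f N)‖ ≤ A * Real.exp (-c * N ^ (γ + 1)) := by
  obtain ⟨lam, C, κ, U, U', U'', hlam, hκ, hUs, hU0, hU1, hU2, hode, hdecay⟩ :=
    exists_ground_state (d := d) (γ := γ) hd hγ
  obtain ⟨δ, hδ, hδω⟩ := exists_dist_pos hdist
  set i₀ : Fin d := ⟨0, hd⟩
  -- With frequency N^{γ+1} the potential is N^{2γ+2}|x|^{2γ} = N²(N|x|)^{2γ}, so x ↦ Nx reduces it
  -- to the fixed operator with eigenvalue scaled by N². The frequency must be an integer, and it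
  -- is.
  let n : ℕ → Fin d → ℤ := fun N => Pi.single i₀ ((N : ℤ) ^ (γ + 1))
  let g : ℕ → E d → ℂ := fun N x => (U ((N : ℝ) ^ 2 * ‖x‖ ^ 2) : ℂ)
  let F : ℕ → Space d → ℂ := fun N => separated (g N) (n N)
  have hgs : ∀ N, ContDiff ℝ ((⊤ : ℕ∞) : WithTop ℕ∞) (g N) := fun N =>
    Complex.ofRealCLM.contDiff.comp (hUs.comp (contDiff_const.mul (contDiff_norm_sq ℝ)))
  have hFs : ∀ N, SmoothVia (cover d) (F N) := fun N => smoothVia_separated _ (hgs N)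
  have hFc : ∀ N, Continuous (F N) := fun N => (hFs N).continuous isOpenQuotientMap_cover
  have hFn : ∀ N p, ‖F N p‖ = |U ((N * ‖p.1‖) ^ 2)| := fun N p => by
    simp only [F, g, separated, norm_mul, norm_mode, mul_one, Complex.norm_real, Real.norm_eq_abs,
      mul_pow]
  have hFb : ∀ N p, ‖F N p‖ ≤ C * Real.exp (-κ * (N * ‖p.1‖) ^ (γ + 1)) := fun N p => by
    rw [hFn]
    exact hdecay _ (by positivity)
  have hC : 0 ≤ C := by
    have := hdecay 0 le_rfl
    simp only [ne_eq, Nat.add_eq_zero_iff, one_ne_zero, and_false, not_false_eq_true, zero_pow,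
      mul_zero, Real.exp_zero, mul_one] at this
    exact (abs_nonneg _).trans this
  -- the square of the bound
  have hFb2 : ∀ N p, ‖F N p‖ ^ 2 ≤ C ^ 2 * Real.exp (-(2 * κ) * (N * ‖p.1‖) ^ (γ + 1)) := by
    intro N p
    refine (pow_le_pow_left₀ (norm_nonneg _) (hFb N p) 2).trans (le_of_eq ?_)
    rw [mul_pow, ← Real.exp_nat_mul]
    congr 2
    push_cast
    ring
  have hgi : Integrable fun p : Space d => Real.exp (-κ * ‖p.1‖ ^ (γ + 1)) :=
    (integrable_exp_neg_norm_pow d hγ hκ).comp_fst (volume : Measure (Torus d))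
  set M := ∫ p : Space d, Real.exp (-κ * ‖p.1‖ ^ (γ + 1)) with hM
  -- Half of the exponent 2κ(N|x|)^{γ+1} gives decay in N at distance η, the other half
  -- integrability in x. It is used with η = 0 for membership in L² and η = δ on ω.
  have hsplit : ∀ N : ℕ, 1 ≤ N → ∀ (p : Space d) (η : ℝ), 0 ≤ η → η ≤ ‖p.1‖ →
      ‖F N p‖ ^ 2 ≤ C ^ 2 * Real.exp (-(κ * η ^ (γ + 1)) * N ^ (γ + 1)) *
        Real.exp (-κ * ‖p.1‖ ^ (γ + 1)) := by
    intro N hN p η hη0 hη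
    refine (hFb2 N p).trans ?_
    rw [mul_assoc, ← Real.exp_add]
    refine mul_le_mul_of_nonneg_left (Real.exp_le_exp.2 ?_) (sq_nonneg _)
    have hN' : (1 : ℝ) ≤ N := by exact_mod_cast hN
    have h1 : η ^ (γ + 1) ≤ ‖p.1‖ ^ (γ + 1) := pow_le_pow_left₀ hη0 hη _
    have h2 : 1 ≤ (N : ℝ) ^ (γ + 1) := one_le_pow₀ hN'
    have h3 : 0 ≤ ‖p.1‖ ^ (γ + 1) := by positivity
    have h4 : η ^ (γ + 1) * (N : ℝ) ^ (γ + 1) ≤ ‖p.1‖ ^ (γ + 1) * (N : ℝ) ^ (γ + 1) :=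
      mul_le_mul_of_nonneg_right h1 (by positivity)
    have h5 : ‖p.1‖ ^ (γ + 1) ≤ ‖p.1‖ ^ (γ + 1) * (N : ℝ) ^ (γ + 1) := le_mul_of_one_le_right h3 h2
    rw [mul_pow]
    nlinarith
  have hF2i : ∀ N : ℕ, 1 ≤ N → Integrable fun p => ‖F N p‖ ^ 2 := by
    intro N hN
    refine (hgi.const_mul (C ^ 2)).mono' ((hFc N).norm.pow 2).aestronglyMeasurable
      (Eventually.of_forall fun p => ?_)
    rw [Real.norm_of_nonneg (by positivity)]
    simpa using hsplit N hN p 0 le_rfl (norm_nonneg _)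
  have hFm : ∀ N : ℕ, 1 ≤ N → MemLp (F N) 2 := fun N hN =>
    (memLp_two_iff_integrable_sq_norm (hFc N).aestronglyMeasurable).2 (hF2i N hN)
  let f : ℕ → L2 d := fun N => if hN : 1 ≤ N then (hFm N hN).toLp (F N) else 0
  have hf : ∀ N, 1 ≤ N → f N =ᵐ[volume] F N := fun N hN => by
    simp only [f, dif_pos hN]
    exact MemLp.coeFn_toLp _
  have hΔ : ∀ N p, grushinLaplacian d γ (F N) p = -((lam * N ^ 2 : ℝ) : ℂ) * F N p := by
    intro N p
    have hsum : ∑ i, ((n N i : ℤ) : ℂ) ^ 2 = (N : ℂ) ^ (2 * (γ + 1)) := by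
      rw [Finset.sum_eq_single i₀]
      · simp only [n, Pi.single_eq_same]
        push_cast
        ring
      · intro j _ hj
        simp [n, hj]
      · simp
    rw [grushinLaplacian_separated _ γ (hgs N), hsum, lap_radial hU1 hU2 N p.1, hode]
    simp only [F, g, separated]
    push_cast
    ring
  -- The square root and the factor 1/2 appear because the estimates are made on squared norms.
  refine ⟨lam, Real.sqrt (C ^ 2 * M), κ * δ ^ (γ + 1) / 2,
    (volume : Measure (Torus d)).real univ * ∫ x : E d, U (‖x‖ ^ 2) ^ 2, f, hlam, by positivity,
    ?_, fun N hN => ⟨?_, ?_, ?_⟩⟩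
  · refine mul_pos ?_ ?_
    · exact ENNReal.toReal_pos (isOpen_univ.measure_pos _ univ_nonempty).ne' (measure_ne_top _ _)
    · have hcont : Continuous fun x : E d => U (‖x‖ ^ 2) ^ 2 :=
        (hUs.continuous.comp (continuous_norm.pow 2)).pow 2
      have hint : Integrable fun x : E d => U (‖x‖ ^ 2) ^ 2 := by
        have h1 := integrable_exp_neg_norm_pow d hγ (by positivity : 0 < 2 * κ)
        refine (h1.const_mul (C ^ 2)).mono' hcont.aestronglyMeasurable
          (Eventually.of_forall fun x => ?_)
        have h2 := hFb2 1 (x, 0)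
        rw [hFn] at h2
        simpa using h2
      rw [integral_pos_iff_support_of_nonneg (fun x => sq_nonneg _) hint]
      refine (hcont.isOpen_support).measure_pos _ ⟨0, ?_⟩
      simp [hU0]
  · intro φ hφ
    have h1 := integral_mul_grushinLaplacian γ (hFs N) hφ
    have h2 : ∫ p, f N p * -grushinLaplacian d γ φ p = -∫ p, F N p * grushinLaplacian d γ φ p := by
      rw [← integral_neg]
      refine integral_congr_ae ?_
      filter_upwards [hf N hN] with p hp
      rw [hp]
      ring
    have h3 : ∫ p, (((lam * N ^ 2 : ℝ) : ℂ) • f N) p * φ p =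
        -∫ p, grushinLaplacian d γ (F N) p * φ p := by
      rw [← integral_neg]
      refine integral_congr_ae ?_
      filter_upwards [hf N hN, Lp.coeFn_smul ((lam * N ^ 2 : ℝ) : ℂ) (f N)] with p hp hp2
      rw [hp2, Pi.smul_apply, hp, hΔ, smul_eq_mul]
      ring
    rw [h2, h3, h1]
  · rw [norm_sq_eq_integral _ (hf N hN)]
    simp_rw [hFn, sq_abs]
    have hN0 : (N : ℝ) ≠ 0 := by positivity
    have e1 : ∫ p : Space d, U ((N * ‖p.1‖) ^ 2) ^ 2 =
        (volume : Measure (Torus d)).real univ • ∫ x : E d, U ((N * ‖x‖) ^ 2) ^ 2 :=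
      integral_fun_fst (μ := volume) (ν := volume) fun x : E d => U ((N * ‖x‖) ^ 2) ^ 2
    have e2 : ∫ x : E d, U ((N * ‖x‖) ^ 2) ^ 2 =
        |((N : ℝ) ^ d)⁻¹| • ∫ x : E d, U (‖x‖ ^ 2) ^ 2 := by
      have := Measure.integral_comp_smul (volume : Measure (E d))
        (fun x : E d => U (‖x‖ ^ 2) ^ 2) (N : ℝ)
      rw [finrank_euclideanSpace_fin] at this
      rw [← this]
      simp [norm_smul]
    rw [e1, e2, abs_of_nonneg (by positivity)]
    simp only [smul_eq_mul]
    field_simp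
  · have hcut : cutoff hω (f N) =ᵐ[volume] ω.indicator (F N) := by
      filter_upwards [coeFn_cutoff hω (f N), hf N hN] with p h1 h2
      rw [h1]
      by_cases hp : p ∈ ω <;> simp [hp, h2]
    have hle : ‖cutoff hω (f N)‖ ^ 2 ≤
        C ^ 2 * M * Real.exp (-(κ * δ ^ (γ + 1)) * N ^ (γ + 1)) := by
      rw [norm_sq_eq_integral _ hcut]
      have e : C ^ 2 * M * Real.exp (-(κ * δ ^ (γ + 1)) * N ^ (γ + 1)) =
          ∫ p : Space d, C ^ 2 * Real.exp (-(κ * δ ^ (γ + 1)) * N ^ (γ + 1)) *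
            Real.exp (-κ * ‖p.1‖ ^ (γ + 1)) := by
        rw [integral_const_mul]
        ring
      rw [e]
      refine integral_mono_of_nonneg (Eventually.of_forall fun p => by positivity)
        (hgi.const_mul _) (Eventually.of_forall fun p => ?_)
      simp only
      by_cases hp : p ∈ ω
      · rw [indicator_of_mem hp]
        exact hsplit N hN p δ hδ.le (hδω p hp)
      · rw [indicator_of_notMem hp, norm_zero, zero_pow two_ne_zero]
        positivity
    have hM0 : 0 ≤ C ^ 2 * M :=
      mul_nonneg (sq_nonneg _) (integral_nonneg fun p => (Real.exp_pos _).le)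
    refine (pow_le_pow_iff_left₀ (norm_nonneg _) (by positivity) two_ne_zero).1 ?_
    rw [mul_pow, Real.sq_sqrt hM0, ← Real.exp_nat_mul]
    refine hle.trans (le_of_eq ?_)
    congr 2
    push_cast
    ring

/-- A sub-critical power cannot compensate for exponential decay. -/
lemma tendsto_pow_mul_exp (d γ : ℕ) {s a c : ℝ} (hs : s < (1 + γ) / 2) (hc : 0 < c) :
    Tendsto (fun N : ℕ => (N : ℝ) ^ d * Real.exp (2 * (a * (N : ℝ) ^ (2 * s) - c * N ^ (γ + 1))))
      atTop (𝓝 0) := by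
  have h1 : Tendsto (fun x : ℝ => x ^ d * Real.exp (-x)) atTop (𝓝 0) :=
    Real.tendsto_pow_mul_exp_neg_atTop_nhds_zero d
  have h1' : Tendsto (fun x : ℝ => x ^ d * Real.exp (-(c * x))) atTop (𝓝 0) := by
    have := tendsto_rpow_mul_exp_neg_mul_atTop_nhds_zero d c hc
    simpa using this
  have h2 : Tendsto (fun x : ℝ => a * x ^ (2 * s - (γ + 1))) atTop (𝓝 0) := by
    have := (tendsto_rpow_neg_atTop (y := (γ + 1) - 2 * s) (by linarith)).const_mul a
    simpa using this
  -- Eventually a x^{2s} ≤ (c/2) x^{γ+1}, so the exponent is at most -c x^{γ+1} ≤ -c x.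
  have h3 : ∀ᶠ x : ℝ in atTop,
      x ^ d * Real.exp (2 * (a * x ^ (2 * s) - c * x ^ (γ + 1))) ≤ x ^ d * Real.exp (-(c * x)) := by
    filter_upwards [h2.eventually (gt_mem_nhds (half_pos hc)), eventually_ge_atTop 1] with x hx hx1
    have hx0 : 0 < x := by linarith
    refine mul_le_mul_of_nonneg_left (Real.exp_le_exp.2 ?_) (by positivity)
    have e1 : a * x ^ (2 * s) = a * x ^ (2 * s - (γ + 1)) * x ^ (γ + 1) := by
      rw [mul_assoc, ← Real.rpow_natCast x (γ + 1), ← Real.rpow_add hx0]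
      push_cast
      ring_nf
    have e2 : x ≤ x ^ (γ + 1) := le_self_pow₀ hx1 (by omega)
    have e3 : a * x ^ (2 * s - (γ + 1)) * x ^ (γ + 1) ≤ c / 2 * x ^ (γ + 1) :=
      mul_le_mul_of_nonneg_right hx.le (by positivity)
    rw [e1]
    nlinarith
  refine squeeze_zero' (Eventually.of_forall fun N => by positivity)
    (tendsto_natCast_atTop_atTop.eventually h3) (h1'.comp tendsto_natCast_atTop_atTop)

/-- The control cost estimate on an eigenvector. -/
lemma norm_inner_le_of_controlled {γ : ℕ} {s T m : ℝ} (hs : 0 < s) (hT : 0 < T) (hm : 0 ≤ m)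
    {ω : Set (Space d)} (hω : NullMeasurableSet ω volume) {v : L2 d}
    (hv : (v, (m : ℂ) • v) ∈ grushinGraph d γ) {f₀ : L2 d} {h : ℝ → L2 d}
    (hh : MemLp h 2 (volume.restrict (Ioo 0 T)))
    (hzero : mildSolution (grushinSemigroup d γ s) f₀ (fun τ => cutoff hω (h τ)) T = 0) :
    ‖⟪v, f₀⟫_ℂ‖ ≤ Real.exp (T * m ^ s) * (‖cutoff hω v‖ * ∫ τ in Ioo 0 T, ‖h τ‖) := by
  obtain ⟨R, hR, hsa, hspec⟩ := exists_isResolvent_grushinGraph d γ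
  set S := grushinSemigroup d γ s with hS
  have hSv : ∀ t, 0 < t → S t v = (Real.exp (-t * m ^ s) : ℂ) • v := fun t ht =>
    fracSemigroup_apply_of_mem hR hsa hspec hs ht hm hv
  have hSin : ∀ t, 0 < t → ∀ w, ⟪v, S t w⟫_ℂ = (Real.exp (-t * m ^ s) : ℂ) * ⟪v, w⟫_ℂ := by
    intro t ht w
    have h1 : ⟪S t v, w⟫_ℂ = ⟪v, S t w⟫_ℂ :=
      (ContinuousLinearMap.isSelfAdjoint_iff_isSymmetric.1
        (isSelfAdjoint_fracSemigroup (grushinGraph d γ) s t)) v w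
    rw [← h1, hSv t ht, inner_smul_left, Complex.conj_ofReal]
  have hhi : IntegrableOn (fun τ => ‖h τ‖) (Ioo 0 T) := (hh.integrable one_le_two).norm
  set J := ∫ τ in Ioo 0 T, ‖h τ‖ with hJ
  have hJ0 : 0 ≤ J := integral_nonneg fun τ => norm_nonneg _
  have hint : ‖⟪v, ∫ τ in (0 : ℝ)..T, S (T - τ) (cutoff hω (h τ))⟫_ℂ‖ ≤ ‖cutoff hω v‖ * J := by
    rw [intervalIntegral.integral_of_le hT.le, integral_Ioc_eq_integral_Ioo]
    -- Integrability of the Duhamel integrand need not be proved: otherwise its Bochner integral is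
    -- 0 by convention and the bound is trivial.
    by_cases hi : IntegrableOn (fun τ => S (T - τ) (cutoff hω (h τ))) (Ioo 0 T)
    · rw [← integral_inner hi, hJ, ← integral_const_mul]
      refine norm_integral_le_of_norm_le (hhi.const_mul _) ?_
      filter_upwards [ae_restrict_mem measurableSet_Ioo] with τ hτ
      rw [hSin (T - τ) (by linarith [hτ.2]), inner_cutoff, norm_mul]
      refine (mul_le_of_le_one_left (norm_nonneg _) ?_).trans (norm_inner_le_norm _ _)
      rw [Complex.norm_real, Real.norm_of_nonneg (Real.exp_pos _).le, Real.exp_le_one_iff]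
      have h1 : 0 ≤ m ^ s := Real.rpow_nonneg hm s
      nlinarith [hτ.2]
    · rw [integral_undef hi, inner_zero_right, norm_zero]
      positivity
  have hsum : ⟪v, S T f₀⟫_ℂ = -⟪v, ∫ τ in (0 : ℝ)..T, S (T - τ) (cutoff hω (h τ))⟫_ℂ := by
    rw [eq_neg_iff_add_eq_zero, ← inner_add_right]
    exact (congrArg (fun w => ⟪v, w⟫_ℂ) hzero).trans (inner_zero_right _)
  have h1 : ‖⟪v, S T f₀⟫_ℂ‖ ≤ ‖cutoff hω v‖ * J := by
    rw [hsum, norm_neg]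
    exact hint
  rw [hSin T hT, norm_mul, Complex.norm_real, Real.norm_of_nonneg (Real.exp_pos _).le, neg_mul,
    Real.exp_neg, inv_mul_le_iff₀ (Real.exp_pos _)] at h1
  exact h1

/-- The fractional Grushin heat equation is not null-controllable away from `{x = 0}`. -/
theorem not_exactlyNullControllable_grushinSemigroup (hd : 1 ≤ d) (hγ : 1 ≤ γ) {s : ℝ} (hs : 0 < s)
    (hsγ : s < (1 + (γ : ℝ)) / 2) {ω : Set (Space d)}
    (hω : NullMeasurableSet ω volume)
    (hdist : closure ω ∩ {p : Space d | p.1 = 0} = ∅)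
    {T : ℝ} (hT : 0 < T) :
    ¬ ExactlyNullControllable (grushinSemigroup d γ s) hω T := by
  intro hctrl
  obtain ⟨lam, A, c, K, f, hlam, hc, hK, hf⟩ :=
    exists_concentrating_eigenfunctions hd hγ hω hdist
  have hA : ∀ N : ℕ, 1 ≤ N → 0 ≤ A * Real.exp (-c * (N : ℝ) ^ (γ + 1)) := fun N hN =>
    (norm_nonneg _).trans (hf N hN).2.2
  have hpow : ∀ N : ℕ, (lam * (N : ℝ) ^ 2) ^ s = lam ^ s * (N : ℝ) ^ (2 * s) := fun N => by
    rw [Real.mul_rpow hlam (by positivity), Real.rpow_mul (by positivity)]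
    norm_num
  let q : ℕ → ℝ := fun N => T * lam ^ s * (N : ℝ) ^ (2 * s) - c * (N : ℝ) ^ (γ + 1)
  -- e^{q(N)} is the growth the cost estimate allows for ⟨v_N, f₀⟩, so dividing by it gives
  -- pointwise bounded functionals. The shift by one skips N = 0, for which no eigenfunction is
  -- provided.
  let g : ℕ → L2 d →L[ℂ] ℂ := fun N =>
    ((Real.exp (-q (N + 1)) : ℝ) : ℂ) • innerSL ℂ (f (N + 1))
  have hbd : ∀ f₀ : L2 d, ∃ C, ∀ N, ‖g N f₀‖ ≤ C := by
    intro f₀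
    obtain ⟨h, hh, hzero⟩ := hctrl f₀
    set J := ∫ τ in Ioo 0 T, ‖h τ‖ with hJ
    have hJ0 : 0 ≤ J := integral_nonneg fun τ => norm_nonneg _
    refine ⟨A * J, fun N => ?_⟩
    obtain ⟨h1, -, h3⟩ := hf (N + 1) (by omega)
    have h4 := norm_inner_le_of_controlled hs hT (by positivity) hω h1 hh hzero
    rw [hpow] at h4
    have h5 : ‖g N f₀‖ = Real.exp (-q (N + 1)) * ‖inner ℂ (f (N + 1)) f₀‖ := by
      simp only [g, smul_apply, innerSL_apply_apply, norm_smul, Complex.norm_real,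
        Real.norm_of_nonneg (Real.exp_pos _).le]
    rw [h5]
    have h6 : Real.exp (T * (lam ^ s * ((N + 1 : ℕ) : ℝ) ^ (2 * s))) *
        (‖cutoff hω (f (N + 1))‖ * J) ≤ Real.exp (q (N + 1)) * (A * J) := by
      calc _ ≤ Real.exp (T * (lam ^ s * ((N + 1 : ℕ) : ℝ) ^ (2 * s))) *
            (A * Real.exp (-c * ((N + 1 : ℕ) : ℝ) ^ (γ + 1)) * J) := by gcongr
        _ = (Real.exp (T * (lam ^ s * ((N + 1 : ℕ) : ℝ) ^ (2 * s))) *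
            Real.exp (-c * ((N + 1 : ℕ) : ℝ) ^ (γ + 1))) * (A * J) := by ring
        _ = _ := by
          rw [← Real.exp_add]
          congr 2
          simp only [q]
          ring
    rw [Real.exp_neg, inv_mul_le_iff₀ (Real.exp_pos _)]
    exact h4.trans h6
  obtain ⟨C, hC⟩ := banach_steinhaus hbd
  -- The uniform bound on the functionals reads ‖v_N‖ ≤ C e^{q(N)}; squaring and using ‖v_N‖² =
  -- K/N^d bounds the positive constant K by a sequence tending to 0.
  have hle : ∀ N : ℕ, K ≤ C ^ 2 * (((N + 1 : ℕ) : ℝ) ^ d * Real.exp (2 * q (N + 1))) := by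
    intro N
    obtain ⟨-, h2, -⟩ := hf (N + 1) (by omega)
    have h1 := hC N
    simp only [g, norm_smul, Complex.norm_real, Real.norm_of_nonneg (Real.exp_pos _).le,
      innerSL_apply_norm] at h1
    rw [Real.exp_neg, inv_mul_le_iff₀ (Real.exp_pos _)] at h1
    have h3 := pow_le_pow_left₀ (norm_nonneg _) h1 2
    rw [h2, div_le_iff₀ (by positivity), mul_pow, ← Real.exp_nat_mul] at h3
    refine h3.trans (le_of_eq ?_)
    push_cast
    ring
  have hlim := (((tendsto_pow_mul_exp d γ (a := T * lam ^ s) hsγ hc).comp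
    (tendsto_add_atTop_nat 1)).const_mul (C ^ 2))
  rw [mul_zero] at hlim
  exact absurd (ge_of_tendsto' hlim hle) (not_le.2 hK)

end Concentration

end BaouendiGrushin

end

theorem theorem2p15 (d γ : ℕ) (hd : 1 ≤ d) (hγ : 1 ≤ γ) (s : ℝ) (hs : 0 < s)
    (hsγ : s < (1 + (γ : ℝ)) / 2) (ω : Set (BaouendiGrushin.Space d))
    (hω : NullMeasurableSet ω volume)
    (hdist : closure ω ∩ {p : BaouendiGrushin.Space d | p.1 = 0} = ∅)
    (T : ℝ) (hT : 0 < T) :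
    ¬ BaouendiGrushin.ExactlyNullControllable (BaouendiGrushin.grushinSemigroup d γ s) hω T :=
  BaouendiGrushin.not_exactlyNullControllable_grushinSemigroup hd hγ hs hsγ hω hdist hT
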